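/- **Setting.** Let $N\ge K\ge 1$ be integers, $M\ge 0$ real, $\alpha\in[0,1]$, $\gamma=M/N$. A transmitter with $K$ antennas and a library of $N$ independent uniform files of $B$ bits serves $K$ single-antenna users. User $k$ has a cache of at most $MB$ bits, filled as a function of the library before the requests are known. Then user $k$ requests a file $W_{R_k}$, and the transmitter uses the channel $n$ times; at time $t$ user $k$ receives $y_{k,t}=h_{k,t}^{T}x_t+z_{k,t}$, where the $z_{k,t}$ are i.i.d. $\mathcal{CN}(0,1)$, $h_{k,t}\in\mathbb C^K$ is random fading, $\mathbb E\|x_t\|^2\le P$, and library, noise and fading are independent. The transmitted $x_t$ is a function of the requests, the library, the current and earlier estimates $\hat h_{k,\tau}$ ($\tau\le t$, all $k$) and, as delayed CSIT, the exact channels $h_{k,\tau}$ ($\tau<t$, all $k$). User $k$ reconstructs its file from its cache, its received signals, the requests, and all channels and estimates. **Channel and CSIT quality.** The joint law of channels and estimates may depend on $P$. For every $k$, $\mathbb E\|h_{k,t}-\hat h_{k,t}\|^2=\sigma_k^2(P)$ for all $t$, with $-\lim_{P\to\infty}\log\sigma_k^2(P)/\log P=\alpha$. For $P>1$, the second moments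 $\mathbb E\|h_{k,t}\|^2$ are bounded uniformly in $P,k,t$; the error $(h_{k,t}-\hat h_{k,t})_k$ is independent of $(\hat h_{k,\tau})_{k,\tau\le t}$ and $(h_{k,\tau})_{k,\tau<t}$, and its entries (over users and antennas) are mutually independent, each with a density bounded by $C/\sigma_k^2(P)$ for a constant $C$ (as for Gaussian errors). The law is otherwise arbitrary. **Optimal delivery time.** Time is measured in slots, where a slot carries $\log_2P$ bits of a file to a single user: $T\geq 0$ is achievable at power $P$ if, for every $\varepsilon>0$, there are schemes with arbitrarily large $B$ and with $n\le T\,B/\log_2P$ for which, for every request vector $(R_1,\dots,R_K)$, all users recover their files except with probability at most $\varepsilon$. Let $T^*_P$ be the infimum of the achievable $T$ ($\infty$ if there is none), and $T^*(\gamma,\alpha)=\liminf_{P\to\infty}T^*_P$. **Claim.** With $H_s=\sum_{i=1}^s\frac1i$, for every integer $s$ with $1\le s\le K$ and $sM\le N$, $$T^*(\gamma,\alpha)\ \ge\ \frac{1}{H_s\alpha+1-\alpha}\Bigl(H_s-\frac{Ms}{\lfloor N/s\rfloor}\Bigr).$$ In particular, if $M>0$ and $KM\ge N$ then $T^*(\gamma,\alpha)$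 is at least the maximum of the right-hand side over $s\in\{1,\dots,\lfloor N/M\rfloor\}$. -/

import Mathlib

open MeasureTheory ProbabilityTheory Filter
open scoped ENNReal NNReal Topology

/-- Channel coefficients of all users in one channel use: row `k` is the vector
`h_k ∈ ℂ^K` from the `K` transmit antennas to the (single-antenna) user `k`. -/
abbrev CSI (K : ℕ) : Type := Fin K → Fin K → ℂ

/-- A realization of the fading process and of its current estimates:
at time `t`, `(ω t).1` is the transmitter's estimate `ĥ` and `(ω t).2` is the channel `h`. -/
abbrev FadingPath (K : ℕ) : Type := ℕ → CSI K × CSI K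

/-- The entry, for user `k` and antenna `i`, of the estimation error `h - ĥ` at time `t`. -/
def csiError {K : ℕ} (t : ℕ) (k i : Fin K) (ω : FadingPath K) : ℂ :=
  (ω t).2 k i - (ω t).1 k i

/-- What the feedback has revealed when the channel is used at time `t`: the current and earlier
estimates `ĥ_0, …, ĥ_t` and, as delayed CSIT, the exact earlier channels `h_0, …, h_{t-1}`. (A delay of one channel use is the most favourable
one: a longer delay reveals less, so it only removes schemes.) -/
def feedback {K : ℕ} (t : ℕ) (ω : FadingPath K) : (Fin (t + 1) → CSI K) × (Fin t → CSI K) :=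
  (fun τ => (ω τ).1, fun τ => (ω τ).2)

/-- Random fading with current CSIT of quality exponent `α`: for each power `P` a law of the
fading process and its estimates, such that the mean-square error of every user's estimate decays
as `P ^ (-α)` in the sense `α = - lim log E‖h_k - ĥ_k‖² / log P`. The fading and its estimates may
be correlated in time and their distributions are not prescribed. The regularity required is:
second moments bounded uniformly in `P`; and an estimation error that is fresh with respect to
the current and delayed CSIT, with independent entries, each with a density of height at most
a constant times `1 / E‖h_k - ĥ_k‖²` (as for Gaussian errors). -/
structure FadingModel (K : ℕ) (α : ℝ) where
  /-- The joint law of channels and estimates at power `P`. -/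
  law : ℝ → Measure (FadingPath K)
  isProb : ∀ P, IsProbabilityMeasure (law P)
  secondMoment_le : ∃ C : ℝ≥0, ∀ P, 1 < P → ∀ k t,
    ∫⁻ ω, ∑ i, ‖(ω t).2 k i‖ₑ ^ 2 ∂(law P) ≤ C
  /-- `E‖h_k - ĥ_k‖²` at power `P`. -/
  mse : Fin K → ℝ → ℝ≥0
  mse_eq : ∀ P, 1 < P → ∀ k t, ∫⁻ ω, ∑ i, ‖csiError t k i ω‖ₑ ^ 2 ∂(law P) = mse k P
  quality : ∀ k, Tendsto (fun P => -(Real.log (mse k P) / Real.log P)) atTop (𝓝 α)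
  error_indep_feedback : ∀ P, 1 < P → ∀ t,
    IndepFun (fun ω k i => csiError t k i ω) (feedback t) (law P)
  error_iIndep : ∀ P, 1 < P → ∀ t,
    iIndepFun (fun (ki : Fin K × Fin K) ω => csiError t ki.1 ki.2 ω) (law P)
  error_density : ∃ C : ℝ≥0, ∀ P, 1 < P → ∀ k t i,
    (law P).map (csiError t k i) ≤ ((C / mse k P : ℝ≥0) : ℝ≥0∞) • volume

/-- Unit-power circularly symmetric complex Gaussian noise. -/
noncomputable def awgn : Measure ℂ :=
  ((gaussianReal 0 (1 / 2)).prod (gaussianReal 0 (1 / 2))).map Complex.measurableEquivRealProd.symm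

/-- A file of `B` bits. -/
abbrev File (B : ℕ) : Type := Fin B → Bool

/-- A library of `N` files of `B` bits each. -/
abbrev Library (N B : ℕ) : Type := Fin N → File B

/-- A caching and delivery scheme for `K` users and a library of `N` files of `B` bits,
with caches of `q` possible contents and a delivery phase of `n` channel uses. -/
structure Scheme (K N B q n : ℕ) where
  /-- Placement: the content of the cache of user `k`, which cannot depend on the requests. -/
  place : Fin K → Library N B → Fin q
  /-- Delivery: the vector sent from the antennas at time `t`, as a function of the requests, the
  library, and the current and delayed CSIT. -/
  encode : (Fin K → Fin N) → (t : Fin n) → Library N B →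
    (Fin (t + 1) → CSI K) × (Fin t → CSI K) → Fin K → ℂ
  measurable_encode : ∀ R t W, Measurable (encode R t W)
  /-- Reconstruction by user `k` from the requests, the user's cache, the user's received signal,
  and (perfect, global) channel knowledge at the receiver. -/
  decode : (Fin K → Fin N) → Fin K → Fin q →
    (Fin n → ℂ) × (Fin n → CSI K × CSI K) → File B
  measurable_decode : ∀ R k c, Measurable (decode R k c)

/-- The sources of randomness of the delivery phase: library, fading, receiver noise. -/
abbrev Outcome (K N B n : ℕ) : Type :=
  Library N B × FadingPath K × (Fin n → Fin K → ℂ)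

/-- The joint law: the files are independent and uniform, the noise is white, and library, fading
and noise are independent of each other. -/
noncomputable def outcomeLaw {K : ℕ} {α : ℝ} (F : FadingModel K α) (P : ℝ) (N B n : ℕ) :
    Measure (Outcome K N B n) :=
  (uniformOn Set.univ).prod
    ((F.law P).prod (Measure.pi fun _ => Measure.pi fun _ => awgn))

namespace Scheme

variable {K N B q n : ℕ} (S : Scheme K N B q n)

/-- The transmitted vector at time `t`. -/
def sent (R : Fin K → Fin N) (t : Fin n) (o : Outcome K N B n) : Fin K → ℂ :=
  S.encode R t o.1 (feedback t o.2.1)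

/-- The signal `y_k = h_k^T x + z_k` received by user `k` at time `t`. -/
def received (R : Fin K → Fin N) (k : Fin K) (o : Outcome K N B n) (t : Fin n) : ℂ :=
  (∑ i, (o.2.1 t).2 k i * S.sent R t o i) + o.2.2 t k

/-- The file reconstructed by user `k`. -/
def output (R : Fin K → Fin N) (k : Fin K) (o : Outcome K N B n) : File B :=
  S.decode R k (S.place k o.1) (S.received R k o, fun t => o.2.1 t)

/-- The power constraint `E‖x‖² ≤ P`, for every request and every transmission. -/
def PowerConstraint {α : ℝ} (F : FadingModel K α) (P : ℝ) : Prop :=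
  ∀ R t, ∫⁻ o, ∑ i, ‖S.sent R t o i‖ₑ ^ 2 ∂(outcomeLaw F P N B n) ≤ ENNReal.ofReal P

/-- The probability that, for the requests `R`, some user fails to reconstruct its file. -/
noncomputable def errorProb {α : ℝ} (F : FadingModel K α) (P : ℝ) (R : Fin K → Fin N) : ℝ≥0∞ :=
  outcomeLaw F P N B n {o | ∃ k, S.output R k o ≠ o.1 (R k)}

end Scheme

/-- Delivery in `T` time slots per file served per user is achievable at power `P`, where each
cache holds `M` files' worth of bits: for all requests, files of arbitrarily large size `B` can be
delivered with arbitrarily small error probability in at most `T * (B / log₂ P)` channel uses.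
One time slot is thus the time, to leading order in `P`, in which a file can be sent to a single
user without caching and interference; files of `log₂ P` bits per slot are the normalization. -/
def AchievableTime {K : ℕ} {α : ℝ} (F : FadingModel K α) (N : ℕ) (M P : ℝ) (T : ℝ≥0) : Prop :=
  ∀ ε : ℝ, 0 < ε → ∀ B₀ : ℕ, ∃ B q n : ℕ, B₀ ≤ B ∧ (q : ℝ) ≤ 2 ^ (M * B) ∧
    (n : ℝ) * Real.logb 2 P ≤ T * B ∧
    ∃ S : Scheme K N B q n, S.PowerConstraint F P ∧ ∀ R, S.errorProb F P R ≤ ENNReal.ofReal ε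

/-- The optimal delivery time at power `P` (infinite if no delivery time is achievable). -/
noncomputable def optimalTimeAt {K : ℕ} {α : ℝ} (F : FadingModel K α) (N : ℕ) (M P : ℝ) : ℝ≥0∞ :=
  ⨅ (T : ℝ≥0) (_ : AchievableTime F N M P T), (T : ℝ≥0∞)

/-- The optimal delivery time `T*` in the high-power regime. The lower limit is taken as `P → ∞`,
so that existence of the limit is not presupposed. -/
noncomputable def optimalTime {K : ℕ} {α : ℝ} (F : FadingModel K α) (N : ℕ) (M : ℝ) : ℝ≥0∞ :=
  liminf (fun P : ℝ => optimalTimeAt F N M P) atTop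

/-! The proof is an entropy converse. With D = ⌊N/s⌋, take D rounds of requests in which the first s
users ask for Ds distinct files altogether. For one round, let f(k,m) be the differential entropy of
the signals of the first m users given the fading, the caches of the first k users and all files
that these k users request over the D rounds. The cache and the signals of user k (counted from 0)
determine its file up to small error, so Fano's inequality (`condEntropy_sub_ge_of_decode`), summed
over the rounds, bounds the sum of f(k,k+1) - f(k+1,k+1) below by about D B log 2 - (k+1) log q,
with log q ≤ M B log 2. The weights 1/(k+1) turn this into D B H_s log 2 - s log q.

On the other side f(0,1) is at most about n log P, and f(k,k+1)/(k+1) exceeds f(k,k)/k by at most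
about n α log P/(k+1). The weighted sum therefore telescopes (`sum_entropy_diff_le`) to at most
about n log P (1 + (H_s - 1) α) per round, and 1 + (H_s - 1) α = H_s α + 1 - α.

The core is the comparison of users in `FadingModel.condEntropy_succ_le`. Both sides are measured by
`concentration`, the posterior mean of 1/(1 + ‖x - x'‖²) for the true input x and an input x'
resampled from the posterior. A fresh channel error with density at most C/σ² makes two inputs look
alike to a given user with average likelihood at most κ/(1 + ‖x - x'‖²), where κ = `errorGain` is of
order at most P^α up to a small exponent. Hence a new signal of an earlier user has entropy at least
-E log(concentration) - log κ. Conversely, a posterior mixture of heavy-tailed densities, used as a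
competitor in Gibbs' inequality, shows that a signal of the further user has entropy at most (1+ε)
times -E log(concentration), plus a constant. Comparing the further user with each of the k earlier
ones and summing by the chain rule gives the bound. All entropies are expected logarithms of
explicit finite mixtures of Gaussian densities, over a finite message set partitioned by what is
conditioned on. -/

/-! ### Complex Gaussian noise -/

/-- The density of unit-power circularly symmetric complex Gaussian noise. -/
noncomputable def noiseDensity (z : ℂ) : ℝ := Real.pi⁻¹ * Real.exp (-‖z‖ ^ 2)

lemma noiseDensity_pos (z : ℂ) : 0 < noiseDensity z := by unfold noiseDensity; positivity

/-- Because 1/π < 1, every likelihood and every mixture is at most one, so all logarithms below are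
nonpositive and all entropies nonnegative. -/
lemma noiseDensity_le_one (z : ℂ) : noiseDensity z ≤ 1 := by
  unfold noiseDensity
  have h1 : Real.pi⁻¹ ≤ 1 := inv_le_one_of_one_le₀ (by linarith [Real.pi_gt_three])
  have h2 : Real.exp (-‖z‖ ^ 2) ≤ 1 := Real.exp_le_one_iff.2 (by nlinarith [sq_nonneg ‖z‖])
  exact mul_le_one₀ h1 (Real.exp_pos _).le h2

@[fun_prop]
lemma measurable_noiseDensity : Measurable noiseDensity := by unfold noiseDensity; fun_prop

lemma log_noiseDensity (z : ℂ) : Real.log (noiseDensity z) = -Real.log Real.pi - ‖z‖ ^ 2 := by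
  unfold noiseDensity
  rw [Real.log_mul (by positivity) (Real.exp_pos _).ne', Real.log_exp, Real.log_inv]; ring

lemma awgn_eq_withDensity :
    awgn = (volume : Measure ℂ).withDensity fun z => ENNReal.ofReal (noiseDensity z) := by
  have hv : (1 / 2 : ℝ≥0) ≠ 0 := by norm_num
  unfold awgn
  rw [gaussianReal_of_var_ne_zero _ hv,
    prod_withDensity (measurable_gaussianPDF _ _) (measurable_gaussianPDF _ _)]
  have hmp := Complex.volume_preserving_equiv_real_prod.symm
  rw [← hmp.map_eq]
  ext s hs
  rw [Measure.map_apply (MeasurableEquiv.measurable _) hs, withDensity_apply _ hs,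
    withDensity_apply _ (MeasurableEquiv.measurable _ hs),
    setLIntegral_map hs (by fun_prop) (MeasurableEquiv.measurable _)]
  refine lintegral_congr fun p => ?_
  rw [gaussianPDF, gaussianPDF, ← ENNReal.ofReal_mul (gaussianPDFReal_nonneg _ _ _)]
  congr 1
  have hn : ‖Complex.measurableEquivRealProd.symm p‖ ^ 2 = p.1 ^ 2 + p.2 ^ 2 := by
    rw [← Complex.normSq_eq_norm_sq, Complex.normSq_apply]
    change p.1 * p.1 + p.2 * p.2 = _
    ring
  unfold gaussianPDFReal noiseDensity
  rw [hn, show -(p.1 ^ 2 + p.2 ^ 2) = -p.1 ^ 2 + -p.2 ^ 2 by ring, Real.exp_add]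
  -- Each real component has variance 1/2, hence normalization 1/√π.
  have hpi : (√(2 * Real.pi * ((1 / 2 : ℝ≥0) : ℝ)))⁻¹ * (√(2 * Real.pi * ((1 / 2 : ℝ≥0) : ℝ)))⁻¹
      = Real.pi⁻¹ := by
    rw [← mul_inv, Real.mul_self_sqrt (by positivity)]
    congr 1; push_cast; ring
  have e1 : ∀ x : ℝ, -(x - 0) ^ 2 / (2 * ((1 / 2 : ℝ≥0) : ℝ)) = -x ^ 2 := by
    intro x; push_cast; ring
  rw [e1, e1, ← hpi]; ring

instance : IsProbabilityMeasure awgn := by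
  unfold awgn
  exact Measure.isProbabilityMeasure_map (by fun_prop)

lemma lintegral_noiseDensity_comp (m : ℂ) :
    ∫⁻ z, ENNReal.ofReal (noiseDensity (z - m)) = 1 := by
  rw [lintegral_sub_right_eq_self (fun z => ENNReal.ofReal (noiseDensity z)) m]
  have h := measure_univ (μ := awgn)
  rwa [awgn_eq_withDensity, withDensity_apply _ MeasurableSet.univ, Measure.restrict_univ] at h

lemma map_add_awgn (m : ℂ) : awgn.map (fun z => m + z) =
    (volume : Measure ℂ).withDensity fun z => ENNReal.ofReal (noiseDensity (z - m)) := by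
  ext s hs
  rw [Measure.map_apply (by fun_prop) hs, awgn_eq_withDensity,
    withDensity_apply _ (measurable_const_add m hs), withDensity_apply _ hs,
    ← lintegral_indicator hs, ← lintegral_indicator (measurable_const_add m hs),
    ← lintegral_add_left_eq_self
      (s.indicator fun z => ENNReal.ofReal (noiseDensity (z - m))) m]
  refine lintegral_congr fun z => ?_
  by_cases hz : m + z ∈ s
  · rw [Set.indicator_of_mem (show z ∈ (fun x => m + x) ⁻¹' s from hz),
      Set.indicator_of_mem hz, add_sub_cancel_left]
  · rw [Set.indicator_of_notMem (show z ∉ (fun x => m + x) ⁻¹' s from hz),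
      Set.indicator_of_notMem hz]

/-- Multiplication by d scales area in the plane by ‖d‖². This decay is what makes distinct inputs
distinguishable through an unknown channel coefficient. -/
lemma lintegral_noiseDensity_affine_le (b d : ℂ) (hd : d ≠ 0) :
    ∫⁻ v, ENNReal.ofReal (noiseDensity (b + v * d)) ≤ ENNReal.ofReal (1 / ‖d‖ ^ 2) := by
  have hd' : 0 < ‖d‖ := norm_pos_iff.2 hd
  have e : ∀ v, noiseDensity (b + v * d)
      = Real.pi⁻¹ * Real.exp (-‖d‖ ^ 2 * ‖v + b / d‖ ^ 2) := by
    intro v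
    unfold noiseDensity
    rw [show b + v * d = d * (v + b / d) by field_simp; ring, norm_mul]
    ring_nf
  simp_rw [e]
  rw [lintegral_add_right_eq_self (fun v : ℂ =>
    ENNReal.ofReal (Real.pi⁻¹ * Real.exp (-‖d‖ ^ 2 * ‖v‖ ^ 2))) (b / d)]
  have hI := GaussianFourier.integral_rexp_neg_mul_sq_norm (V := ℂ) (b := ‖d‖ ^ 2) (by positivity)
  -- A non-integrable function has Bochner integral 0 by default, which the positive value in `hI`
  -- excludes.
  have hint : Integrable (fun v : ℂ => Real.exp (-‖d‖ ^ 2 * ‖v‖ ^ 2)) := by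
    by_contra h
    rw [integral_undef h] at hI
    have : 0 < (Real.pi / ‖d‖ ^ 2) ^ ((Module.finrank ℝ ℂ : ℝ) / 2) := by positivity
    linarith
  rw [← ofReal_integral_eq_lintegral_ofReal (hint.const_mul _)
    (ae_of_all _ fun v => by positivity), integral_const_mul, hI]
  refine ENNReal.ofReal_le_ofReal ?_
  rw [Complex.finrank_real_complex]
  norm_num
  field_simp
  rfl

lemma integrable_normSq_awgn : Integrable (fun z : ℂ => ‖z‖ ^ 2) awgn := by
  unfold awgn
  have hx : Integrable (fun x : ℝ => x ^ 2) (gaussianReal 0 (1 / 2)) :=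
    (memLp_id_gaussianReal 2).integrable_sq
  rw [integrable_map_equiv]
  have hn : ((fun z : ℂ => ‖z‖ ^ 2) ∘ Complex.measurableEquivRealProd.symm)
      = fun p : ℝ × ℝ => p.1 ^ 2 + p.2 ^ 2 := by
    ext p
    simp only [Function.comp]
    rw [← Complex.normSq_eq_norm_sq, Complex.normSq_apply]
    change p.1 * p.1 + p.2 * p.2 = _
    ring
  rw [hn]
  exact (hx.comp_fst _).add (hx.comp_snd _)

/-- Noise that is independent over users and over time is independent over all (time, user)
pairs. -/
lemma map_uncurry_awgn (n K : ℕ) :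
    (Measure.pi fun _ : Fin n => Measure.pi fun _ : Fin K => awgn).map
      (fun z (a : Fin n × Fin K) => z a.1 a.2) = Measure.pi fun _ => awgn := by
  refine (Measure.pi_eq fun s hs => ?_).symm
  rw [Measure.map_apply (by fun_prop) (MeasurableSet.univ_pi hs)]
  have : (fun (z : Fin n → Fin K → ℂ) (a : Fin n × Fin K) => z a.1 a.2) ⁻¹' Set.univ.pi s
      = Set.univ.pi fun t => Set.univ.pi fun k => s (t, k) := by
    ext z; simp [Set.mem_pi]
  rw [this, Measure.pi_pi]
  simp_rw [Measure.pi_pi]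
  exact (Fintype.prod_prod_type (fun a : Fin n × Fin K => awgn (s a))).symm

/-! ### A heavy-tailed reference density on the complex plane -/

/-- The mass of the unnormalized heavy-tailed reference density. -/
noncomputable def tailMass (ε : ℝ) : ℝ := ∫ y : ℂ, (1 + ‖y‖ ^ 2) ^ (-(1 + ε))

/-- A heavy-tailed probability density on the complex plane. -/
noncomputable def tailDensity (ε : ℝ) (y : ℂ) : ℝ := (tailMass ε)⁻¹ * (1 + ‖y‖ ^ 2) ^ (-(1 + ε))

/-- The plane has real dimension 2, so a decay of exponent 2 is borderline and ε > 0 is needed. This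
is the source of the factors 1 + ε below, which disappear only in the final limit. -/
lemma integrable_tail {ε : ℝ} (hε : 0 < ε) :
    Integrable (fun y : ℂ => (1 + ‖y‖ ^ 2) ^ (-(1 + ε))) := by
  have := integrable_rpow_neg_one_add_norm_sq (E := ℂ) (μ := volume) (r := 2 * (1 + ε))
    (by rw [Complex.finrank_real_complex]; push_cast; linarith)
  convert this using 3
  ring

lemma tailMass_pos {ε : ℝ} (hε : 0 < ε) : 0 < tailMass ε := by
  unfold tailMass
  refine (integral_pos_iff_support_of_nonneg (fun y => by positivity) (integrable_tail hε)).2 ?_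
  have : Function.support (fun y : ℂ => (1 + ‖y‖ ^ 2) ^ (-(1 + ε))) = Set.univ := by
    ext y; simp only [Function.mem_support, Set.mem_univ, iff_true]; positivity
  rw [this]; simp

lemma tailDensity_pos {ε : ℝ} (hε : 0 < ε) (y : ℂ) : 0 < tailDensity ε y := by
  have := tailMass_pos hε
  unfold tailDensity; positivity

lemma tailDensity_le {ε : ℝ} (hε : 0 < ε) (y : ℂ) : tailDensity ε y ≤ (tailMass ε)⁻¹ := by
  have := tailMass_pos hε
  unfold tailDensity
  refine mul_le_of_le_one_right (by positivity) ?_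
  exact Real.rpow_le_one_of_one_le_of_nonpos (by nlinarith [sq_nonneg ‖y‖]) (by linarith)

@[fun_prop]
lemma measurable_tailDensity (ε : ℝ) : Measurable (tailDensity ε) := by
  unfold tailDensity; fun_prop

lemma lintegral_tailDensity {ε : ℝ} (hε : 0 < ε) (m : ℂ) :
    ∫⁻ y, ENNReal.ofReal (tailDensity ε (y - m)) = 1 := by
  rw [lintegral_sub_right_eq_self (fun z => ENNReal.ofReal (tailDensity ε z)) m]
  unfold tailDensity
  have := tailMass_pos hε
  rw [← ofReal_integral_eq_lintegral_ofReal ((integrable_tail hε).const_mul _)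
    (ae_of_all _ fun v => by positivity), integral_const_mul]
  change ENNReal.ofReal ((tailMass ε)⁻¹ * tailMass ε) = 1
  rw [inv_mul_cancel₀ this.ne', ENNReal.ofReal_one]

lemma log_tailDensity {ε : ℝ} (hε : 0 < ε) (y : ℂ) :
    Real.log (tailDensity ε y) = -Real.log (tailMass ε) - (1 + ε) * Real.log (1 + ‖y‖ ^ 2) := by
  have := tailMass_pos hε
  unfold tailDensity
  rw [Real.log_mul (by positivity) (by positivity), Real.log_rpow (by positivity), Real.log_inv]
  ring

/-! ### Gibbs' inequality -/

/-- If `X / Y` has mean at most one, then `log X` has mean at most that of `log Y`. -/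
lemma integral_log_le_of_lintegral_div_le {Ω : Type*} [MeasurableSpace Ω] {μ : Measure Ω}
    [IsProbabilityMeasure μ] {X Y : Ω → ℝ} (hX : ∀ o, 0 < X o) (hY : ∀ o, 0 < Y o)
    (hXm : Measurable X) (hYm : Measurable Y)
    (hXi : Integrable (fun o => Real.log (X o)) μ) (hYi : Integrable (fun o => Real.log (Y o)) μ)
    {c : ℝ} (hc : 0 < c) (h : ∫⁻ o, ENNReal.ofReal (X o / Y o) ∂μ ≤ ENNReal.ofReal c) :
    ∫ o, Real.log (X o) ∂μ ≤ ∫ o, Real.log (Y o) ∂μ + Real.log c := by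
  have hm : Measurable fun o => X o / Y o := hXm.div hYm
  have hp : ∀ o, 0 ≤ X o / Y o := fun o => (div_pos (hX o) (hY o)).le
  have hi : Integrable (fun o => X o / Y o) μ := by
    refine ⟨hm.aestronglyMeasurable, ?_⟩
    rw [hasFiniteIntegral_iff_ofReal (ae_of_all _ hp)]
    exact h.trans_lt ENNReal.ofReal_lt_top
  have hle : ∫ o, X o / Y o ∂μ ≤ c := by
    rw [integral_eq_lintegral_of_nonneg_ae (ae_of_all _ hp) hm.aestronglyMeasurable]
    exact ENNReal.toReal_le_of_le_ofReal hc.le h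
  have hpt : ∀ o, Real.log (X o) - Real.log (Y o) ≤ c⁻¹ * (X o / Y o) - 1 + Real.log c := by
    intro o
    have hpos : 0 < c⁻¹ * (X o / Y o) := mul_pos (inv_pos.2 hc) (div_pos (hX o) (hY o))
    have := Real.log_le_sub_one_of_pos hpos
    rw [Real.log_mul (inv_pos.2 hc).ne' (div_pos (hX o) (hY o)).ne',
      Real.log_div (hX o).ne' (hY o).ne', Real.log_inv] at this
    linarith
  have hmono : ∫ o, (Real.log (X o) - Real.log (Y o)) ∂μ
      ≤ ∫ o, (c⁻¹ * (X o / Y o) + (Real.log c - 1)) ∂μ :=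
    integral_mono (hXi.sub hYi) ((hi.const_mul c⁻¹).add (integrable_const _))
      fun o => (hpt o).trans (by linarith)
  rw [integral_sub hXi hYi, integral_add (hi.const_mul c⁻¹) (integrable_const _),
    integral_const_mul] at hmono
  simp only [integral_const, probReal_univ, smul_eq_mul, one_mul] at hmono
  have : c⁻¹ * ∫ o, X o / Y o ∂μ ≤ 1 := by
    rw [inv_mul_le_iff₀ hc]; linarith
  linarith

/-! ### Partial integrals over product spaces -/

section Marginal

variable {ι : Type*} [DecidableEq ι]

lemma lmarginal_eq_self_of_dependsOn {f : (ι → ℂ) → ℝ≥0∞} {A B : Finset ι}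
    {μ : ι → Measure ℂ} [∀ i, IsProbabilityMeasure (μ i)]
    (hf : DependsOn f (A : Set ι)) (hAB : Disjoint A B) : (∫⋯∫⁻_B, f ∂μ) = f := by
  ext x
  have : ∀ y, f (Function.updateFinset x B y) = f x := fun y => hf fun i hi => by
    rw [Function.updateFinset, dif_neg (Finset.disjoint_left.1 hAB hi)]
  simp [lmarginal, this]

/-- Moving the densities into the integrand puts all messages over the same Lebesgue reference
measure, so that their likelihoods can be added. -/
lemma lmarginal_withDensity {f : (ι → ℂ) → ℝ≥0∞} (hf : Measurable f)
    (ρ : ι → ℂ → ℝ≥0∞) (hρ : ∀ i, Measurable (ρ i))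
    [∀ i, SigmaFinite ((volume : Measure ℂ).withDensity (ρ i))] (A : Finset ι) (x : ι → ℂ) :
    (∫⋯∫⁻_A, f ∂fun i => (volume : Measure ℂ).withDensity (ρ i)) x
      = (∫⋯∫⁻_A, (fun y => (∏ a ∈ A, ρ a (y a)) * f y) ∂fun _ => (volume : Measure ℂ)) x := by
  have hm : ∀ A : Finset ι, Measurable fun y : ι → ℂ => ∏ a ∈ A, ρ a (y a) := fun A =>
    Finset.measurable_prod _ fun a _ => (hρ a).comp (measurable_pi_apply a)
  induction A using Finset.induction generalizing x with
  | empty => simp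
  | insert i s hi ih =>
    have hM : Measurable fun y : ι → ℂ => (∏ a ∈ s, ρ a (y a)) * f y := (hm s).mul hf
    have hM' : Measurable fun y : ι → ℂ => (∏ a ∈ insert i s, ρ a (y a)) * f y :=
      (hm (insert i s)).mul hf
    rw [lmarginal_insert _ hf hi, lmarginal_insert _ hM' hi]
    simp_rw [ih]
    have hM'' : Measurable fun v => (∫⋯∫⁻_s, (fun y => (∏ a ∈ s, ρ a (y a)) * f y)
        ∂fun _ => (volume : Measure ℂ)) (Function.update x i v) :=
      (hM.lmarginal _).comp (measurable_update x)
    rw [lintegral_withDensity_eq_lintegral_mul _ (hρ i) hM'']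
    refine lintegral_congr fun v => ?_
    simp only [Pi.mul_apply, lmarginal]
    have hMu : Measurable fun y : s → ℂ =>
        (∏ a ∈ s, ρ a (Function.updateFinset (Function.update x i v) s y a)) *
          f (Function.updateFinset (Function.update x i v) s y) :=
      hM.comp measurable_updateFinset
    rw [← lintegral_const_mul _ hMu]
    refine lintegral_congr fun y => ?_
    rw [Finset.prod_insert hi, mul_assoc]
    congr 2
    simp [Function.updateFinset, hi]

/-- A product of conditional densities, each of one coordinate given the coordinates outside `B`,
integrates to at most one over the coordinates in `B`. -/
lemma lmarginal_prod_le_one {B : Finset ι} {q : ι → (ι → ℂ) → ℝ≥0∞}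
    (hqm : ∀ b ∈ B, Measurable (q b))
    (hq : ∀ b ∈ B, ∀ c ∈ B, c ≠ b → ∀ y v, q b (Function.update y c v) = q b y)
    (h1 : ∀ b ∈ B, ∀ y, ∫⁻ v : ℂ, q b (Function.update y b v) ≤ 1) (y : ι → ℂ) :
    (∫⋯∫⁻_B, (fun y => ∏ b ∈ B, q b y) ∂fun _ => (volume : Measure ℂ)) y ≤ 1 := by
  induction B using Finset.induction generalizing y with
  | empty => simp
  | insert i s hi ih =>
    have hm : Measurable fun y => ∏ b ∈ insert i s, q b y := Finset.measurable_prod _ hqm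
    have hm' : Measurable fun y => ∏ b ∈ s, q b y :=
      Finset.measurable_prod _ fun b hb => hqm b (Finset.mem_insert_of_mem hb)
    -- Coordinate `i` is integrated innermost, where only the factor `q i` depends on it.
    rw [lmarginal_insert' _ hm hi]
    refine le_trans (lmarginal_mono (g := fun y => ∏ b ∈ s, q b y) (fun x => ?_) y)
      (ih (fun b hb => hqm b (Finset.mem_insert_of_mem hb))
        (fun b hb c hc => hq b (Finset.mem_insert_of_mem hb) c (Finset.mem_insert_of_mem hc))
        (fun b hb => h1 b (Finset.mem_insert_of_mem hb)) y)
    have e : ∀ v : ℂ, ∏ b ∈ insert i s, q b (Function.update x i v)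
        = q i (Function.update x i v) * ∏ b ∈ s, q b x := by
      intro v
      rw [Finset.prod_insert hi]
      congr 1
      refine Finset.prod_congr rfl fun b hb => ?_
      exact hq b (Finset.mem_insert_of_mem hb) i (Finset.mem_insert_self _ _)
        (fun h => hi (h ▸ hb)) x v
    simp_rw [e]
    have hqi : Measurable fun v : ℂ => q i (Function.update x i v) :=
      (hqm i (Finset.mem_insert_self _ _)).comp (measurable_update x)
    rw [lintegral_mul_const _ hqi]
    exact mul_le_of_le_one_left (by positivity) (h1 i (Finset.mem_insert_self _ _) x)

end Marginal

/-! ### Averages over the classes of an equivalence relation on a finite type -/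

section Classes

variable {𝓦 : Type*} [Fintype 𝓦]

open Classical in
/-- The equivalence class of `w`. -/
noncomputable def eqvClass (E : Setoid 𝓦) (w : 𝓦) : Finset 𝓦 :=
  Finset.univ.filter fun w' => E w w'

lemma mem_eqvClass {E : Setoid 𝓦} {w w' : 𝓦} : w' ∈ eqvClass E w ↔ E w w' := by
  simp [eqvClass]

lemma self_mem_eqvClass (E : Setoid 𝓦) (w : 𝓦) : w ∈ eqvClass E w := mem_eqvClass.2 (E.refl w)

lemma eqvClass_congr {E : Setoid 𝓦} {w w' : 𝓦} (h : E w w') : eqvClass E w = eqvClass E w' := by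
  ext v
  rw [mem_eqvClass, mem_eqvClass]
  exact ⟨fun hv => E.trans (E.symm h) hv, fun hv => E.trans h hv⟩

lemma card_eqvClass_pos (E : Setoid 𝓦) (w : 𝓦) : 0 < ((eqvClass E w).card : ℝ) := by
  exact_mod_cast Finset.card_pos.2 ⟨w, self_mem_eqvClass E w⟩

lemma card_eqvClass_le (E : Setoid 𝓦) (w : 𝓦) : ((eqvClass E w).card : ℝ) ≤ Fintype.card 𝓦 := by
  exact_mod_cast Finset.card_le_univ _

lemma sum_sum_eqvClass_comm (E : Setoid 𝓦) (f : 𝓦 → 𝓦 → ℝ) :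
    ∑ w, ∑ w' ∈ eqvClass E w, f w w' = ∑ w', ∑ w ∈ eqvClass E w', f w w' := by
  refine Finset.sum_comm' fun w w' => ?_
  simp only [Finset.mem_univ, true_and, and_true, mem_eqvClass]
  exact ⟨E.symm, E.symm⟩

/-- The average of a function over the class of `w`. -/
noncomputable def classAvg (E : Setoid 𝓦) (l : 𝓦 → ℝ) (w : 𝓦) : ℝ :=
  (∑ w' ∈ eqvClass E w, l w') / (eqvClass E w).card

lemma sum_eqvClass_pos (E : Setoid 𝓦) {l : 𝓦 → ℝ} (hl : ∀ w, 0 < l w) (w : 𝓦) :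
    0 < ∑ w' ∈ eqvClass E w, l w' :=
  Finset.sum_pos (fun _ _ => hl _) ⟨w, self_mem_eqvClass E w⟩

lemma classAvg_pos (E : Setoid 𝓦) {l : 𝓦 → ℝ} (hl : ∀ w, 0 < l w) (w : 𝓦) :
    0 < classAvg E l w := div_pos (sum_eqvClass_pos E hl w) (card_eqvClass_pos E w)

lemma classAvg_congr {E : Setoid 𝓦} {l : 𝓦 → ℝ} {w w' : 𝓦} (h : E w w') :
    classAvg E l w = classAvg E l w' := by
  unfold classAvg; rw [eqvClass_congr h]

lemma classAvg_le_one (E : Setoid 𝓦) {l : 𝓦 → ℝ} (hl : ∀ w, l w ≤ 1) (w : 𝓦) :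
    classAvg E l w ≤ 1 := by
  unfold classAvg
  rw [div_le_one (card_eqvClass_pos E w)]
  calc _ ≤ ∑ w' ∈ eqvClass E w, (1 : ℝ) := Finset.sum_le_sum fun _ _ => hl _
    _ = _ := by simp

/-- This crude lower bound by the term of `w` itself keeps the logarithm of an average from being
too negative; it serves integrability only. -/
lemma div_card_le_classAvg (E : Setoid 𝓦) {l : 𝓦 → ℝ} (hl : ∀ w, 0 < l w) (w : 𝓦) :
    l w / Fintype.card 𝓦 ≤ classAvg E l w := by
  unfold classAvg
  have h1 : l w ≤ ∑ w' ∈ eqvClass E w, l w' :=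
    Finset.single_le_sum (f := l) (fun _ _ => (hl _).le) (self_mem_eqvClass E w)
  exact div_le_div₀ (sum_eqvClass_pos E hl w).le h1 (card_eqvClass_pos E w) (card_eqvClass_le E w)

/-- On a class, `f` and the average are constant while the weights add up to cardinality times
average, so the weights cancel. This is the identity ∫ p (q/p) = ∫ q behind Gibbs' inequality. -/
lemma sum_mul_div_classAvg (E : Setoid 𝓦) {l : 𝓦 → ℝ} (hl : ∀ w, 0 < l w) {f : 𝓦 → ℝ}
    (hf : ∀ w w', E w w' → f w = f w') : ∑ w, l w * (f w / classAvg E l w) = ∑ w, f w := by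
  have key := sum_sum_eqvClass_comm E fun w w' => f w * l w' / ∑ v ∈ eqvClass E w, l v
  calc ∑ w, l w * (f w / classAvg E l w)
      = ∑ w', ∑ w ∈ eqvClass E w', f w * l w' / ∑ v ∈ eqvClass E w, l v := by
        refine Finset.sum_congr rfl fun w' _ => ?_
        have : ∀ w ∈ eqvClass E w', f w * l w' / ∑ v ∈ eqvClass E w, l v
            = f w' * l w' / ∑ v ∈ eqvClass E w', l v := fun w hw => by
          rw [hf w' w (mem_eqvClass.1 hw), eqvClass_congr (mem_eqvClass.1 hw)]
        rw [Finset.sum_congr rfl this, Finset.sum_const, nsmul_eq_mul]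
        unfold classAvg
        have h1 := (sum_eqvClass_pos E hl w').ne'
        have h2 := (card_eqvClass_pos E w').ne'
        field_simp
    _ = _ := by
        rw [← key]
        refine Finset.sum_congr rfl fun w _ => ?_
        rw [← Finset.sum_div, ← Finset.mul_sum]
        exact mul_div_cancel_right₀ _ (sum_eqvClass_pos E hl w).ne'

lemma eqvClass_mono {E E' : Setoid 𝓦} (h : E' ≤ E) (w : 𝓦) : eqvClass E' w ⊆ eqvClass E w :=
  fun _ hw => mem_eqvClass.2 (h (mem_eqvClass.1 hw))

end Classes

/-! ### The channel, for an arbitrary finite message set -/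

/-- A codebook: the channel inputs as functions of the message and of the feedback. -/
abbrev Codebook (K n : ℕ) (𝓦 : Type*) : Type _ :=
  (t : Fin n) → 𝓦 → (Fin (t + 1) → CSI K) × (Fin t → CSI K) → Fin K → ℂ

section Channel

variable {K n : ℕ} {𝓦 : Type*}

@[fun_prop]
lemma measurable_feedback (t : ℕ) : Measurable (feedback (K := K) t) := by
  unfold feedback; fun_prop

/-- The noiseless received signals. -/
noncomputable def signal (c : Codebook K n 𝓦) (ω : FadingPath K) (w : 𝓦) (a : Fin n × Fin K) : ℂ :=
  ∑ i, (ω a.1).2 a.2 i * c a.1 w (feedback a.1 ω) i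

lemma measurable_input {c : Codebook K n 𝓦} (hc : ∀ t w, Measurable (c t w)) (t : Fin n) (w : 𝓦) :
    Measurable fun ω : FadingPath K => c t w (feedback t ω) :=
  (hc t w).comp (measurable_feedback t)

lemma measurable_signal {c : Codebook K n 𝓦} (hc : ∀ t w, Measurable (c t w)) (w : 𝓦)
    (a : Fin n × Fin K) : Measurable fun ω => signal c ω w a := by
  unfold signal
  refine Finset.measurable_sum _ fun i _ => ?_
  have := (measurable_pi_apply i).comp (measurable_input hc a.1 w)
  exact Measurable.mul (by fun_prop) this

/-- The likelihood of message `w` given the received signals in `A`. -/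
noncomputable def likelihood (c : Codebook K n 𝓦) (A : Finset (Fin n × Fin K)) (ω : FadingPath K)
    (y : Fin n × Fin K → ℂ) (w : 𝓦) : ℝ :=
  ∏ a ∈ A, noiseDensity (y a - signal c ω w a)

lemma likelihood_pos (c : Codebook K n 𝓦) (A : Finset (Fin n × Fin K)) (ω : FadingPath K)
    (y : Fin n × Fin K → ℂ) (w : 𝓦) : 0 < likelihood c A ω y w :=
  Finset.prod_pos fun _ _ => noiseDensity_pos _

lemma likelihood_le_one (c : Codebook K n 𝓦) (A : Finset (Fin n × Fin K)) (ω : FadingPath K)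
    (y : Fin n × Fin K → ℂ) (w : 𝓦) : likelihood c A ω y w ≤ 1 :=
  Finset.prod_le_one (fun _ _ => (noiseDensity_pos _).le) fun _ _ => noiseDensity_le_one _

lemma measurable_likelihood_comp {X : Type*} [MeasurableSpace X] {c : Codebook K n 𝓦}
    (hc : ∀ t w, Measurable (c t w)) (A : Finset (Fin n × Fin K)) (w : 𝓦) {f : X → FadingPath K}
    {g : X → Fin n × Fin K → ℂ} (hf : Measurable f) (hg : Measurable g) :
    Measurable fun x => likelihood c A (f x) (g x) w := by
  refine Finset.measurable_prod _ fun a _ => measurable_noiseDensity.comp ?_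
  exact ((measurable_pi_apply a).comp hg).sub ((measurable_signal hc w a).comp hf)

lemma measurable_likelihood {c : Codebook K n 𝓦} (hc : ∀ t w, Measurable (c t w))
    (A : Finset (Fin n × Fin K)) (w : 𝓦) :
    Measurable fun p : FadingPath K × (Fin n × Fin K → ℂ) => likelihood c A p.1 p.2 w :=
  measurable_likelihood_comp hc A w measurable_fst measurable_snd

lemma dependsOn_likelihood (c : Codebook K n 𝓦) (A : Finset (Fin n × Fin K)) (ω : FadingPath K)
    (w : 𝓦) : DependsOn (fun y => likelihood c A ω y w) (A : Set (Fin n × Fin K)) := by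
  intro y y' h
  refine Finset.prod_congr rfl fun a ha => ?_
  rw [h a ha]

lemma lmarginal_likelihood_le_one (c : Codebook K n 𝓦) (A : Finset (Fin n × Fin K))
    (ω : FadingPath K) (w : 𝓦) (y : Fin n × Fin K → ℂ) :
    (∫⋯∫⁻_A, (fun y => ENNReal.ofReal (likelihood c A ω y w)) ∂fun _ => (volume : Measure ℂ)) y
      ≤ 1 := by
  have : (fun y => ENNReal.ofReal (likelihood c A ω y w))
      = fun y => ∏ a ∈ A, ENNReal.ofReal (noiseDensity (y a - signal c ω w a)) := by
    ext y
    exact ENNReal.ofReal_prod_of_nonneg fun _ _ => (noiseDensity_pos _).le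
  rw [this]
  refine lmarginal_prod_le_one (fun b _ => by fun_prop) (fun b _ c _ hbc y v => ?_)
    (fun b _ y => ?_) y
  · rw [Function.update_of_ne hbc.symm]
  · simp only [Function.update_self]
    exact (lintegral_noiseDensity_comp _).le

/-- The received signals. -/
noncomputable def observed (c : Codebook K n 𝓦)
    (o : 𝓦 × FadingPath K × (Fin n → Fin K → ℂ)) (a : Fin n × Fin K) : ℂ :=
  signal c o.2.1 o.1 a + o.2.2 a.1 a.2

/-- Integrating over the noise amounts to integrating against the likelihood. -/
lemma lintegral_noise_eq {f : (Fin n × Fin K → ℂ) → ℝ≥0∞} (hf : Measurable f)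
    (c : Codebook K n 𝓦) {A : Finset (Fin n × Fin K)} (hA : DependsOn f (A : Set (Fin n × Fin K)))
    (w : 𝓦) (ω : FadingPath K) (y : Fin n × Fin K → ℂ) :
    ∫⁻ z, f (observed c (w, ω, z)) ∂(Measure.pi fun _ => Measure.pi fun _ => awgn) =
      (∫⋯∫⁻_A, (fun y => ENNReal.ofReal (likelihood c A ω y w) * f y)
        ∂fun _ => (volume : Measure ℂ)) y := by
  have hρ : ∀ a : Fin n × Fin K,
      Measurable fun z => ENNReal.ofReal (noiseDensity (z - signal c ω w a)) := fun a => by fun_prop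
  have hprob : ∀ a : Fin n × Fin K, IsProbabilityMeasure ((volume : Measure ℂ).withDensity
      fun z => ENNReal.ofReal (noiseDensity (z - signal c ω w a))) := fun a => by
    rw [← map_add_awgn]; exact Measure.isProbabilityMeasure_map (by fun_prop)
  have h1 : ∫⁻ z, f (observed c (w, ω, z)) ∂(Measure.pi fun _ => Measure.pi fun _ => awgn)
      = ∫⁻ y, f y ∂(Measure.pi fun a => (volume : Measure ℂ).withDensity
          fun z => ENNReal.ofReal (noiseDensity (z - signal c ω w a))) := by
    simp_rw [← map_add_awgn]
    rw [← Measure.pi_map_pi (fun a => by fun_prop), ← map_uncurry_awgn, Measure.map_map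
      (by fun_prop) (by fun_prop), lintegral_map hf (by fun_prop)]
    rfl
  -- The signals outside `A` follow probability measures and `f` ignores them, so they integrate
  -- out; only then is the measure on `A` written with its density.
  rw [h1, lintegral_eq_lmarginal_univ y, ← Finset.union_compl A,
    lmarginal_union _ f hf disjoint_compl_right,
    lmarginal_eq_self_of_dependsOn hA disjoint_compl_right,
    lmarginal_withDensity hf _ hρ]
  congr 1
  ext y
  congr 1
  exact (ENNReal.ofReal_prod_of_nonneg fun _ _ => (noiseDensity_pos _).le).symm

variable [Fintype 𝓦]

/-- The density of the received signals in `A`, given the class of the message. -/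
noncomputable def mixture (c : Codebook K n 𝓦) (E : Setoid 𝓦) (A : Finset (Fin n × Fin K))
    (w : 𝓦) (ω : FadingPath K) (y : Fin n × Fin K → ℂ) : ℝ :=
  classAvg E (likelihood c A ω y) w

lemma mixture_pos (c : Codebook K n 𝓦) (E : Setoid 𝓦) (A : Finset (Fin n × Fin K))
    (w : 𝓦) (ω : FadingPath K) (y : Fin n × Fin K → ℂ) : 0 < mixture c E A w ω y :=
  classAvg_pos _ (likelihood_pos c A ω y) _

lemma measurable_mixture {c : Codebook K n 𝓦} (hc : ∀ t w, Measurable (c t w)) (E : Setoid 𝓦)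
    (A : Finset (Fin n × Fin K)) (w : 𝓦) :
    Measurable fun p : FadingPath K × (Fin n × Fin K → ℂ) => mixture c E A w p.1 p.2 :=
  (Finset.measurable_sum _ fun w' _ => measurable_likelihood hc A w').div_const _

lemma dependsOn_mixture (c : Codebook K n 𝓦) (E : Setoid 𝓦) (A : Finset (Fin n × Fin K))
    (w : 𝓦) (ω : FadingPath K) : DependsOn (mixture c E A w ω) (A : Set (Fin n × Fin K)) := by
  intro y y' h
  unfold mixture classAvg
  congr 1
  exact Finset.sum_congr rfl fun w' _ => dependsOn_likelihood c A ω w' h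

lemma lmarginal_mixture_le_one {c : Codebook K n 𝓦} (hc : ∀ t w, Measurable (c t w))
    (E : Setoid 𝓦) (A : Finset (Fin n × Fin K)) (w : 𝓦) (ω : FadingPath K)
    (y : Fin n × Fin K → ℂ) :
    (∫⋯∫⁻_A, (fun y => ENNReal.ofReal (mixture c E A w ω y)) ∂fun _ => (volume : Measure ℂ)) y
      ≤ 1 := by
  have hpos := card_eqvClass_pos E w
  have e : (fun y => ENNReal.ofReal (mixture c E A w ω y))
      = fun y => ENNReal.ofReal ((eqvClass E w).card : ℝ)⁻¹ *
          ∑ w' ∈ eqvClass E w, ENNReal.ofReal (likelihood c A ω y w') := by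
    ext y
    unfold mixture classAvg
    rw [div_eq_inv_mul, ENNReal.ofReal_mul (by positivity),
      ENNReal.ofReal_sum_of_nonneg fun _ _ => (likelihood_pos _ _ _ _ _).le]
  have hm : ∀ w', Measurable fun z : (i : A) → ℂ =>
      ENNReal.ofReal (likelihood c A ω (Function.updateFinset y A z) w') := fun w' =>
    ((measurable_likelihood hc A w').comp
      (measurable_const.prodMk measurable_updateFinset)).ennreal_ofReal
  rw [e]
  simp only [lmarginal]
  rw [lintegral_const_mul _ (Finset.measurable_sum _ fun w' _ => hm w'),
    lintegral_finsetSum _ fun w' _ => hm w']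
  calc _ ≤ ENNReal.ofReal ((eqvClass E w).card : ℝ)⁻¹ * ∑ w' ∈ eqvClass E w, (1 : ℝ≥0∞) := by
        gcongr with w' _
        exact lmarginal_likelihood_le_one c A ω w' y
    _ = 1 := by
        rw [Finset.sum_const, nsmul_eq_mul, mul_one, ENNReal.ofReal_inv_of_pos hpos,
          ENNReal.ofReal_natCast]
        refine ENNReal.inv_mul_cancel ?_ (ENNReal.natCast_ne_top _)
        exact_mod_cast hpos.ne'

variable [MeasurableSpace 𝓦] [MeasurableSingletonClass 𝓦]

/-- The joint law of a uniform message, the fading and the noise. -/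
noncomputable def channelLaw (𝓦 : Type*) [MeasurableSpace 𝓦] (n : ℕ) {K : ℕ}
    (L : Measure (FadingPath K)) :
    Measure (𝓦 × FadingPath K × (Fin n → Fin K → ℂ)) :=
  (uniformOn Set.univ).prod (L.prod (Measure.pi fun _ => Measure.pi fun _ => awgn))

instance [Nonempty 𝓦] (L : Measure (FadingPath K)) [IsProbabilityMeasure L] :
    IsProbabilityMeasure (channelLaw 𝓦 n L) := by
  have : IsProbabilityMeasure (uniformOn (Set.univ : Set 𝓦)) :=
    isProbabilityMeasure_uniformOn Set.finite_univ Set.univ_nonempty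
  unfold channelLaw; infer_instance

lemma lintegral_uniformOn_univ [Nonempty 𝓦] (f : 𝓦 → ℝ≥0∞) :
    ∫⁻ w, f w ∂(uniformOn (Set.univ : Set 𝓦)) = (Fintype.card 𝓦 : ℝ≥0∞)⁻¹ * ∑ w, f w := by
  rw [uniformOn, ProbabilityTheory.cond, lintegral_smul_measure, Measure.restrict_univ,
    lintegral_count, tsum_fintype, Measure.count_univ]
  simp

lemma measurable_observed {c : Codebook K n 𝓦} (hc : ∀ t w, Measurable (c t w)) :
    Measurable (observed c) := by
  refine measurable_pi_lambda _ fun a => ?_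
  refine Measurable.add ?_ (by fun_prop)
  exact measurable_from_prod_countable_right fun w => (measurable_signal hc w a).comp measurable_fst

lemma measurable_comp_observed {β : Type*} [MeasurableSpace β] {c : Codebook K n 𝓦}
    (hc : ∀ t w, Measurable (c t w)) {X : 𝓦 → FadingPath K → (Fin n × Fin K → ℂ) → β}
    (hX : ∀ w, Measurable fun p : FadingPath K × (Fin n × Fin K → ℂ) => X w p.1 p.2) :
    Measurable fun o => X o.1 o.2.1 (observed c o) := by
  refine measurable_from_prod_countable_right fun w => ?_
  refine (hX w).comp (measurable_fst.prodMk ?_)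
  exact (measurable_observed hc).comp (measurable_const.prodMk measurable_id)

lemma lintegral_channelLaw [Nonempty 𝓦] (L : Measure (FadingPath K)) [IsProbabilityMeasure L]
    {f : 𝓦 × FadingPath K × (Fin n → Fin K → ℂ) → ℝ≥0∞} (hf : Measurable f) :
    ∫⁻ o, f o ∂(channelLaw 𝓦 n L) = (Fintype.card 𝓦 : ℝ≥0∞)⁻¹ * ∑ w, ∫⁻ ω, ∫⁻ z, f (w, ω, z)
      ∂(Measure.pi fun _ => Measure.pi fun _ => awgn) ∂L := by
  have : IsProbabilityMeasure (uniformOn (Set.univ : Set 𝓦)) :=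
    isProbabilityMeasure_uniformOn Set.finite_univ Set.univ_nonempty
  unfold channelLaw
  rw [lintegral_prod _ hf.aemeasurable, lintegral_uniformOn_univ]
  congr 1
  refine Finset.sum_congr rfl fun w _ => ?_
  have hfw : Measurable fun p : FadingPath K × (Fin n → Fin K → ℂ) => f (w, p) :=
    hf.comp (measurable_const.prodMk measurable_id)
  exact lintegral_prod _ hfw.aemeasurable

/-- A nonnegative function of the message, the fading and the received signals in `A` has mean at
most `r` if its sum over the messages, weighted by the likelihoods, integrates to at most `r` times
the number of messages. -/
lemma lintegral_observed_le [Nonempty 𝓦] (L : Measure (FadingPath K)) [IsProbabilityMeasure L]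
    {c : Codebook K n 𝓦} (hc : ∀ t w, Measurable (c t w)) {A : Finset (Fin n × Fin K)}
    {f : 𝓦 → FadingPath K → (Fin n × Fin K → ℂ) → ℝ≥0∞}
    (hf : ∀ w, Measurable fun p : FadingPath K × (Fin n × Fin K → ℂ) => f w p.1 p.2)
    (hA : ∀ w ω, DependsOn (f w ω) (A : Set (Fin n × Fin K)))
    (h : ∀ ω y, (∫⋯∫⁻_A, (fun y => ∑ w, ENNReal.ofReal (likelihood c A ω y w) * f w ω y)
        ∂fun _ => (volume : Measure ℂ)) y ≤ Fintype.card 𝓦) :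
    ∫⁻ o, f o.1 o.2.1 (observed c o) ∂(channelLaw 𝓦 n L) ≤ 1 := by
  have hfm := measurable_comp_observed hc hf
  rw [lintegral_channelLaw L hfm, ← lintegral_finsetSum]
  · have hcard : (Fintype.card 𝓦 : ℝ≥0∞) ≠ 0 := by exact_mod_cast Fintype.card_ne_zero
    rw [← ENNReal.inv_mul_cancel hcard (ENNReal.natCast_ne_top _)]
    gcongr
    refine (lintegral_mono (g := fun _ => (Fintype.card 𝓦 : ℝ≥0∞)) fun ω => ?_).trans (by simp)
    -- The base point 0 only fixes coordinates outside `A`, where its value is immaterial.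
    refine le_trans (le_of_eq ?_) (h ω 0)
    have hfω : ∀ w, Measurable (f w ω) := fun w =>
      (hf w).comp (measurable_const.prodMk measurable_id)
    simp_rw [fun w => lintegral_noise_eq (hfω w) c (hA w ω) w ω 0]
    simp only [lmarginal]
    rw [lintegral_finsetSum]
    intro w _
    have : Measurable fun y => ENNReal.ofReal (likelihood c A ω y w) * f w ω y :=
      ((measurable_likelihood hc A w).comp
        (measurable_const.prodMk measurable_id)).ennreal_ofReal.mul (hfω w)
    exact this.comp measurable_updateFinset
  · intro w _
    exact Measurable.lintegral_prod_right' (f := fun p : FadingPath K × (Fin n → Fin K → ℂ) =>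
      f w p.1 (observed c (w, p))) (hfm.comp (measurable_const.prodMk measurable_id))

end Channel

/-! ### Guessing a function of the message against its posterior -/

section Decoding

variable {𝓦 V : Type*} [Fintype 𝓦] [Fintype V]

/-- The weights `ρ`, given the class of the message, of a guess for `φ`, averaged against the
posterior of `φ`. -/
lemma sum_mul_guess_le (C : Setoid 𝓦) (φ : 𝓦 → V) {l : 𝓦 → ℝ} (hl : ∀ w, 0 < l w)
    {ρ : 𝓦 → V → ℝ} (hρ : ∀ w w', C w w' → ρ w = ρ w') (hρ0 : ∀ w v, 0 ≤ ρ w v)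
    (hρ1 : ∀ w, ∑ v, ρ w v ≤ 1) :
    ∑ w, l w * (ρ w (φ w) * (∑ w' ∈ eqvClass C w, l w') /
      ∑ w' ∈ eqvClass (C ⊓ Setoid.ker φ) w, l w') ≤ ∑ w, l w := by
  classical
  set s : 𝓦 → ℝ := fun w => ∑ w' ∈ eqvClass (C ⊓ Setoid.ker φ) w, l w' with hs
  have hspos : ∀ w, 0 < s w := sum_eqvClass_pos _ hl
  have h1 : ∀ w, l w * (ρ w (φ w) * (∑ w' ∈ eqvClass C w, l w') / s w)
      = ∑ w' ∈ eqvClass C w, l w' * (ρ w (φ w) * l w / s w) := fun w => by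
    rw [← Finset.sum_mul]; ring
  change ∑ w, l w * (ρ w (φ w) * (∑ w' ∈ eqvClass C w, l w') / s w) ≤ _
  simp_rw [h1]
  -- Exchanging the two members of a class makes `l w'` a common factor. The class then splits into
  -- fibres of `φ`; on each, the weights `l w / s w` sum to one and leave a total guess weight of at
  -- most one.
  rw [sum_sum_eqvClass_comm C fun w w' => l w' * (ρ w (φ w) * l w / s w)]
  refine Finset.sum_le_sum fun w' _ => ?_
  rw [← Finset.mul_sum]
  refine mul_le_of_le_one_right (hl w').le ?_
  refine le_trans ?_ (hρ1 w')
  rw [← Finset.sum_fiberwise (eqvClass C w') φ]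
  refine Finset.sum_le_sum fun v _ => ?_
  have hcl : ∀ w ∈ (eqvClass C w').filter (φ · = v),
      eqvClass (C ⊓ Setoid.ker φ) w = (eqvClass C w').filter (φ · = v) := by
    intro w hw
    rw [Finset.mem_filter, mem_eqvClass] at hw
    ext u
    rw [mem_eqvClass, Finset.mem_filter, mem_eqvClass]
    change (C w u ∧ φ w = φ u) ↔ _
    rw [hw.2]
    exact ⟨fun h => ⟨C.trans hw.1 h.1, h.2.symm⟩, fun h => ⟨C.trans (C.symm hw.1) h.1, h.2.symm⟩⟩
  have h2 : ∀ w ∈ (eqvClass C w').filter (φ · = v), ρ w (φ w) * l w / s w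
      = ρ w' v * (l w / ∑ u ∈ (eqvClass C w').filter (φ · = v), l u) := by
    intro w hw
    have hw' := hw
    rw [Finset.mem_filter, mem_eqvClass] at hw'
    rw [hs]
    simp only
    rw [hcl w hw, hw'.2, ← hρ w' w hw'.1, mul_div_assoc]
  rw [Finset.sum_congr rfl h2, ← Finset.mul_sum, ← Finset.sum_div]
  -- Only an inequality, since an empty fibre contributes 0/0 = 0.
  exact mul_le_of_le_one_right (hρ0 _ _) (div_self_le_one _)

end Decoding

/-! ### Conditional differential entropy, Gibbs' and Fano's inequalities -/

section Entropy

variable {K n : ℕ} {𝓦 : Type*}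

/-- The total energy of the noise. -/
noncomputable def noiseEnergy (o : 𝓦 × FadingPath K × (Fin n → Fin K → ℂ)) : ℝ :=
  ∑ a : Fin n × Fin K, ‖o.2.2 a.1 a.2‖ ^ 2

variable [Fintype 𝓦]

/-- For the actual message the residuals are exactly the noise, so its log-likelihood is a constant
minus noise energy. The bound extends the sum to all signals and is thus uniform in `A`. -/
lemma neg_le_log_likelihood_observed [Nonempty 𝓦] (c : Codebook K n 𝓦)
    (A : Finset (Fin n × Fin K)) (o : 𝓦 × FadingPath K × (Fin n → Fin K → ℂ)) :
    -(n * K * Real.log Real.pi + Real.log (Fintype.card 𝓦) + noiseEnergy o) ≤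
      Real.log (likelihood c A o.2.1 (observed c o) o.1 / Fintype.card 𝓦) := by
  have hπ : 0 ≤ Real.log Real.pi := Real.log_nonneg (by linarith [Real.pi_gt_three])
  have hcard : (Fintype.card 𝓦 : ℝ) ≠ 0 := by exact_mod_cast Fintype.card_ne_zero
  rw [Real.log_div (likelihood_pos _ _ _ _ _).ne' hcard]
  unfold likelihood
  rw [Real.log_prod fun a _ => (noiseDensity_pos _).ne']
  have h1 : ∑ a : Fin n × Fin K, (-(Real.log Real.pi) - ‖o.2.2 a.1 a.2‖ ^ 2)
      ≤ ∑ a ∈ A, Real.log (noiseDensity (observed c o a - signal c o.2.1 o.1 a)) := by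
    have e : ∀ a, Real.log (noiseDensity (observed c o a - signal c o.2.1 o.1 a))
        = -(Real.log Real.pi) - ‖o.2.2 a.1 a.2‖ ^ 2 := fun a => by
      rw [log_noiseDensity, observed, add_sub_cancel_left]
    simp_rw [e]
    rw [← Finset.sum_add_sum_compl A]
    have : ∑ a ∈ Aᶜ, (-(Real.log Real.pi) - ‖o.2.2 a.1 a.2‖ ^ 2) ≤ 0 :=
      Finset.sum_nonpos fun a _ => by nlinarith [sq_nonneg ‖o.2.2 a.1 a.2‖]
    linarith
  rw [Finset.sum_sub_distrib] at h1
  simp only [Finset.sum_const, Finset.card_univ, Fintype.card_prod, Fintype.card_fin,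
    nsmul_eq_mul] at h1
  unfold noiseEnergy
  push_cast at h1
  linarith

lemma lmarginal_sum_le {A : Finset (Fin n × Fin K)} {X : 𝓦 → (Fin n × Fin K → ℂ) → ℝ≥0∞}
    (hXm : ∀ w, Measurable (X w)) (y : Fin n × Fin K → ℂ)
    (h : ∀ w, (∫⋯∫⁻_A, X w ∂fun _ => (volume : Measure ℂ)) y ≤ 1) :
    (∫⋯∫⁻_A, (fun y => ∑ w, X w y) ∂fun _ => (volume : Measure ℂ)) y ≤ Fintype.card 𝓦 := by
  simp only [lmarginal] at h ⊢
  rw [lintegral_finsetSum]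
  swap
  · exact fun w _ => (hXm w).comp measurable_updateFinset
  refine (Finset.sum_le_sum fun w _ => h w).trans ?_
  simp

variable [MeasurableSpace 𝓦]

/-- The differential entropy of the received signals in `A` given the fading and the class of the
message. -/
noncomputable def condEntropy (L : Measure (FadingPath K)) (c : Codebook K n 𝓦) (E : Setoid 𝓦)
    (A : Finset (Fin n × Fin K)) : ℝ :=
  -∫ o, Real.log (mixture c E A o.1 o.2.1 (observed c o)) ∂(channelLaw 𝓦 n L)

/-- Differential entropies may be negative in general, but here the densities are at most one.
`Scheme.converse` uses this to discard the last term of the telescoping sum. -/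
lemma condEntropy_nonneg (L : Measure (FadingPath K)) (c : Codebook K n 𝓦) (E : Setoid 𝓦)
    (A : Finset (Fin n × Fin K)) : 0 ≤ condEntropy L c E A := by
  unfold condEntropy
  rw [neg_nonneg]
  exact integral_nonpos fun o => Real.log_nonpos (mixture_pos _ _ _ _ _ _).le
    (classAvg_le_one E (likelihood_le_one c A _ _) _)

variable [MeasurableSingletonClass 𝓦]

lemma measurePreserving_noise [Nonempty 𝓦] (L : Measure (FadingPath K)) [IsProbabilityMeasure L]
    (a : Fin n × Fin K) :
    MeasurePreserving (fun o : 𝓦 × FadingPath K × (Fin n → Fin K → ℂ) => o.2.2 a.1 a.2)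
      (channelLaw 𝓦 n L) awgn := by
  have : IsProbabilityMeasure (uniformOn (Set.univ : Set 𝓦)) :=
    isProbabilityMeasure_uniformOn Set.finite_univ Set.univ_nonempty
  have h1 : MeasurePreserving Prod.snd (channelLaw 𝓦 n L)
      (L.prod (Measure.pi fun _ : Fin n => Measure.pi fun _ : Fin K => awgn)) :=
    measurePreserving_snd
  have h2 : MeasurePreserving Prod.snd
      (L.prod (Measure.pi fun _ : Fin n => Measure.pi fun _ : Fin K => awgn))
      (Measure.pi fun _ : Fin n => Measure.pi fun _ : Fin K => awgn) := measurePreserving_snd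
  have h3 := measurePreserving_eval (fun _ : Fin n => Measure.pi fun _ : Fin K => awgn) a.1
  have h4 := measurePreserving_eval (fun _ : Fin K => awgn) a.2
  exact h4.comp (h3.comp (h2.comp h1))

lemma integrable_noise [Nonempty 𝓦] (L : Measure (FadingPath K)) [IsProbabilityMeasure L]
    (a : Fin n × Fin K) : Integrable
      (fun o : 𝓦 × FadingPath K × (Fin n → Fin K → ℂ) => ‖o.2.2 a.1 a.2‖ ^ 2)
      (channelLaw 𝓦 n L) :=
  (measurePreserving_noise L a).integrable_comp_of_integrable integrable_normSq_awgn

lemma integrable_noiseEnergy [Nonempty 𝓦] (L : Measure (FadingPath K)) [IsProbabilityMeasure L] :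
    Integrable (noiseEnergy (K := K) (n := n) (𝓦 := 𝓦)) (channelLaw 𝓦 n L) :=
  integrable_finsetSum _ fun a _ => integrable_noise L a

/-- A positive function is log-integrable if it is bounded and at least the likelihood of the
actual message. -/
lemma integrable_log_of_likelihood_le [Nonempty 𝓦] {L : Measure (FadingPath K)}
    [IsProbabilityMeasure L] (c : Codebook K n 𝓦) (A : Finset (Fin n × Fin K))
    {X : 𝓦 × FadingPath K × (Fin n → Fin K → ℂ) → ℝ} (hXm : Measurable X) (hX1 : ∀ o, X o ≤ 1)
    (hX : ∀ o, likelihood c A o.2.1 (observed c o) o.1 / Fintype.card 𝓦 ≤ X o) :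
    Integrable (fun o => Real.log (X o)) (channelLaw 𝓦 n L) := by
  have hcard : (0 : ℝ) < Fintype.card 𝓦 := by exact_mod_cast Fintype.card_pos
  refine Integrable.mono' (g := fun o => n * K * Real.log Real.pi + Real.log (Fintype.card 𝓦)
    + noiseEnergy o) ((integrable_const _).add (integrable_noiseEnergy L))
    hXm.log.aestronglyMeasurable (ae_of_all _ fun o => ?_)
  have hpos := div_pos (likelihood_pos c A o.2.1 (observed c o) o.1) hcard
  have h1 := neg_le_log_likelihood_observed c A o
  have h2 := Real.log_le_log hpos (hX o)
  have h3 := Real.log_nonpos (hpos.le.trans (hX o)) (hX1 o)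
  rw [Real.norm_eq_abs, abs_of_nonpos h3]
  linarith

lemma measurable_mixture_observed {c : Codebook K n 𝓦} (hc : ∀ t w, Measurable (c t w))
    (E : Setoid 𝓦) (A : Finset (Fin n × Fin K)) :
    Measurable fun o => mixture c E A o.1 o.2.1 (observed c o) :=
  measurable_comp_observed hc (measurable_mixture hc E A)

lemma integrable_log_mixture [Nonempty 𝓦] (L : Measure (FadingPath K)) [IsProbabilityMeasure L]
    {c : Codebook K n 𝓦} (hc : ∀ t w, Measurable (c t w)) (E : Setoid 𝓦)
    (A : Finset (Fin n × Fin K)) :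
    Integrable (fun o => Real.log (mixture c E A o.1 o.2.1 (observed c o))) (channelLaw 𝓦 n L) :=
  integrable_log_of_likelihood_le c A (measurable_mixture_observed hc E A)
    (fun _ => classAvg_le_one E (likelihood_le_one c A _ _) _)
    fun _ => div_card_le_classAvg E (likelihood_pos c A _ _) _

/-- **Gibbs' inequality**: among the densities of the received signals in `A` given the class of
the message, the true one has the largest expected logarithm. -/
theorem integral_log_le_integral_log_mixture [Nonempty 𝓦] (L : Measure (FadingPath K))
    [IsProbabilityMeasure L] {c : Codebook K n 𝓦} (hc : ∀ t w, Measurable (c t w)) (E : Setoid 𝓦)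
    (A : Finset (Fin n × Fin K)) {X : 𝓦 → FadingPath K → (Fin n × Fin K → ℂ) → ℝ}
    (hX : ∀ w ω y, 0 < X w ω y)
    (hXm : ∀ w, Measurable fun p : FadingPath K × (Fin n × Fin K → ℂ) => X w p.1 p.2)
    (hXE : ∀ w w', E w w' → X w = X w') (hXA : ∀ w ω, DependsOn (X w ω) (A : Set (Fin n × Fin K)))
    (h1 : ∀ w ω y, (∫⋯∫⁻_A, (fun y => ENNReal.ofReal (X w ω y)) ∂fun _ => (volume : Measure ℂ)) y
      ≤ 1)
    (hi : Integrable (fun o => Real.log (X o.1 o.2.1 (observed c o))) (channelLaw 𝓦 n L)) :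
    ∫ o, Real.log (X o.1 o.2.1 (observed c o)) ∂(channelLaw 𝓦 n L) ≤
      ∫ o, Real.log (mixture c E A o.1 o.2.1 (observed c o)) ∂(channelLaw 𝓦 n L) := by
  have := integral_log_le_of_lintegral_div_le (μ := channelLaw 𝓦 n L)
    (X := fun o => X o.1 o.2.1 (observed c o))
    (Y := fun o => mixture c E A o.1 o.2.1 (observed c o)) (fun _ => hX _ _ _)
    (fun _ => mixture_pos _ _ _ _ _ _) (measurable_comp_observed hc hXm)
    (measurable_mixture_observed hc E A) hi (integrable_log_mixture L hc E A) one_pos ?_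
  · simpa using this
  rw [ENNReal.ofReal_one]
  refine lintegral_observed_le L hc (A := A)
    (f := fun w ω y => ENNReal.ofReal (X w ω y / mixture c E A w ω y))
    (fun w => ((hXm w).div (measurable_mixture hc E A w)).ennreal_ofReal) (fun w ω y y' h => ?_)
    fun ω y => ?_
  · simp only
    rw [hXA w ω h, dependsOn_mixture c E A w ω h]
  · have e : ∀ y, ∑ w, ENNReal.ofReal (likelihood c A ω y w)
        * ENNReal.ofReal (X w ω y / mixture c E A w ω y) = ∑ w, ENNReal.ofReal (X w ω y) := by
      intro y
      rw [← ENNReal.ofReal_sum_of_nonneg fun _ _ => (hX _ _ _).le,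
        ← sum_mul_div_classAvg E (likelihood_pos c A ω y) (f := fun w => X w ω y)
          fun w w' h => by rw [hXE w w' h],
        ENNReal.ofReal_sum_of_nonneg fun w _ => (mul_pos (likelihood_pos _ _ _ _ _)
          (div_pos (hX _ _ _) (classAvg_pos E (likelihood_pos c A ω y) w))).le]
      refine Finset.sum_congr rfl fun w _ => ?_
      rw [← ENNReal.ofReal_mul (likelihood_pos _ _ _ _ _).le]
      rfl
    simp_rw [e]
    refine lmarginal_sum_le (fun w => ?_) y fun w => h1 w ω y
    exact ((hXm w).comp (measurable_const.prodMk measurable_id)).ennreal_ofReal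

/-- Conditioning reduces entropy. -/
lemma condEntropy_mono [Nonempty 𝓦] (L : Measure (FadingPath K)) [IsProbabilityMeasure L]
    {c : Codebook K n 𝓦} (hc : ∀ t w, Measurable (c t w)) {E E' : Setoid 𝓦} (h : E' ≤ E)
    (A : Finset (Fin n × Fin K)) : condEntropy L c E' A ≤ condEntropy L c E A := by
  unfold condEntropy
  rw [neg_le_neg_iff]
  -- The density given the coarser class is a competitor for the density given the finer one.
  refine integral_log_le_integral_log_mixture L hc E' A (mixture_pos c E A)
    (measurable_mixture hc E A) (fun w w' hw => ?_) (dependsOn_mixture c E A)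
    (lmarginal_mixture_le_one hc E A) (integrable_log_mixture L hc E A)
  ext ω y
  exact classAvg_congr (h hw)

/-- The expected logarithm of the size of the class of a uniform message. -/
noncomputable def classEntropy (E : Setoid 𝓦) : ℝ :=
  (∑ w, Real.log (eqvClass E w).card) / Fintype.card 𝓦

lemma integral_comp_fst [Nonempty 𝓦] (L : Measure (FadingPath K)) [IsProbabilityMeasure L]
    (f : 𝓦 → ℝ) : ∫ o, f o.1 ∂(channelLaw 𝓦 n L) = (∑ w, f w) / Fintype.card 𝓦 := by
  have : IsProbabilityMeasure (uniformOn (Set.univ : Set 𝓦)) :=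
    isProbabilityMeasure_uniformOn Set.finite_univ Set.univ_nonempty
  unfold channelLaw
  rw [integral_fun_fst]
  simp only [probReal_univ, one_smul]
  rw [integral_fintype Integrable.of_finite, Finset.sum_div]
  refine Finset.sum_congr rfl fun w _ => ?_
  rw [Measure.real, uniformOn_univ]
  simp [div_eq_inv_mul]

lemma integrable_comp_fst [Nonempty 𝓦] (L : Measure (FadingPath K)) [IsProbabilityMeasure L]
    (f : 𝓦 → ℝ) : Integrable (fun o => f o.1) (channelLaw 𝓦 n L) := by
  have : IsProbabilityMeasure (uniformOn (Set.univ : Set 𝓦)) :=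
    isProbabilityMeasure_uniformOn Set.finite_univ Set.univ_nonempty
  have h : Integrable f (uniformOn (Set.univ : Set 𝓦)) := Integrable.of_finite
  unfold channelLaw
  exact h.comp_fst _

/-- **Fano's inequality**: if `φ` can be decoded from the signals in `A` and the class of the
message with error probability at most `δ`, then the signals carry almost all the information on
`φ` that the class does not carry. -/
theorem condEntropy_sub_ge_of_decode [Nonempty 𝓦] (L : Measure (FadingPath K))
    [IsProbabilityMeasure L] {c : Codebook K n 𝓦} (hc : ∀ t w, Measurable (c t w)) (C : Setoid 𝓦)
    (A : Finset (Fin n × Fin K)) {V : Type*} [Fintype V] [Nonempty V] [MeasurableSpace V]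
    [MeasurableSingletonClass V] (φ : 𝓦 → V)
    {dec : 𝓦 → FadingPath K → (Fin n × Fin K → ℂ) → V}
    (hdm : ∀ w, Measurable fun p : FadingPath K × (Fin n × Fin K → ℂ) => dec w p.1 p.2)
    (hdC : ∀ w w', C w w' → dec w = dec w')
    (hdA : ∀ w ω, DependsOn (dec w ω) (A : Set (Fin n × Fin K)))
    {δ : ℝ} (hδ : 0 ≤ δ)
    (herr : channelLaw 𝓦 n L {o | dec o.1 o.2.1 (observed c o) ≠ φ o.1} ≤ ENNReal.ofReal δ) :
    classEntropy C - classEntropy (C ⊓ Setoid.ker φ)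
        - (Real.log 2 + δ * Real.log (Fintype.card V))
      ≤ condEntropy L c C A - condEntropy L c (C ⊓ Setoid.ker φ) A := by
  classical
  have hV : (1 : ℝ) ≤ Fintype.card V := by exact_mod_cast Fintype.card_pos
  set C' := C ⊓ Setoid.ker φ with hC'
  -- An even mixture of the decoder's output and a uniform guess: a correct decision costs at most
  -- log 2, a wrong one log 2 + log |V|, and the weight never vanishes.
  set ρ : 𝓦 → FadingPath K → (Fin n × Fin K → ℂ) → V → ℝ := fun w ω y v =>
    1 / 2 * (if dec w ω y = v then 1 else 0) + 1 / 2 * (Fintype.card V : ℝ)⁻¹ with hρ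
  have hρpos : ∀ w ω y v, 0 < ρ w ω y v := fun w ω y v => by
    simp only [hρ]; split_ifs <;> positivity
  have hρm : ∀ w, Measurable fun p : FadingPath K × (Fin n × Fin K → ℂ) => ρ w p.1 p.2 (φ w) := by
    intro w
    have : Measurable fun p : FadingPath K × (Fin n × Fin K → ℂ) =>
        (if dec w p.1 p.2 = φ w then (1 : ℝ) else 0) :=
      Measurable.ite (hdm w (measurableSet_singleton _)) measurable_const measurable_const
    exact (this.const_mul _).add_const _
  have hρom : Measurable fun o => ρ o.1 o.2.1 (observed c o) (φ o.1) :=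
    measurable_comp_observed hc (X := fun w ω y => ρ w ω y (φ w)) hρm
  have hlogρ : ∀ w ω y, Real.log (ρ w ω y (φ w)) ≥
      -Real.log 2 - (if dec w ω y ≠ φ w then 1 else 0) * Real.log (Fintype.card V) := by
    intro w ω y
    by_cases h : dec w ω y = φ w
    · have h1 : (1 / 2 : ℝ) ≤ ρ w ω y (φ w) := by
        simp only [hρ, h, if_true]; linarith [inv_nonneg.2 (by linarith : (0 : ℝ) ≤ Fintype.card V)]
      have h2 := Real.log_le_log (by norm_num) h1
      rw [one_div, Real.log_inv] at h2
      simpa [h] using h2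
    · have h1 : (1 / 2 : ℝ) * (Fintype.card V : ℝ)⁻¹ = ρ w ω y (φ w) := by
        simp only [hρ, h, if_false]; ring
      rw [← h1, Real.log_mul (by norm_num) (by positivity), Real.log_inv, one_div, Real.log_inv]
      simp [h, sub_eq_add_neg]
  have hρle : ∀ w ω y v, ρ w ω y v ≤ 1 := fun w ω y v => by
    have := inv_le_one_of_one_le₀ hV
    simp only [hρ]; split_ifs <;> linarith
  have hcl : ∀ E : Setoid 𝓦, ∀ o : 𝓦 × FadingPath K × (Fin n → Fin K → ℂ),
      Real.log (∑ w' ∈ eqvClass E o.1, likelihood c A o.2.1 (observed c o) w')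
        = Real.log (mixture c E A o.1 o.2.1 (observed c o)) + Real.log (eqvClass E o.1).card := by
    intro E o
    unfold mixture classAvg
    rw [Real.log_div (sum_eqvClass_pos E (likelihood_pos c A _ _) _).ne'
      (card_eqvClass_pos E _).ne']
    ring
  have hsm : ∀ E : Setoid 𝓦, ∀ w, Measurable fun p : FadingPath K × (Fin n × Fin K → ℂ) =>
      ∑ w' ∈ eqvClass E w, likelihood c A p.1 p.2 w' := fun E w =>
    Finset.measurable_sum _ fun w' _ => measurable_likelihood hc A w'
  have hsom : ∀ E : Setoid 𝓦, Measurable fun o =>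
      ∑ w' ∈ eqvClass E o.1, likelihood c A o.2.1 (observed c o) w' := fun E =>
    measurable_comp_observed hc
      (X := fun w ω y => ∑ w' ∈ eqvClass E w, likelihood c A ω y w') (hsm E)
  have hsi : ∀ E : Setoid 𝓦, Integrable (fun o =>
      Real.log (∑ w' ∈ eqvClass E o.1, likelihood c A o.2.1 (observed c o) w'))
      (channelLaw 𝓦 n L) := fun E => by
    simp_rw [hcl]
    exact (integrable_log_mixture L hc E A).add
      (integrable_comp_fst L fun w => Real.log (eqvClass E w).card)
  have hsint : ∀ E : Setoid 𝓦, ∫ o,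
      Real.log (∑ w' ∈ eqvClass E o.1, likelihood c A o.2.1 (observed c o) w') ∂(channelLaw 𝓦 n L)
      = -condEntropy L c E A + classEntropy E := fun E => by
    simp_rw [hcl]
    rw [integral_add (integrable_log_mixture L hc E A)
      (integrable_comp_fst L fun w => Real.log (eqvClass E w).card),
      integral_comp_fst L fun w => Real.log (eqvClass E w).card, condEntropy, neg_neg, classEntropy]
  have hρi : Integrable (fun o => Real.log (ρ o.1 o.2.1 (observed c o) (φ o.1)))
      (channelLaw 𝓦 n L) := by
    refine Integrable.mono' (integrable_const (Real.log 2 + Real.log (Fintype.card V)))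
      hρom.log.aestronglyMeasurable (ae_of_all _ fun o => ?_)
    have h1 := hlogρ o.1 o.2.1 (observed c o)
    have h2 := Real.log_nonpos (hρpos o.1 o.2.1 (observed c o) (φ o.1)).le (hρle _ _ _ _)
    have h3 := Real.log_nonneg hV
    rw [Real.norm_eq_abs, abs_of_nonpos h2]
    split_ifs at h1 <;> linarith
  -- The ratio of the class sums over `C'` and `C` is the posterior probability of the true value of
  -- `φ`; the guess `ρ` cannot beat it on average in logarithm.
  have hmain := integral_log_le_of_lintegral_div_le (μ := channelLaw 𝓦 n L)
    (X := fun o => ρ o.1 o.2.1 (observed c o) (φ o.1) *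
      ∑ w' ∈ eqvClass C o.1, likelihood c A o.2.1 (observed c o) w')
    (Y := fun o => ∑ w' ∈ eqvClass C' o.1, likelihood c A o.2.1 (observed c o) w')
    (fun o => mul_pos (hρpos _ _ _ _) (sum_eqvClass_pos _ (likelihood_pos _ _ _ _) _))
    (fun o => sum_eqvClass_pos _ (likelihood_pos _ _ _ _) _) (hρom.mul (hsom C)) (hsom C') ?_
    (hsi C') one_pos ?_
  · have e : ∀ o : 𝓦 × FadingPath K × (Fin n → Fin K → ℂ),
        Real.log (ρ o.1 o.2.1 (observed c o) (φ o.1) *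
          ∑ w' ∈ eqvClass C o.1, likelihood c A o.2.1 (observed c o) w')
        = Real.log (ρ o.1 o.2.1 (observed c o) (φ o.1)) +
          Real.log (∑ w' ∈ eqvClass C o.1, likelihood c A o.2.1 (observed c o) w') := fun o =>
      Real.log_mul (hρpos _ _ _ _).ne' (sum_eqvClass_pos _ (likelihood_pos _ _ _ _) _).ne'
    simp_rw [e] at hmain
    rw [integral_add hρi (hsi C), hsint, hsint, Real.log_one, add_zero] at hmain
    have herrm : MeasurableSet {o | dec o.1 o.2.1 (observed c o) ≠ φ o.1} :=
      (measurableSet_eq_fun (measurable_comp_observed hc hdm)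
        ((measurable_of_finite φ).comp measurable_fst)).compl
    have hlow : ∫ o, (-Real.log 2 - ({o | dec o.1 o.2.1 (observed c o) ≠ φ o.1}.indicator
        (fun _ => Real.log (Fintype.card V)) o)) ∂(channelLaw 𝓦 n L)
        ≤ ∫ o, Real.log (ρ o.1 o.2.1 (observed c o) (φ o.1)) ∂(channelLaw 𝓦 n L) := by
      refine integral_mono ((integrable_const _).sub ((integrable_const _).indicator herrm)) hρi
        fun o => ?_
      refine le_trans (le_of_eq ?_) (hlogρ o.1 o.2.1 (observed c o))
      simp [Set.indicator]
    rw [integral_sub (integrable_const _) ((integrable_const _).indicator herrm),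
      integral_indicator_const _ herrm, integral_const] at hlow
    simp only [probReal_univ, smul_eq_mul, one_mul] at hlow
    have hδ' : (channelLaw 𝓦 n L).real {o | dec o.1 o.2.1 (observed c o) ≠ φ o.1} ≤ δ :=
      ENNReal.toReal_le_of_le_ofReal hδ herr
    have := mul_le_mul_of_nonneg_right hδ' (Real.log_nonneg hV)
    linarith
  · have e : ∀ o : 𝓦 × FadingPath K × (Fin n → Fin K → ℂ),
        Real.log (ρ o.1 o.2.1 (observed c o) (φ o.1) *
          ∑ w' ∈ eqvClass C o.1, likelihood c A o.2.1 (observed c o) w')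
        = Real.log (ρ o.1 o.2.1 (observed c o) (φ o.1)) +
          Real.log (∑ w' ∈ eqvClass C o.1, likelihood c A o.2.1 (observed c o) w') := fun o =>
      Real.log_mul (hρpos _ _ _ _).ne' (sum_eqvClass_pos _ (likelihood_pos _ _ _ _) _).ne'
    simp_rw [e]
    exact hρi.add (hsi C)
  · rw [ENNReal.ofReal_one]
    refine lintegral_observed_le L hc (A := A)
      (f := fun w ω y => ENNReal.ofReal (ρ w ω y (φ w) *
        (∑ w' ∈ eqvClass C w, likelihood c A ω y w') /
          ∑ w' ∈ eqvClass C' w, likelihood c A ω y w'))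
      (fun w => (((hρm w).mul (hsm C w)).div (hsm C' w)).ennreal_ofReal) (fun w ω y y' h => ?_)
      fun ω y => ?_
    · simp only [hρ]
      rw [hdA w ω h, Finset.sum_congr rfl fun w' _ => dependsOn_likelihood c A ω w' h,
        Finset.sum_congr rfl fun w' _ => dependsOn_likelihood c A ω w' h]
    · refine le_trans (lmarginal_mono (g := fun y => ∑ w, ENNReal.ofReal (likelihood c A ω y w))
        (fun y => ?_) y) (lmarginal_sum_le (fun w => ?_) y
          fun w => lmarginal_likelihood_le_one c A ω w y)
      · have := sum_mul_guess_le C φ (likelihood_pos c A ω y) (ρ := fun w => ρ w ω y)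
          (fun w w' h => by simp only [hρ]; rw [hdC w w' h]) (fun w v => (hρpos w ω y v).le)
          (fun w => by
            simp only [hρ]
            rw [Finset.sum_add_distrib, ← Finset.mul_sum]
            simp only [Finset.sum_ite_eq, Finset.mem_univ, if_true, Finset.sum_const,
              Finset.card_univ, nsmul_eq_mul]
            have : (Fintype.card V : ℝ) ≠ 0 := by positivity
            field_simp
            norm_num)
        simp only
        rw [← ENNReal.ofReal_sum_of_nonneg fun w _ => (likelihood_pos c A ω y w).le]
        refine le_trans (le_of_eq ?_) (ENNReal.ofReal_le_ofReal this)
        rw [ENNReal.ofReal_sum_of_nonneg]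
        · refine Finset.sum_congr rfl fun w _ => ?_
          rw [← ENNReal.ofReal_mul (likelihood_pos _ _ _ _ _).le]
        · intro w _
          exact (mul_pos (likelihood_pos _ _ _ _ _) (div_pos (mul_pos (hρpos _ _ _ _)
            (sum_eqvClass_pos _ (likelihood_pos _ _ _ _) _))
            (sum_eqvClass_pos _ (likelihood_pos _ _ _ _) _))).le
      · exact ((measurable_likelihood hc A w).comp
          (measurable_const.prodMk measurable_id)).ennreal_ofReal

end Entropy

/-! ### Averaging over the current estimation error -/

section Fading

variable {K : ℕ}

/-- A fading path with given feedback and given estimation errors at time `t`. -/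
def pathOfError (t : ℕ) (fb : (Fin (t + 1) → CSI K) × (Fin t → CSI K)) (e : Fin K × Fin K → ℂ) :
    FadingPath K := fun τ =>
  -- Times after `t` just repeat time `t`. This is harmless because the integrands depend only on
  -- the feedback and the channel at time `t`.
  if h : τ < t then (fb.1 ⟨τ, by omega⟩, fb.2 ⟨τ, h⟩)
  else (fb.1 (Fin.last t), fun k i => fb.1 (Fin.last t) k i + e (k, i))

lemma measurable_pathOfError (t : ℕ) : Measurable fun p :
    ((Fin (t + 1) → CSI K) × (Fin t → CSI K)) × (Fin K × Fin K → ℂ) => pathOfError t p.1 p.2 := by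
  refine measurable_pi_lambda _ fun τ => ?_
  unfold pathOfError
  by_cases h : τ < t
  · simp only [h, dif_pos]
    fun_prop
  · simp only [h, dif_neg, not_false_iff]
    fun_prop

lemma feedback_pathOfError (t : ℕ) (fb : (Fin (t + 1) → CSI K) × (Fin t → CSI K))
    (e : Fin K × Fin K → ℂ) : feedback t (pathOfError t fb e) = fb := by
  refine Prod.ext (funext fun τ => ?_) (funext fun τ => ?_)
  · simp only [feedback, pathOfError]
    by_cases h : (τ : ℕ) < t
    · simp [h]
    · have : τ = Fin.last t := Fin.ext (by have := τ.2; simp only [Fin.val_last]; omega)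
      subst this
      simp
  · simp [feedback, pathOfError]

lemma pathOfError_snd (t : ℕ) (fb : (Fin (t + 1) → CSI K) × (Fin t → CSI K))
    (e : Fin K × Fin K → ℂ) (k i : Fin K) :
    (pathOfError t fb e t).2 k i = fb.1 (Fin.last t) k i + e (k, i) := by
  simp [pathOfError]

lemma feedback_eq_of_le {t τ : ℕ} {ω ω' : FadingPath K} (h : feedback t ω = feedback t ω')
    (hτ : τ ≤ t) : feedback τ ω = feedback τ ω' := by
  refine Prod.ext (funext fun i => ?_) (funext fun i => ?_)
  · exact congrFun (congrArg Prod.fst h) ⟨i, by omega⟩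
  · exact congrFun (congrArg Prod.snd h) ⟨i, by omega⟩

lemma channel_eq_of_lt {t τ : ℕ} {ω ω' : FadingPath K} (h : feedback t ω = feedback t ω')
    (hτ : τ < t) : (ω τ).2 = (ω' τ).2 :=
  congrFun (congrArg Prod.snd h) ⟨τ, hτ⟩

@[fun_prop]
lemma measurable_csiError (t : ℕ) (k i : Fin K) : Measurable (csiError t k i) := by
  unfold csiError; fun_prop

variable {α : ℝ} (F : FadingModel K α) {P : ℝ}

/-- Freshness and mutual independence of the errors make the joint law of feedback and error entries
a product measure, so a single error entry can be integrated out with everything else fixed. -/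
lemma FadingModel.lintegral_eq_lintegral_error (hP : 1 < P) (t : ℕ) {f : FadingPath K → ℝ≥0∞}
    (hf : Measurable f)
    (hinv : ∀ ω ω', feedback t ω = feedback t ω' → (ω t).2 = (ω' t).2 → f ω = f ω') :
    ∫⁻ ω, f ω ∂(F.law P) = ∫⁻ fb, ∫⁻ e, f (pathOfError t fb e)
      ∂(Measure.pi fun a : Fin K × Fin K => (F.law P).map (csiError t a.1 a.2))
      ∂((F.law P).map (feedback t)) := by
  have := F.isProb P
  have hprob : ∀ a : Fin K × Fin K, IsProbabilityMeasure ((F.law P).map (csiError t a.1 a.2)) :=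
    fun a => Measure.isProbabilityMeasure_map (by fun_prop)
  have h1 : IndepFun (feedback t) (fun ω (a : Fin K × Fin K) => csiError t a.1 a.2 ω) (F.law P) :=
    ((F.error_indep_feedback P hP t).comp
      (φ := fun (e : Fin K → Fin K → ℂ) (a : Fin K × Fin K) => e a.1 a.2)
      (ψ := id) (by fun_prop) measurable_id).symm
  have h2 := (indepFun_iff_map_prod_eq_prod_map_map (by fun_prop) (by fun_prop)).1 h1
  have h3 := (iIndepFun_iff_map_fun_eq_pi_map
    (fun a => by fun_prop)).1 (F.error_iIndep P hP t)
  rw [h3] at h2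
  have hm : Measurable fun p :
      ((Fin (t + 1) → CSI K) × (Fin t → CSI K)) × (Fin K × Fin K → ℂ) => f (pathOfError t p.1 p.2) :=
    hf.comp (measurable_pathOfError t)
  rw [← lintegral_prod _ hm.aemeasurable, ← h2, lintegral_map hm (by fun_prop)]
  refine lintegral_congr fun ω => hinv _ _ (feedback_pathOfError _ _ _).symm ?_
  ext k i
  rw [pathOfError_snd]
  simp [csiError, feedback]

/-- The factor in the comparison of the signals of two users, for channel errors of density at
most `C / σ`. -/
noncomputable def errorGain (K : ℕ) (C σ : ℝ≥0) : ℝ := 2 * (1 + K * (C / σ : ℝ≥0))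

/-- Given the feedback and the channels of the other users, the noisy inner product of an input
difference `d` with the channel of user `j` is near zero with density at most of order
`1 / (1 + ‖d‖²)`. -/
lemma FadingModel.lintegral_mul_noiseDensity_le (hP : 1 < P) {C : ℝ≥0} {j : Fin K}
    (hC : ∀ t i, (F.law P).map (csiError t j i) ≤ ((C / F.mse j P : ℝ≥0) : ℝ≥0∞) • volume)
    (t : ℕ) {r : FadingPath K → ℝ≥0∞} (hr : Measurable r)
    (hrinv : ∀ ω ω', feedback t ω = feedback t ω' → (∀ i ≠ j, (ω t).2 i = (ω' t).2 i) →
      r ω = r ω')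
    {d : FadingPath K → Fin K → ℂ} (hd : Measurable d)
    (hdinv : ∀ ω ω', feedback t ω = feedback t ω' → d ω = d ω') (z : ℂ) :
    ∫⁻ ω, r ω * ENNReal.ofReal (noiseDensity (∑ i, (ω t).2 j i * d ω i + z)) ∂(F.law P) ≤
      ∫⁻ ω, r ω * ENNReal.ofReal (errorGain K C (F.mse j P) / (1 + ∑ i, ‖d ω i‖ ^ 2))
        ∂(F.law P) := by
  have := F.isProb P
  have hprob : ∀ a : Fin K × Fin K, IsProbabilityMeasure ((F.law P).map (csiError t a.1 a.2)) :=
    fun a => Measure.isProbabilityMeasure_map (by fun_prop)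
  set g : ℝ≥0 := C / F.mse j P with hg
  have hm1 : Measurable fun ω : FadingPath K =>
      r ω * ENNReal.ofReal (noiseDensity (∑ i, (ω t).2 j i * d ω i + z)) := by
    refine hr.mul (Measurable.ennreal_ofReal (measurable_noiseDensity.comp ?_))
    exact (Finset.measurable_sum _ fun i _ => Measurable.mul (by fun_prop)
      ((measurable_pi_apply i).comp hd)).add_const _
  have hm2 : Measurable fun ω : FadingPath K =>
      r ω * ENNReal.ofReal (errorGain K C (F.mse j P) / (1 + ∑ i, ‖d ω i‖ ^ 2)) := by
    refine hr.mul (Measurable.ennreal_ofReal (Measurable.const_div ?_ _))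
    exact (Finset.measurable_sum _ fun i _ =>
      (((measurable_pi_apply i).comp hd).norm.pow_const 2)).const_add _
  rw [F.lintegral_eq_lintegral_error hP t hm1, F.lintegral_eq_lintegral_error hP t hm2]
  rotate_left
  · intro ω ω' h1 h2
    rw [hrinv ω ω' h1 fun i _ => congrFun h2 i, hdinv ω ω' h1]
  · intro ω ω' h1 h2
    rw [hrinv ω ω' h1 fun i _ => congrFun h2 i, hdinv ω ω' h1, h2]
  refine lintegral_mono fun fb => ?_
  set D : Fin K → ℂ := d (pathOfError t fb 0) with hD
  have hde : ∀ e, d (pathOfError t fb e) = D := fun e =>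
    hdinv _ _ (by rw [feedback_pathOfError, feedback_pathOfError])
  simp_rw [hde]
  set S : ℝ := ∑ i, ‖D i‖ ^ 2 with hS
  have hS0 : 0 ≤ S := Finset.sum_nonneg fun _ _ => by positivity
  -- For close inputs the trivial bound 1 on the noise density suffices; the factor 2 in `errorGain`
  -- covers 1 + S ≤ 2.
  by_cases hS1 : S ≤ 1
  · refine lintegral_mono fun e => ?_
    gcongr
    refine (noiseDensity_le_one _).trans ?_
    rw [le_div_iff₀ (by positivity), one_mul]
    have : 0 ≤ (K : ℝ) * (g : ℝ) := by positivity
    change 1 + S ≤ 2 * (1 + K * (g : ℝ))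
    linarith
  push Not at hS1
  -- For distant inputs, the antenna with the largest difference carries at least S/K, and only the
  -- error entry of that antenna is averaged.
  obtain ⟨i₀, -, hi₀⟩ := Finset.exists_max_image Finset.univ (fun i => ‖D i‖ ^ 2) ⟨j, by simp⟩
  have hSK : S ≤ K * ‖D i₀‖ ^ 2 := by
    calc S ≤ ∑ _i : Fin K, ‖D i₀‖ ^ 2 := Finset.sum_le_sum fun i _ => hi₀ i (Finset.mem_univ _)
      _ = _ := by simp
  have hpos : 0 < ‖D i₀‖ ^ 2 := by
    by_contra h
    have : ‖D i₀‖ ^ 2 = 0 := le_antisymm (not_lt.1 h) (by positivity)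
    rw [this, mul_zero] at hSK
    linarith
  have hD0 : D i₀ ≠ 0 := fun h => by rw [h] at hpos; simp at hpos
  have hme : Measurable fun e => pathOfError t fb e :=
    (measurable_pathOfError t).comp (measurable_const.prodMk measurable_id)
  refine lintegral_le_of_lmarginal_le {(j, i₀)} ?_ ?_ ?_
  · refine (hr.comp hme).mul (Measurable.ennreal_ofReal (measurable_noiseDensity.comp ?_))
    refine (Finset.measurable_sum _ fun i _ => Measurable.mul_const ?_ _).add_const _
    exact (by fun_prop : Measurable fun ω : FadingPath K => (ω t).2 j i).comp hme
  · exact (hr.comp hme).mul_const _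
  rw [lmarginal_singleton, lmarginal_singleton]
  intro e
  have hre : ∀ v, r (pathOfError t fb (Function.update e (j, i₀) v)) = r (pathOfError t fb e) := by
    intro v
    refine hrinv _ _ (by rw [feedback_pathOfError, feedback_pathOfError]) fun i hi => ?_
    ext l
    rw [pathOfError_snd, pathOfError_snd, Function.update_of_ne]
    exact fun h => hi (congrArg Prod.fst h)
  set b : ℂ := ∑ i, (pathOfError t fb (Function.update e (j, i₀) 0) t).2 j i * D i + z with hb
  have hlin : ∀ v, ∑ i, (pathOfError t fb (Function.update e (j, i₀) v) t).2 j i * D i + z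
      = b + v * D i₀ := by
    intro v
    have : ∀ i, (pathOfError t fb (Function.update e (j, i₀) v) t).2 j i * D i
        = (pathOfError t fb (Function.update e (j, i₀) 0) t).2 j i * D i
          + if i = i₀ then v * D i₀ else 0 := by
      intro i
      rw [pathOfError_snd, pathOfError_snd]
      by_cases h : i = i₀
      · subst h; simp; ring
      · rw [Function.update_of_ne (by simp [h]), Function.update_of_ne (by simp [h]), if_neg h,
          add_zero]
    simp_rw [this]
    rw [Finset.sum_add_distrib, Finset.sum_ite_eq', if_pos (Finset.mem_univ _), hb]
    ring
  simp only [hre, hlin]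
  have := hprob (j, i₀)
  rw [lintegral_const_mul _ (by fun_prop), lintegral_const, measure_univ, mul_one]
  gcongr
  calc ∫⁻ v, ENNReal.ofReal (noiseDensity (b + v * D i₀)) ∂(F.law P).map (csiError t j i₀)
      ≤ ∫⁻ v, ENNReal.ofReal (noiseDensity (b + v * D i₀)) ∂((g : ℝ≥0∞) • volume) :=
        lintegral_mono' (hC t i₀) le_rfl
    _ ≤ g * ENNReal.ofReal (1 / ‖D i₀‖ ^ 2) := by
        rw [lintegral_smul_measure, smul_eq_mul]
        gcongr
        exact lintegral_noiseDensity_affine_le b _ hD0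
    _ = ENNReal.ofReal (g * (1 / ‖D i₀‖ ^ 2)) := by
        rw [ENNReal.ofReal_mul g.coe_nonneg, ENNReal.ofReal_coe_nnreal]
    _ ≤ _ := by
        refine ENNReal.ofReal_le_ofReal ?_
        rw [mul_one_div, div_le_div_iff₀ hpos (by positivity)]
        change (g : ℝ) * (1 + S) ≤ 2 * (1 + K * (g : ℝ)) * ‖D i₀‖ ^ 2
        -- Since S > 1, one has 1 + S ≤ 2S ≤ 2K‖D i₀‖².
        have h1 : (g : ℝ) * (1 + S) ≤ g * (2 * (K * ‖D i₀‖ ^ 2)) :=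
          mul_le_mul_of_nonneg_left (by linarith) g.coe_nonneg
        nlinarith

end Fading

/-! ### Entropy of a new signal bounded below by the concentration of the inputs -/

section Comparison

variable {K n : ℕ} {𝓦 : Type*}

/-- The squared distance of the channel inputs for two messages. -/
noncomputable def inputDist (c : Codebook K n 𝓦) (t : Fin n) (ω : FadingPath K) (w w' : 𝓦) : ℝ :=
  ∑ i, ‖c t w (feedback t ω) i - c t w' (feedback t ω) i‖ ^ 2

lemma inputDist_nonneg (c : Codebook K n 𝓦) (t : Fin n) (ω : FadingPath K) (w w' : 𝓦) :
    0 ≤ inputDist c t ω w w' := Finset.sum_nonneg fun _ _ => by positivity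

lemma one_add_inputDist_pos (c : Codebook K n 𝓦) (t : Fin n) (ω : FadingPath K) (w w' : 𝓦) :
    0 < 1 + inputDist c t ω w w' := by linarith [inputDist_nonneg c t ω w w']

lemma inputDist_self (c : Codebook K n 𝓦) (t : Fin n) (ω : FadingPath K) (w : 𝓦) :
    inputDist c t ω w w = 0 := by simp [inputDist]

lemma measurable_inputDist {c : Codebook K n 𝓦} (hc : ∀ t w, Measurable (c t w)) (t : Fin n)
    (w w' : 𝓦) : Measurable fun ω => inputDist c t ω w w' :=
  Finset.measurable_sum _ fun i _ => (((measurable_pi_apply i).comp (measurable_input hc t w)).sub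
    ((measurable_pi_apply i).comp (measurable_input hc t w'))).norm.pow_const 2

/-- With message and noise fixed, the signals in `A` involve inputs up to the time of `b` and
channels other than the one of `b`. The posterior weights are therefore unaffected by averaging over
the error of that channel. -/
lemma likelihood_observed_congr (c : Codebook K n 𝓦) {A : Finset (Fin n × Fin K)}
    {b : Fin n × Fin K} (hA : ∀ a ∈ A, a.1 < b.1 ∨ a.1 = b.1 ∧ a.2 ≠ b.2) {ω ω' : FadingPath K}
    (h : feedback b.1 ω = feedback b.1 ω') (h' : ∀ i ≠ b.2, (ω b.1).2 i = (ω' b.1).2 i)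
    (w w' : 𝓦) (z : Fin n → Fin K → ℂ) :
    likelihood c A ω (observed c (w, ω, z)) w' = likelihood c A ω' (observed c (w, ω', z)) w' := by
  unfold likelihood
  refine Finset.prod_congr rfl fun a ha => ?_
  have hs : ∀ w, signal c ω w a = signal c ω' w a := by
    intro w
    unfold signal
    rcases hA a ha with hlt | ⟨heq, hne⟩
    · rw [feedback_eq_of_le h (show (a.1 : ℕ) ≤ b.1 from hlt.le),
        channel_eq_of_lt h (show (a.1 : ℕ) < b.1 from hlt)]
    · rw [feedback_eq_of_le h (show (a.1 : ℕ) ≤ b.1 from heq.le)]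
      have := h' a.2 hne
      rw [← heq] at this
      rw [this]
  simp only [observed, hs]

variable [Fintype 𝓦]

/-- The posterior mean of `1 / (1 + ‖x - x'‖²)`, where `x` is the actual channel input at time `t`
and `x'` that of a message drawn from the posterior given the signals in `A`. -/
noncomputable def concentration (c : Codebook K n 𝓦) (E : Setoid 𝓦) (A : Finset (Fin n × Fin K))
    (t : Fin n) (w : 𝓦) (ω : FadingPath K) (y : Fin n × Fin K → ℂ) : ℝ :=
  (∑ w' ∈ eqvClass E w, likelihood c A ω y w' / (1 + inputDist c t ω w w')) /
    ∑ w' ∈ eqvClass E w, likelihood c A ω y w'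

lemma sum_likelihood_div_pos (c : Codebook K n 𝓦) (E : Setoid 𝓦) (A : Finset (Fin n × Fin K))
    (t : Fin n) (w : 𝓦) (ω : FadingPath K) (y : Fin n × Fin K → ℂ) :
    0 < ∑ w' ∈ eqvClass E w, likelihood c A ω y w' / (1 + inputDist c t ω w w') :=
  Finset.sum_pos (fun _ _ => div_pos (likelihood_pos _ _ _ _ _) (one_add_inputDist_pos _ _ _ _ _))
    ⟨w, self_mem_eqvClass E w⟩

lemma concentration_pos (c : Codebook K n 𝓦) (E : Setoid 𝓦) (A : Finset (Fin n × Fin K))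
    (t : Fin n) (w : 𝓦) (ω : FadingPath K) (y : Fin n × Fin K → ℂ) :
    0 < concentration c E A t w ω y :=
  div_pos (sum_likelihood_div_pos _ _ _ _ _ _ _) (sum_eqvClass_pos _ (likelihood_pos _ _ _ _) _)

lemma concentration_le_one (c : Codebook K n 𝓦) (E : Setoid 𝓦) (A : Finset (Fin n × Fin K))
    (t : Fin n) (w : 𝓦) (ω : FadingPath K) (y : Fin n × Fin K → ℂ) :
    concentration c E A t w ω y ≤ 1 := by
  unfold concentration
  rw [div_le_one (sum_eqvClass_pos _ (likelihood_pos _ _ _ _) _)]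
  exact Finset.sum_le_sum fun w' _ => div_le_self (likelihood_pos _ _ _ _ _).le
    (by linarith [inputDist_nonneg c t ω w w'])

lemma likelihood_div_card_le_concentration (c : Codebook K n 𝓦) (E : Setoid 𝓦)
    (A : Finset (Fin n × Fin K)) (t : Fin n) (w : 𝓦) (ω : FadingPath K)
    (y : Fin n × Fin K → ℂ) :
    likelihood c A ω y w / Fintype.card 𝓦 ≤ concentration c E A t w ω y := by
  unfold concentration
  refine div_le_div₀ (sum_likelihood_div_pos _ _ _ _ _ _ _).le ?_
    (sum_eqvClass_pos _ (likelihood_pos _ _ _ _) _) ?_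
  · have := Finset.single_le_sum
      (f := fun w' => likelihood c A ω y w' / (1 + inputDist c t ω w w'))
      (fun w' _ => (div_pos (likelihood_pos _ _ _ _ _) (one_add_inputDist_pos c t ω w w')).le)
      (self_mem_eqvClass E w)
    simpa [inputDist_self] using this
  · calc _ ≤ ∑ w' ∈ eqvClass E w, (1 : ℝ) :=
          Finset.sum_le_sum fun _ _ => likelihood_le_one _ _ _ _ _
      _ = (eqvClass E w).card := by simp
      _ ≤ _ := card_eqvClass_le E w

lemma measurable_concentration {c : Codebook K n 𝓦} (hc : ∀ t w, Measurable (c t w))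
    (E : Setoid 𝓦) (A : Finset (Fin n × Fin K)) (t : Fin n) (w : 𝓦) :
    Measurable fun p : FadingPath K × (Fin n × Fin K → ℂ) => concentration c E A t w p.1 p.2 :=
  (Finset.measurable_sum _ fun w' _ => (measurable_likelihood hc A w').div
    (((measurable_inputDist hc t w w').comp measurable_fst).const_add 1)).div
    (Finset.measurable_sum _ fun w' _ => measurable_likelihood hc A w')

/-- The new signal contributes one noise density per message, and subtracting the actual signal
turns its argument into the channel applied to an input difference plus noise. The quotient thus has
the form averaged in `FadingModel.lintegral_sum_mul_noiseDensity_le`. -/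
lemma mixture_insert_div_eq (c : Codebook K n 𝓦) (E : Setoid 𝓦) {A : Finset (Fin n × Fin K)}
    {b : Fin n × Fin K} (hbA : b ∉ A) (w : 𝓦) (ω : FadingPath K) (z : Fin n → Fin K → ℂ) :
    mixture c E (insert b A) w ω (observed c (w, ω, z)) /
      (mixture c E A w ω (observed c (w, ω, z)) *
        concentration c E A b.1 w ω (observed c (w, ω, z)))
      = ∑ w' ∈ eqvClass E w, likelihood c A ω (observed c (w, ω, z)) w' /
          (∑ v ∈ eqvClass E w, likelihood c A ω (observed c (w, ω, z)) v /
            (1 + ∑ i, ‖c b.1 w (feedback b.1 ω) i - c b.1 v (feedback b.1 ω) i‖ ^ 2)) *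
          noiseDensity (∑ i, (ω b.1).2 b.2 i *
          (c b.1 w (feedback b.1 ω) i - c b.1 w' (feedback b.1 ω) i) + z b.1 b.2) := by
  have h1 : ∀ w', likelihood c (insert b A) ω (observed c (w, ω, z)) w' =
      likelihood c A ω (observed c (w, ω, z)) w' * noiseDensity (∑ i, (ω b.1).2 b.2 i *
        (c b.1 w (feedback b.1 ω) i - c b.1 w' (feedback b.1 ω) i) + z b.1 b.2) := by
    intro w'
    simp only [likelihood]
    rw [Finset.prod_insert hbA, mul_comm]
    congr 2
    simp only [observed, signal, mul_sub, Finset.sum_sub_distrib]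
    ring
  have hs := (sum_eqvClass_pos E (likelihood_pos c A ω (observed c (w, ω, z))) w).ne'
  have hN := (card_eqvClass_pos E w).ne'
  have hQ0 := (sum_likelihood_div_pos c E A b.1 w ω (observed c (w, ω, z))).ne'
  unfold inputDist at hQ0
  unfold concentration mixture classAvg inputDist
  rw [Finset.sum_congr rfl fun w' _ => h1 w']
  simp_rw [div_mul_eq_mul_div]
  rw [← Finset.sum_div]
  generalize (∑ i ∈ eqvClass E w, likelihood c A ω (observed c (w, ω, z)) i * noiseDensity _) = x
  field_simp

variable {α : ℝ} (F : FadingModel K α) {P : ℝ}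

/-- The bound of `FadingModel.lintegral_mul_noiseDensity_le`, averaged with arbitrary weights. -/
lemma FadingModel.lintegral_sum_mul_noiseDensity_le {𝓥 : Type*} (hP : 1 < P) {C : ℝ≥0} {j : Fin K}
    (hC : ∀ t i, (F.law P).map (csiError t j i) ≤ ((C / F.mse j P : ℝ≥0) : ℝ≥0∞) • volume)
    (t : ℕ) {s : Finset 𝓥} (hs : s.Nonempty) {l : 𝓥 → FadingPath K → ℝ} (hl : ∀ w ω, 0 < l w ω)
    (hlm : ∀ w, Measurable (l w))
    (hlinv : ∀ w ω ω', feedback t ω = feedback t ω' → (∀ i ≠ j, (ω t).2 i = (ω' t).2 i) →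
      l w ω = l w ω')
    {d : 𝓥 → FadingPath K → Fin K → ℂ} (hd : ∀ w, Measurable (d w))
    (hdinv : ∀ w ω ω', feedback t ω = feedback t ω' → d w ω = d w ω') (z : ℂ) :
    ∫⁻ ω, ENNReal.ofReal (∑ w ∈ s, l w ω / (∑ v ∈ s, l v ω / (1 + ∑ i, ‖d v ω i‖ ^ 2)) *
      noiseDensity (∑ i, (ω t).2 j i * d w ω i + z)) ∂(F.law P) ≤
      ENNReal.ofReal (errorGain K C (F.mse j P)) := by
  have := F.isProb P
  set κ := errorGain K C (F.mse j P) with hκ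
  have hκpos : 0 < κ := by rw [hκ]; unfold errorGain; positivity
  have hdpos : ∀ v ω, 0 < 1 + ∑ i, ‖d v ω i‖ ^ 2 := fun v ω => by positivity
  have hdm : ∀ v, Measurable fun ω => 1 + ∑ i, ‖d v ω i‖ ^ 2 := fun v =>
    (Finset.measurable_sum _ fun i _ =>
      (((measurable_pi_apply i).comp (hd v)).norm.pow_const 2)).const_add _
  obtain ⟨Q, hQ⟩ : ∃ Q : FadingPath K → ℝ,
      Q = fun ω => ∑ v ∈ s, l v ω / (1 + ∑ i, ‖d v ω i‖ ^ 2) := ⟨_, rfl⟩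
  have hQ' : ∀ ω, ∑ v ∈ s, l v ω / (1 + ∑ i, ‖d v ω i‖ ^ 2) = Q ω := fun ω => by rw [hQ]
  have hQpos : ∀ ω, 0 < Q ω := fun ω => by
    rw [← hQ']; exact Finset.sum_pos (fun w _ => div_pos (hl _ _) (hdpos _ _)) hs
  have hQm : Measurable Q := by
    rw [hQ]; exact Finset.measurable_sum _ fun w _ => (hlm w).div (hdm w)
  have hrm : ∀ w, Measurable fun ω => ENNReal.ofReal (l w ω / Q ω) := fun w =>
    ((hlm w).div hQm).ennreal_ofReal
  simp_rw [hQ']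
  have e1 : ∀ ω, ENNReal.ofReal (∑ w ∈ s, l w ω / Q ω *
      noiseDensity (∑ i, (ω t).2 j i * d w ω i + z)) = ∑ w ∈ s, ENNReal.ofReal (l w ω / Q ω) *
      ENNReal.ofReal (noiseDensity (∑ i, (ω t).2 j i * d w ω i + z)) := fun ω => by
    rw [ENNReal.ofReal_sum_of_nonneg fun w _ =>
      (mul_pos (div_pos (hl _ _) (hQpos _)) (noiseDensity_pos _)).le]
    exact Finset.sum_congr rfl fun w _ => ENNReal.ofReal_mul (div_pos (hl _ _) (hQpos _)).le
  -- Once noise densities are replaced by κ/(1 + ‖d‖²), the sum equals κ times its own denominator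
  -- `Q`. This is why the concentration is the right normalization.
  have e2 : ∀ ω, ∑ w ∈ s, ENNReal.ofReal (l w ω / Q ω) *
      ENNReal.ofReal (κ / (1 + ∑ i, ‖d w ω i‖ ^ 2)) = ENNReal.ofReal κ := fun ω => by
    have h1 : ∀ w, ENNReal.ofReal (l w ω / Q ω) * ENNReal.ofReal (κ / (1 + ∑ i, ‖d w ω i‖ ^ 2))
        = ENNReal.ofReal (κ / Q ω * (l w ω / (1 + ∑ i, ‖d w ω i‖ ^ 2))) := fun w => by
      rw [← ENNReal.ofReal_mul (div_pos (hl _ _) (hQpos _)).le]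
      congr 1
      ring
    simp_rw [h1]
    rw [← ENNReal.ofReal_sum_of_nonneg fun w _ =>
      (mul_pos (div_pos hκpos (hQpos _)) (div_pos (hl _ _) (hdpos _ _))).le, ← Finset.mul_sum, hQ',
      div_mul_cancel₀ _ (hQpos ω).ne']
  simp_rw [e1]
  rw [lintegral_finsetSum]
  · calc _ ≤ ∑ w ∈ s, ∫⁻ ω, ENNReal.ofReal (l w ω / Q ω) *
          ENNReal.ofReal (κ / (1 + ∑ i, ‖d w ω i‖ ^ 2)) ∂(F.law P) := by
          refine Finset.sum_le_sum fun w _ => ?_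
          refine F.lintegral_mul_noiseDensity_le hP hC t (hrm w) (fun ω ω' h h' => ?_) (hd w)
            (hdinv w) z
          rw [← hQ', ← hQ', hlinv w ω ω' h h', Finset.sum_congr rfl fun v _ => by
            rw [hlinv v ω ω' h h', hdinv v ω ω' h]]
      _ = ∫⁻ ω, ENNReal.ofReal κ ∂(F.law P) := by
          rw [← lintegral_finsetSum]
          · simp_rw [e2]
          · exact fun w _ => (hrm w).mul ((hdm w).const_div κ).ennreal_ofReal
      _ = ENNReal.ofReal κ := by simp
  · intro w _
    refine (hrm w).mul (measurable_noiseDensity.comp ?_).ennreal_ofReal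
    refine (Finset.measurable_sum _ fun i _ => Measurable.mul (by fun_prop) ?_).add_const _
    exact (measurable_pi_apply i).comp (hd w)

lemma FadingModel.lintegral_mixture_insert_div_le (hP : 1 < P) {C : ℝ≥0}
    {c : Codebook K n 𝓦} (hc : ∀ t w, Measurable (c t w)) (E : Setoid 𝓦)
    {A : Finset (Fin n × Fin K)} {b : Fin n × Fin K}
    (hC : ∀ t i, (F.law P).map (csiError t b.2 i) ≤ ((C / F.mse b.2 P : ℝ≥0) : ℝ≥0∞) • volume)
    (hA : ∀ a ∈ A, a.1 < b.1 ∨ a.1 = b.1 ∧ a.2 ≠ b.2) (w : 𝓦) (z : Fin n → Fin K → ℂ) :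
    ∫⁻ ω, ENNReal.ofReal (mixture c E (insert b A) w ω (observed c (w, ω, z)) /
      (mixture c E A w ω (observed c (w, ω, z)) * concentration c E A b.1 w ω (observed c (w, ω, z))))
      ∂(F.law P) ≤ ENNReal.ofReal (errorGain K C (F.mse b.2 P)) := by
  have hbA : b ∉ A := fun hb => by
    rcases hA b hb with h | h
    · exact lt_irrefl _ h
    · exact h.2 rfl
  have hom : Measurable fun ω : FadingPath K => observed c (w, ω, z) :=
    measurable_pi_lambda _ fun a => (measurable_signal hc w a).add_const _
  simp_rw [fun ω => mixture_insert_div_eq c E hbA w ω z]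
  exact F.lintegral_sum_mul_noiseDensity_le hP hC b.1 ⟨w, self_mem_eqvClass E w⟩
    (l := fun w' ω => likelihood c A ω (observed c (w, ω, z)) w')
    (d := fun w' ω i => c b.1 w (feedback b.1 ω) i - c b.1 w' (feedback b.1 ω) i)
    (fun w' ω => likelihood_pos _ _ _ _ _)
    (fun w' => measurable_likelihood_comp hc A w' measurable_id hom)
    (fun w' ω ω' h h' => likelihood_observed_congr c hA h h' w w' z)
    (fun w' => measurable_pi_lambda _ fun i =>
      ((measurable_pi_apply i).comp (measurable_input hc b.1 w)).sub
        ((measurable_pi_apply i).comp (measurable_input hc b.1 w')))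
    (fun w' ω ω' h => by rw [h]) (z b.1 b.2)

variable [MeasurableSpace 𝓦] [MeasurableSingletonClass 𝓦]

lemma integrable_log_concentration [Nonempty 𝓦] (L : Measure (FadingPath K))
    [IsProbabilityMeasure L] {c : Codebook K n 𝓦} (hc : ∀ t w, Measurable (c t w)) (E : Setoid 𝓦)
    (A : Finset (Fin n × Fin K)) (t : Fin n) :
    Integrable (fun o => Real.log (concentration c E A t o.1 o.2.1 (observed c o)))
      (channelLaw 𝓦 n L) :=
  integrable_log_of_likelihood_le c A (measurable_comp_observed hc (measurable_concentration hc E A t))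
    (fun _ => concentration_le_one _ _ _ _ _ _ _)
    fun _ => likelihood_div_card_le_concentration _ _ _ _ _ _ _

/-- A new received signal has at least the entropy that the concentration of the channel inputs
allows. -/
theorem FadingModel.integral_log_mixture_insert_le [Nonempty 𝓦] (hP : 1 < P) {C : ℝ≥0}
    {c : Codebook K n 𝓦} (hc : ∀ t w, Measurable (c t w)) (E : Setoid 𝓦)
    {A : Finset (Fin n × Fin K)} {b : Fin n × Fin K}
    (hC : ∀ t i, (F.law P).map (csiError t b.2 i) ≤ ((C / F.mse b.2 P : ℝ≥0) : ℝ≥0∞) • volume)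
    (hA : ∀ a ∈ A, a.1 < b.1 ∨ a.1 = b.1 ∧ a.2 ≠ b.2) :
    ∫ o, Real.log (mixture c E (insert b A) o.1 o.2.1 (observed c o)) ∂(channelLaw 𝓦 n (F.law P)) ≤
      ∫ o, Real.log (mixture c E A o.1 o.2.1 (observed c o)) ∂(channelLaw 𝓦 n (F.law P)) +
      ∫ o, Real.log (concentration c E A b.1 o.1 o.2.1 (observed c o))
        ∂(channelLaw 𝓦 n (F.law P)) +
      Real.log (errorGain K C (F.mse b.2 P)) := by
  have := F.isProb P
  set κ := errorGain K C (F.mse b.2 P) with hκ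
  have hκpos : 0 < κ := by rw [hκ]; unfold errorGain; positivity
  have hYlog : ∀ o : 𝓦 × FadingPath K × (Fin n → Fin K → ℂ),
      Real.log (mixture c E A o.1 o.2.1 (observed c o) *
        concentration c E A b.1 o.1 o.2.1 (observed c o))
      = Real.log (mixture c E A o.1 o.2.1 (observed c o)) +
        Real.log (concentration c E A b.1 o.1 o.2.1 (observed c o)) := fun o =>
    Real.log_mul (mixture_pos _ _ _ _ _ _).ne' (concentration_pos _ _ _ _ _ _ _).ne'
  have hi1 := integrable_log_mixture (F.law P) hc E A
  have hi2 := integrable_log_concentration (F.law P) hc E A b.1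
  have hYm := (measurable_mixture_observed hc E A).mul
    (measurable_comp_observed hc (measurable_concentration hc E A b.1))
  have hXm := measurable_mixture_observed hc E (insert b A)
  have hmain := integral_log_le_of_lintegral_div_le (μ := channelLaw 𝓦 n (F.law P))
    (X := fun o => mixture c E (insert b A) o.1 o.2.1 (observed c o))
    (Y := fun o => mixture c E A o.1 o.2.1 (observed c o) *
      concentration c E A b.1 o.1 o.2.1 (observed c o))
    (fun _ => mixture_pos _ _ _ _ _ _)
    (fun _ => mul_pos (mixture_pos _ _ _ _ _ _) (concentration_pos _ _ _ _ _ _ _))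
    hXm hYm (integrable_log_mixture _ hc E _) (by simp_rw [hYlog]; exact hi1.add hi2) hκpos ?_
  · simp_rw [hYlog] at hmain
    rw [integral_add hi1 hi2] at hmain
    exact hmain
  have hfm : Measurable fun o : 𝓦 × FadingPath K × (Fin n → Fin K → ℂ) =>
      ENNReal.ofReal (mixture c E (insert b A) o.1 o.2.1 (observed c o) /
        (mixture c E A o.1 o.2.1 (observed c o) *
          concentration c E A b.1 o.1 o.2.1 (observed c o))) := (hXm.div hYm).ennreal_ofReal
  rw [lintegral_channelLaw _ hfm]
  have hcard : (Fintype.card 𝓦 : ℝ≥0∞) ≠ 0 := by exact_mod_cast Fintype.card_ne_zero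
  suffices H : ∀ w, ∫⁻ ω, ∫⁻ z, ENNReal.ofReal (mixture c E (insert b A) w ω (observed c (w, ω, z)) /
      (mixture c E A w ω (observed c (w, ω, z)) * concentration c E A b.1 w ω (observed c (w, ω, z))))
      ∂(Measure.pi fun _ => Measure.pi fun _ => awgn) ∂(F.law P) ≤ ENNReal.ofReal κ by
    calc _ ≤ (Fintype.card 𝓦 : ℝ≥0∞)⁻¹ * ∑ _w : 𝓦, ENNReal.ofReal κ := by
          gcongr with w _
          exact H w
      _ = _ := by
          rw [Finset.sum_const, nsmul_eq_mul, Finset.card_univ, ← mul_assoc,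
            ENNReal.inv_mul_cancel hcard (ENNReal.natCast_ne_top _), one_mul]
  intro w
  have hfw : Measurable fun p : FadingPath K × (Fin n → Fin K → ℂ) =>
      ENNReal.ofReal (mixture c E (insert b A) w p.1 (observed c (w, p)) /
        (mixture c E A w p.1 (observed c (w, p)) *
          concentration c E A b.1 w p.1 (observed c (w, p)))) :=
    hfm.comp (measurable_const.prodMk measurable_id)
  -- The fading has to be averaged with the noise held fixed.
  rw [lintegral_lintegral_swap (f := fun ω z => ENNReal.ofReal
    (mixture c E (insert b A) w ω (observed c (w, ω, z)) /
      (mixture c E A w ω (observed c (w, ω, z)) *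
        concentration c E A b.1 w ω (observed c (w, ω, z))))) hfw.aemeasurable]
  refine (lintegral_mono (g := fun _ => ENNReal.ofReal κ) fun z => ?_).trans (by simp)
  exact F.lintegral_mixture_insert_div_le hP hc E hC hA w z

end Comparison

/-! ### Moment bounds and expected logarithms -/

lemma integrable_log_one_add {Ω : Type*} [MeasurableSpace Ω] {μ : Measure Ω}
    [IsProbabilityMeasure μ] {f : Ω → ℝ} (hf : Measurable f) (hf0 : ∀ o, 0 ≤ f o) {c : ℝ}
    (h : ∫⁻ o, ENNReal.ofReal (f o) ∂μ ≤ ENNReal.ofReal c) :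
    Integrable (fun o => Real.log (1 + f o)) μ := by
  have hi : Integrable f μ := by
    refine ⟨hf.aestronglyMeasurable, ?_⟩
    rw [hasFiniteIntegral_iff_ofReal (ae_of_all _ hf0)]
    exact h.trans_lt ENNReal.ofReal_lt_top
  refine hi.mono' (Measurable.log (by fun_prop)).aestronglyMeasurable (ae_of_all _ fun o => ?_)
  rw [Real.norm_eq_abs, abs_of_nonneg (Real.log_nonneg (by linarith [hf0 o]))]
  have := Real.log_le_sub_one_of_pos (show 0 < 1 + f o by linarith [hf0 o])
  linarith

/-- Jensen's inequality for the logarithm, read off from the quotient bound with a constant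
denominator. -/
lemma integral_log_one_add_le {Ω : Type*} [MeasurableSpace Ω] {μ : Measure Ω}
    [IsProbabilityMeasure μ] {f : Ω → ℝ} (hf : Measurable f) (hf0 : ∀ o, 0 ≤ f o) {c : ℝ}
    (hc : 0 ≤ c) (h : ∫⁻ o, ENNReal.ofReal (f o) ∂μ ≤ ENNReal.ofReal c) :
    ∫ o, Real.log (1 + f o) ∂μ ≤ Real.log (1 + c) := by
  have := integral_log_le_of_lintegral_div_le (μ := μ) (X := fun o => 1 + f o) (Y := fun _ => 1)
    (c := 1 + c) (fun o => by linarith [hf0 o]) (fun _ => one_pos) (by fun_prop) measurable_const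
    (integrable_log_one_add hf hf0 h) (integrable_const _) (by linarith) ?_
  · simpa using this
  · simp_rw [div_one, fun o => ENNReal.ofReal_add zero_le_one (hf0 o)]
    rw [lintegral_add_left measurable_const, ENNReal.ofReal_add zero_le_one hc]
    gcongr
    simp

/-- Cauchy–Schwarz, in a product form whose logarithm splits into channel, noise and input terms.
Only the input term can grow with the power. -/
lemma one_add_normSq_le {K : ℕ} (h d : Fin K → ℂ) (z : ℂ) :
    1 + ‖∑ i, h i * d i + z‖ ^ 2 ≤
      2 * ((1 + ∑ i, ‖h i‖ ^ 2) * (1 + ‖z‖ ^ 2)) * (1 + ∑ i, ‖d i‖ ^ 2) := by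
  have h1 : ‖∑ i, h i * d i‖ ^ 2 ≤ (∑ i, ‖h i‖ ^ 2) * ∑ i, ‖d i‖ ^ 2 := by
    calc ‖∑ i, h i * d i‖ ^ 2 ≤ (∑ i, ‖h i‖ * ‖d i‖) ^ 2 := by
          gcongr
          exact (norm_sum_le _ _).trans (Finset.sum_le_sum fun i _ => (norm_mul_le _ _))
      _ ≤ _ := Finset.sum_mul_sq_le_sq_mul_sq _ _ _
  have h2 : ‖∑ i, h i * d i + z‖ ^ 2 ≤ 2 * (‖∑ i, h i * d i‖ ^ 2 + ‖z‖ ^ 2) := by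
    have := norm_add_le (∑ i, h i * d i) z
    nlinarith [sq_nonneg (‖∑ i, h i * d i‖ - ‖z‖), norm_nonneg (∑ i, h i * d i + z)]
  have ha : 0 ≤ ∑ i, ‖h i‖ ^ 2 := by positivity
  have hb : 0 ≤ ∑ i, ‖d i‖ ^ 2 := by positivity
  have hc : 0 ≤ ‖z‖ ^ 2 := by positivity
  have h3 : 0 ≤ (∑ i, ‖h i‖ ^ 2) * ∑ i, ‖d i‖ ^ 2 := by positivity
  have h4 : 0 ≤ (∑ i, ‖h i‖ ^ 2) * (∑ i, ‖d i‖ ^ 2) * ‖z‖ ^ 2 := by positivity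
  have h5 : 0 ≤ (∑ i, ‖h i‖ ^ 2) * ‖z‖ ^ 2 := by positivity
  have h6 : 0 ≤ (∑ i, ‖d i‖ ^ 2) * ‖z‖ ^ 2 := by positivity
  nlinarith

/-- The mean power of the noise. -/
noncomputable def noisePower : ℝ := ∫ z, ‖z‖ ^ 2 ∂awgn

lemma noisePower_nonneg : 0 ≤ noisePower := integral_nonneg fun _ => by positivity

section Moments

variable {K n : ℕ} {𝓦 : Type*} [Fintype 𝓦] [Nonempty 𝓦] [MeasurableSpace 𝓦]
  [MeasurableSingletonClass 𝓦]

lemma lintegral_noise_le (L : Measure (FadingPath K)) [IsProbabilityMeasure L]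
    (a : Fin n × Fin K) :
    ∫⁻ o, ENNReal.ofReal (‖o.2.2 a.1 a.2‖ ^ 2) ∂(channelLaw 𝓦 n L) ≤
      ENNReal.ofReal noisePower := by
  have h := (measurePreserving_noise (𝓦 := 𝓦) L a).lintegral_comp
    (f := fun z => ENNReal.ofReal (‖z‖ ^ 2)) (by fun_prop)
  rw [h, ← ofReal_integral_eq_lintegral_ofReal integrable_normSq_awgn
    (ae_of_all _ fun _ => by positivity)]
  rfl

lemma lintegral_fading_eq (L : Measure (FadingPath K)) [IsProbabilityMeasure L]
    {f : FadingPath K → ℝ≥0∞} (hf : Measurable f) :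
    ∫⁻ o, f o.2.1 ∂(channelLaw 𝓦 n L) = ∫⁻ ω, f ω ∂L := by
  have : IsProbabilityMeasure (uniformOn (Set.univ : Set 𝓦)) :=
    isProbabilityMeasure_uniformOn Set.finite_univ Set.univ_nonempty
  have h1 : MeasurePreserving Prod.snd (channelLaw 𝓦 n L)
      (L.prod (Measure.pi fun _ : Fin n => Measure.pi fun _ : Fin K => awgn)) :=
    measurePreserving_snd
  have h2 : MeasurePreserving Prod.fst
      (L.prod (Measure.pi fun _ : Fin n => Measure.pi fun _ : Fin K => awgn)) L :=
    measurePreserving_fst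
  exact (h2.comp h1).lintegral_comp hf

lemma ofReal_sum_normSq {ι : Type*} [Fintype ι] (v : ι → ℂ) :
    ENNReal.ofReal (∑ i, ‖v i‖ ^ 2) = ∑ i, ‖v i‖ₑ ^ 2 := by
  rw [ENNReal.ofReal_sum_of_nonneg fun _ _ => by positivity]
  refine Finset.sum_congr rfl fun i _ => ?_
  rw [ENNReal.ofReal_pow (norm_nonneg _), ofReal_norm]

/-- The bounds on the fading and on the transmit power that enter the entropy bounds. -/
structure MomentBounds (L : Measure (FadingPath K)) (c : Codebook K n 𝓦) (C P : ℝ) : Prop where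
  measurable : ∀ t w, Measurable (c t w)
  nonneg : 0 ≤ C
  fading : ∀ k t, ∫⁻ ω, ∑ i, ‖(ω t).2 k i‖ₑ ^ 2 ∂L ≤ ENNReal.ofReal C
  power : ∀ t, ∫⁻ o, ∑ i, ‖c t o.1 (feedback t o.2.1) i‖ₑ ^ 2 ∂(channelLaw 𝓦 n L) ≤
    ENNReal.ofReal P

variable {L : Measure (FadingPath K)} [IsProbabilityMeasure L] {c : Codebook K n 𝓦} {C P : ℝ}

lemma MomentBounds.lintegral_fading_le (h : MomentBounds L c C P) (k : Fin K) (t : ℕ) :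
    ∫⁻ o, ENNReal.ofReal (∑ i, ‖(o.2.1 t).2 k i‖ ^ 2) ∂(channelLaw 𝓦 n L) ≤ ENNReal.ofReal C := by
  simp_rw [ofReal_sum_normSq]
  exact (lintegral_fading_eq (𝓦 := 𝓦) (n := n) L
    (f := fun ω => ∑ i, ‖(ω t).2 k i‖ₑ ^ 2) (by fun_prop)).trans_le (h.fading k t)

/-- The part of the logarithmic loss that is due to channel and noise fluctuations. -/
noncomputable def fluctuation (o : 𝓦 × FadingPath K × (Fin n → Fin K → ℂ)) (a : Fin n × Fin K) :
    ℝ :=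
  Real.log 2 + (Real.log (1 + ∑ i, ‖(o.2.1 a.1).2 a.2 i‖ ^ 2) +
    Real.log (1 + ‖o.2.2 a.1 a.2‖ ^ 2))

lemma MomentBounds.integrable_fluctuation (h : MomentBounds L c C P) (a : Fin n × Fin K) :
    Integrable (fun o => fluctuation o a) (channelLaw 𝓦 n L) :=
  (integrable_const _).add ((integrable_log_one_add (by fun_prop) (fun _ => by positivity)
    (h.lintegral_fading_le a.2 a.1)).add (integrable_log_one_add (by fun_prop)
      (fun _ => by positivity) (lintegral_noise_le L a)))

lemma MomentBounds.integral_fluctuation_le (h : MomentBounds L c C P) (a : Fin n × Fin K) :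
    ∫ o, fluctuation o a ∂(channelLaw 𝓦 n L) ≤
      Real.log 2 + (Real.log (1 + C) + Real.log (1 + noisePower)) := by
  have i1 : Integrable (fun o => Real.log (1 + ∑ i, ‖(o.2.1 a.1).2 a.2 i‖ ^ 2))
      (channelLaw 𝓦 n L) := integrable_log_one_add (by fun_prop) (fun _ => by positivity)
    (h.lintegral_fading_le a.2 a.1)
  have i2 : Integrable (fun o => Real.log (1 + ‖o.2.2 a.1 a.2‖ ^ 2)) (channelLaw 𝓦 n L) :=
    integrable_log_one_add (by fun_prop) (fun _ => by positivity) (lintegral_noise_le L a)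
  have i3 : Integrable (fun o => Real.log (1 + ∑ i, ‖(o.2.1 a.1).2 a.2 i‖ ^ 2) +
      Real.log (1 + ‖o.2.2 a.1 a.2‖ ^ 2)) (channelLaw 𝓦 n L) := i1.add i2
  unfold fluctuation
  rw [integral_add (integrable_const _) i3, integral_add i1 i2, integral_const]
  simp only [probReal_univ, one_smul]
  gcongr
  · exact integral_log_one_add_le (by fun_prop) (fun _ => by positivity) h.nonneg
      (h.lintegral_fading_le a.2 a.1)
  · exact integral_log_one_add_le (by fun_prop) (fun _ => by positivity) noisePower_nonneg
      (lintegral_noise_le L a)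

end Moments

/-! ### Heavy-tailed posterior mixtures -/

section Tail

variable {K n : ℕ} {𝓦 : Type*}

lemma log_tailDensity_ge {ε : ℝ} (hε : 0 < ε) (h d : Fin K → ℂ) (z : ℂ) :
    -Real.log (tailMass ε) - (1 + ε) * (Real.log 2 + (Real.log (1 + ∑ i, ‖h i‖ ^ 2) +
      Real.log (1 + ‖z‖ ^ 2)) + Real.log (1 + ∑ i, ‖d i‖ ^ 2)) ≤
      Real.log (tailDensity ε (∑ i, h i * d i + z)) := by
  rw [log_tailDensity hε]
  have h1 := Real.log_le_log (by positivity) (one_add_normSq_le h d z)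
  rw [Real.log_mul (by positivity) (by positivity), Real.log_mul (by positivity) (by positivity),
    Real.log_mul (by positivity) (by positivity)] at h1
  have := mul_le_mul_of_nonneg_left h1 (by linarith : 0 ≤ 1 + ε)
  linarith

lemma observed_sub_signal (c : Codebook K n 𝓦) (o : 𝓦 × FadingPath K × (Fin n → Fin K → ℂ))
    (b : Fin n × Fin K) (w' : 𝓦) : observed c o b - signal c o.2.1 w' b =
      ∑ i, (o.2.1 b.1).2 b.2 i * (c b.1 o.1 (feedback b.1 o.2.1) i -
        c b.1 w' (feedback b.1 o.2.1) i) + o.2.2 b.1 b.2 := by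
  simp only [observed, signal, mul_sub, Finset.sum_sub_distrib]
  ring

variable [Fintype 𝓦]

/-- The posterior mixture, given the signals in `A`, of heavy-tailed densities around the
noiseless signals at `b`. -/
noncomputable def tailMixture (c : Codebook K n 𝓦) (ε : ℝ) (E : Setoid 𝓦)
    (A : Finset (Fin n × Fin K)) (b : Fin n × Fin K) (w : 𝓦) (ω : FadingPath K)
    (y : Fin n × Fin K → ℂ) : ℝ :=
  (∑ w' ∈ eqvClass E w, likelihood c A ω y w' * tailDensity ε (y b - signal c ω w' b)) /
    ∑ w' ∈ eqvClass E w, likelihood c A ω y w'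

lemma tailMixture_pos (c : Codebook K n 𝓦) {ε : ℝ} (hε : 0 < ε) (E : Setoid 𝓦)
    (A : Finset (Fin n × Fin K)) (b : Fin n × Fin K) (w : 𝓦) (ω : FadingPath K)
    (y : Fin n × Fin K → ℂ) : 0 < tailMixture c ε E A b w ω y :=
  div_pos (Finset.sum_pos (fun _ _ => mul_pos (likelihood_pos _ _ _ _ _) (tailDensity_pos hε _))
    ⟨w, self_mem_eqvClass E w⟩) (sum_eqvClass_pos _ (likelihood_pos _ _ _ _) _)

lemma tailMixture_le (c : Codebook K n 𝓦) {ε : ℝ} (hε : 0 < ε) (E : Setoid 𝓦)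
    (A : Finset (Fin n × Fin K)) (b : Fin n × Fin K) (w : 𝓦) (ω : FadingPath K)
    (y : Fin n × Fin K → ℂ) : tailMixture c ε E A b w ω y ≤ (tailMass ε)⁻¹ := by
  unfold tailMixture
  rw [div_le_iff₀ (sum_eqvClass_pos _ (likelihood_pos _ _ _ _) _), mul_comm, Finset.sum_mul]
  exact Finset.sum_le_sum fun w' _ =>
    mul_le_mul_of_nonneg_left (tailDensity_le hε _) (likelihood_pos _ _ _ _ _).le

lemma measurable_tailMixture {c : Codebook K n 𝓦} (hc : ∀ t w, Measurable (c t w)) (ε : ℝ)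
    (E : Setoid 𝓦) (A : Finset (Fin n × Fin K)) (b : Fin n × Fin K) (w : 𝓦) :
    Measurable fun p : FadingPath K × (Fin n × Fin K → ℂ) => tailMixture c ε E A b w p.1 p.2 := by
  refine (Finset.measurable_sum _ fun w' _ => (measurable_likelihood hc A w').mul
    ((measurable_tailDensity ε).comp ?_)).div
    (Finset.measurable_sum _ fun w' _ => measurable_likelihood hc A w')
  exact ((measurable_pi_apply b).comp measurable_snd).sub
    ((measurable_signal hc w' b).comp measurable_fst)

lemma tailMixture_congr (c : Codebook K n 𝓦) (ε : ℝ) {E : Setoid 𝓦}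
    (A : Finset (Fin n × Fin K)) (b : Fin n × Fin K) {w w' : 𝓦} (h : E w w') :
    tailMixture c ε E A b w = tailMixture c ε E A b w' := by
  ext ω y; unfold tailMixture; rw [eqvClass_congr h]

lemma tailMixture_eq_of_eqOn (c : Codebook K n 𝓦) (ε : ℝ) (E : Setoid 𝓦)
    (A : Finset (Fin n × Fin K)) (b : Fin n × Fin K) (w : 𝓦) (ω : FadingPath K)
    {y y' : Fin n × Fin K → ℂ} (hA : ∀ a ∈ A, y a = y' a) (hb : y b = y' b) :
    tailMixture c ε E A b w ω y = tailMixture c ε E A b w ω y' := by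
  have : ∀ w', likelihood c A ω y w' = likelihood c A ω y' w' := fun w' =>
    dependsOn_likelihood c A ω w' hA
  unfold tailMixture; simp_rw [this, hb]

lemma lintegral_tailMixture_update {c : Codebook K n 𝓦} {ε : ℝ} (hε : 0 < ε) (E : Setoid 𝓦)
    {A : Finset (Fin n × Fin K)} {b : Fin n × Fin K} (hb : b ∉ A) (w : 𝓦) (ω : FadingPath K)
    (y : Fin n × Fin K → ℂ) :
    ∫⁻ v, ENNReal.ofReal (tailMixture c ε E A b w ω (Function.update y b v)) ≤ 1 := by
  have hs := sum_eqvClass_pos E (likelihood_pos c A ω y) w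
  have hl : ∀ v w', likelihood c A ω (Function.update y b v) w' = likelihood c A ω y w' :=
    fun v w' => dependsOn_likelihood c A ω w' fun a ha =>
      Function.update_of_ne (fun h : a = b => hb (h ▸ ha)) _ _
  have e : ∀ v, ENNReal.ofReal (tailMixture c ε E A b w ω (Function.update y b v)) =
      ∑ w' ∈ eqvClass E w, ENNReal.ofReal (likelihood c A ω y w' /
        ∑ w' ∈ eqvClass E w, likelihood c A ω y w') *
          ENNReal.ofReal (tailDensity ε (v - signal c ω w' b)) := by
    intro v
    unfold tailMixture
    simp_rw [hl, Function.update_self]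
    rw [Finset.sum_div, ENNReal.ofReal_sum_of_nonneg fun w' _ =>
      (div_pos (mul_pos (likelihood_pos _ _ _ _ _) (tailDensity_pos hε _)) hs).le]
    refine Finset.sum_congr rfl fun w' _ => ?_
    rw [← ENNReal.ofReal_mul (div_pos (likelihood_pos _ _ _ _ _) hs).le]
    congr 1
    ring
  simp_rw [e]
  rw [lintegral_finsetSum _ fun w' _ => by fun_prop]
  have e' : ∀ w', ∫⁻ v, ENNReal.ofReal (likelihood c A ω y w' /
      ∑ w' ∈ eqvClass E w, likelihood c A ω y w') *
        ENNReal.ofReal (tailDensity ε (v - signal c ω w' b)) = ENNReal.ofReal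
      (likelihood c A ω y w' / ∑ w' ∈ eqvClass E w, likelihood c A ω y w') := fun w' => by
    rw [lintegral_const_mul _ (by fun_prop), lintegral_tailDensity hε, mul_one]
  simp_rw [e']
  rw [← ENNReal.ofReal_sum_of_nonneg fun w' _ => (div_pos (likelihood_pos _ _ _ _ _) hs).le,
    ← Finset.sum_div, div_self hs.ne', ENNReal.ofReal_one]

/-- The heavy-tailed posterior mixture is large where the channel inputs are concentrated. -/
lemma log_tailMixture_ge (c : Codebook K n 𝓦) {ε : ℝ} (hε : 0 < ε) (E : Setoid 𝓦)
    (A : Finset (Fin n × Fin K)) (b : Fin n × Fin K)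
    (o : 𝓦 × FadingPath K × (Fin n → Fin K → ℂ)) :
    -Real.log (tailMass ε) - (1 + ε) * fluctuation o b +
      (1 + ε) * Real.log (concentration c E A b.1 o.1 o.2.1 (observed c o)) ≤
      Real.log (tailMixture c ε E A b o.1 o.2.1 (observed c o)) := by
  set l := likelihood c A o.2.1 (observed c o) with hl
  have hlpos : ∀ w, 0 < l w := likelihood_pos _ _ _ _
  set s := ∑ w' ∈ eqvClass E o.1, l w' with hs
  have hspos : 0 < s := sum_eqvClass_pos E hlpos o.1
  set G := -Real.log (tailMass ε) - (1 + ε) * fluctuation o b with hG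
  have hD := concentration_pos c E A b.1 o.1 o.2.1 (observed c o)
  have h1 : ∀ w', Real.exp G * ((1 + inputDist c b.1 o.2.1 o.1 w')⁻¹) ^ (1 + ε) ≤
      tailDensity ε (observed c o b - signal c o.2.1 w' b) := by
    intro w'
    have hd := one_add_inputDist_pos c b.1 o.2.1 o.1 w'
    rw [← Real.log_le_log_iff (by positivity) (tailDensity_pos hε _), Real.log_mul
      (Real.exp_pos _).ne' (by positivity), Real.log_exp, Real.log_rpow (by positivity),
      Real.log_inv, observed_sub_signal]
    refine le_trans (le_of_eq ?_) (log_tailDensity_ge hε _ _ _)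
    rw [hG]
    unfold fluctuation inputDist
    ring
  have h2 : Real.exp G * (concentration c E A b.1 o.1 o.2.1 (observed c o)) ^ (1 + ε) ≤
      tailMixture c ε E A b o.1 o.2.1 (observed c o) := by
    -- Convexity of x ↦ x^(1+ε): the posterior mean of the powers is at least the power of the
    -- posterior mean, which is the concentration.
    have hJ := Real.rpow_arith_mean_le_arith_mean_rpow (eqvClass E o.1) (fun w' => l w' / s)
      (fun w' => (1 + inputDist c b.1 o.2.1 o.1 w')⁻¹)
      (fun w' _ => (div_pos (hlpos w') hspos).le) (by rw [← Finset.sum_div, div_self hspos.ne'])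
      (fun w' _ => (inv_pos.2 (one_add_inputDist_pos _ _ _ _ _)).le)
      (show (1 : ℝ) ≤ 1 + ε by linarith)
    have e1 : concentration c E A b.1 o.1 o.2.1 (observed c o) =
        ∑ w' ∈ eqvClass E o.1, l w' / s * (1 + inputDist c b.1 o.2.1 o.1 w')⁻¹ := by
      unfold concentration
      rw [Finset.sum_div]
      refine Finset.sum_congr rfl fun w' _ => ?_
      rw [← hl, ← hs]; ring
    rw [← e1] at hJ
    refine (mul_le_mul_of_nonneg_left hJ (Real.exp_pos G).le).trans ?_
    unfold tailMixture
    rw [Finset.mul_sum, Finset.sum_div]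
    refine Finset.sum_le_sum fun w' _ => ?_
    have := mul_le_mul_of_nonneg_left (h1 w') (div_pos (hlpos w') hspos).le
    calc _ = l w' / s * (Real.exp G * ((1 + inputDist c b.1 o.2.1 o.1 w')⁻¹) ^ (1 + ε)) := by ring
      _ ≤ _ := this
      _ = _ := by rw [← hl, ← hs]; ring
  have h3 := Real.log_le_log (by positivity) h2
  rwa [Real.log_mul (Real.exp_pos _).ne' (by positivity), Real.log_exp,
    Real.log_rpow hD] at h3

end Tail

/-! ### Ordering the received signals by time and user -/

section Blocks

/-- The signals of users below `k` at times before `t`, and of users below `j` at time `t`. -/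
def pastSignals (n K k t j : ℕ) : Finset (Fin n × Fin K) :=
  Finset.univ.filter fun a => (a.1 : ℕ) < t ∧ (a.2 : ℕ) < k ∨ (a.1 : ℕ) = t ∧ (a.2 : ℕ) < j

/-- The signals of users below `k`. -/
def userSignals (n K k : ℕ) : Finset (Fin n × Fin K) := Finset.univ.filter fun a => (a.2 : ℕ) < k

lemma mem_pastSignals {n K k t j : ℕ} {a : Fin n × Fin K} : a ∈ pastSignals n K k t j ↔
    (a.1 : ℕ) < t ∧ (a.2 : ℕ) < k ∨ (a.1 : ℕ) = t ∧ (a.2 : ℕ) < j := by simp [pastSignals]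

lemma mem_userSignals {n K k : ℕ} {a : Fin n × Fin K} :
    a ∈ userSignals n K k ↔ (a.2 : ℕ) < k := by simp [userSignals]

lemma pastSignals_zero_zero (n K k : ℕ) : pastSignals n K k 0 0 = ∅ := by
  ext a; simp [mem_pastSignals]

lemma pastSignals_last (n K k : ℕ) : pastSignals n K k n 0 = userSignals n K k := by
  ext a; simp [mem_pastSignals, mem_userSignals]

/-- The end of one time slot is the start of the next, which links the telescoping over users to
that over time. -/
lemma pastSignals_self (n K k t : ℕ) : pastSignals n K k t k = pastSignals n K k (t + 1) 0 := by
  ext a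
  simp only [mem_pastSignals]
  omega

lemma insert_pastSignals {n K : ℕ} (k : ℕ) (t : Fin n) (j : Fin K) :
    insert (t, j) (pastSignals n K k t j) = pastSignals n K k t (j + 1) := by
  ext ⟨a, b⟩
  simp only [Finset.mem_insert, mem_pastSignals, Prod.mk.injEq, Fin.ext_iff]
  omega

lemma pastSignals_subset (n K : ℕ) {k t j : ℕ} (hj : j ≤ k) :
    pastSignals n K k t j ⊆ userSignals n K k := by
  intro a
  simp only [mem_pastSignals, mem_userSignals]
  omega

lemma card_userSignals (n : ℕ) {K k : ℕ} (hk : k ≤ K) : (userSignals n K k).card = n * k := by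
  have : userSignals n K k = Finset.univ ×ˢ (Finset.univ.filter fun i : Fin K => (i : ℕ) < k) := by
    ext a; simp [mem_userSignals]
  rw [this, Finset.card_product, Finset.card_univ, Fintype.card_fin]
  congr 1
  rw [Fin.card_filter_val_lt, min_eq_right hk]

lemma condEntropy_empty {K n : ℕ} {𝓦 : Type*} [Fintype 𝓦]
    [MeasurableSpace 𝓦] (L : Measure (FadingPath K)) [IsProbabilityMeasure L]
    (c : Codebook K n 𝓦) (E : Setoid 𝓦) : condEntropy L c E ∅ = 0 := by
  have : ∀ w ω y, mixture c E ∅ w ω y = 1 := fun w ω y => by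
    unfold mixture classAvg likelihood
    simp only [Finset.prod_empty, Finset.sum_const, nsmul_eq_mul, mul_one]
    exact div_self (card_eqvClass_pos E w).ne'
  simp [condEntropy, this]

end Blocks

/-! ### Upper bounds on entropy and the comparison of users -/

section EntropyBounds

variable {K n : ℕ} {𝓦 : Type*} [Fintype 𝓦] [Nonempty 𝓦] [MeasurableSpace 𝓦]
  [MeasurableSingletonClass 𝓦]

/-- The loss in the heavy-tailed entropy bounds that does not grow with the power. -/
noncomputable def tailLoss (ε C : ℝ) : ℝ :=
  Real.log (tailMass ε) + (1 + ε) * (Real.log 2 + (Real.log (1 + C) + Real.log (1 + noisePower)))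

section Upper

variable {L : Measure (FadingPath K)} [IsProbabilityMeasure L] {c : Codebook K n 𝓦} {C P : ℝ}

lemma MomentBounds.integrable_log_input (h : MomentBounds L c C P) (t : Fin n) :
    Integrable (fun o => Real.log (1 + ∑ i, ‖c t o.1 (feedback t o.2.1) i‖ ^ 2))
      (channelLaw 𝓦 n L) ∧ (0 ≤ P →
    ∫ o, Real.log (1 + ∑ i, ‖c t o.1 (feedback t o.2.1) i‖ ^ 2) ∂(channelLaw 𝓦 n L) ≤
      Real.log (1 + P)) := by
  have hm : Measurable fun o : 𝓦 × FadingPath K × (Fin n → Fin K → ℂ) =>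
      ∑ i, ‖c t o.1 (feedback t o.2.1) i‖ ^ 2 := by
    refine measurable_from_prod_countable_right fun w => ?_
    have h1 : Measurable fun p : FadingPath K × (Fin n → Fin K → ℂ) => c t w (feedback t p.1) :=
      (measurable_input h.measurable t w).comp measurable_fst
    exact Finset.measurable_sum _ fun i _ => ((measurable_pi_apply i).comp h1).norm.pow_const 2
  have hp := h.power t
  simp_rw [← ofReal_sum_normSq] at hp
  exact ⟨integrable_log_one_add hm (fun _ => by positivity) hp,
    fun hP => integral_log_one_add_le hm (fun _ => by positivity) hP hp⟩

/-- The entropy of received signals is at most the logarithm of the power per signal, up to terms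
of lower order. -/
theorem MomentBounds.condEntropy_le (h : MomentBounds L c C P) (hP : 0 ≤ P) {ε : ℝ} (hε : 0 < ε)
    (E : Setoid 𝓦) (A : Finset (Fin n × Fin K)) :
    condEntropy L c E A ≤ A.card * (tailLoss ε C + (1 + ε) * Real.log (1 + P)) := by
  have hi : ∀ a, Integrable (fun o => Real.log (tailDensity ε (observed c o a)))
      (channelLaw 𝓦 n L) ∧ -(tailLoss ε C + (1 + ε) * Real.log (1 + P)) ≤
      ∫ o, Real.log (tailDensity ε (observed c o a)) ∂(channelLaw 𝓦 n L) := by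
    intro a
    have hx := h.integrable_log_input a.1
    have hlow : Integrable (fun o => -Real.log (tailMass ε) - (1 + ε) * (fluctuation o a +
        Real.log (1 + ∑ i, ‖c a.1 o.1 (feedback a.1 o.2.1) i‖ ^ 2))) (channelLaw 𝓦 n L) :=
      (integrable_const _).sub (((h.integrable_fluctuation a).add hx.1).const_mul _)
    have hpt : ∀ o : 𝓦 × FadingPath K × (Fin n → Fin K → ℂ),
        -Real.log (tailMass ε) - (1 + ε) * (fluctuation o a +
        Real.log (1 + ∑ i, ‖c a.1 o.1 (feedback a.1 o.2.1) i‖ ^ 2)) ≤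
        Real.log (tailDensity ε (observed c o a)) := fun o => log_tailDensity_ge hε _ _ _
    have hint : Integrable (fun o => Real.log (tailDensity ε (observed c o a)))
        (channelLaw 𝓦 n L) := by
      refine integrable_of_le_of_le ?_ (ae_of_all _ hpt) (ae_of_all _ fun o => ?_) hlow
        (integrable_const (Real.log (tailMass ε)⁻¹))
      · exact ((measurable_tailDensity ε).comp ((measurable_pi_apply a).comp
          (measurable_observed h.measurable))).log.aestronglyMeasurable
      · exact Real.log_le_log (tailDensity_pos hε _) (tailDensity_le hε _)
    have hsum : Integrable (fun o => fluctuation o a +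
        Real.log (1 + ∑ i, ‖c a.1 o.1 (feedback a.1 o.2.1) i‖ ^ 2)) (channelLaw 𝓦 n L) :=
      (h.integrable_fluctuation a).add hx.1
    refine ⟨hint, le_trans ?_ (integral_mono hlow hint hpt)⟩
    rw [integral_sub (integrable_const _) (hsum.const_mul _),
      integral_const_mul, integral_add (h.integrable_fluctuation a) hx.1, integral_const]
    simp only [probReal_univ, one_smul]
    have h1 := h.integral_fluctuation_le a
    have h2 := mul_le_mul_of_nonneg_left (add_le_add h1 (hx.2 hP)) (by linarith : 0 ≤ 1 + ε)
    unfold tailLoss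
    linarith
  have hlog : ∀ o : 𝓦 × FadingPath K × (Fin n → Fin K → ℂ),
      Real.log (∏ a ∈ A, tailDensity ε (observed c o a)) =
      ∑ a ∈ A, Real.log (tailDensity ε (observed c o a)) := fun o =>
    Real.log_prod fun a _ => (tailDensity_pos hε _).ne'
  -- The competitor is a fixed product of tail densities, blind to message and fading.
  have hG := integral_log_le_integral_log_mixture L h.measurable E A
    (X := fun _ _ y => ∏ a ∈ A, tailDensity ε (y a))
    (fun _ _ _ => Finset.prod_pos fun _ _ => tailDensity_pos hε _)
    (fun _ => Finset.measurable_prod _ fun a _ => (measurable_tailDensity ε).comp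
      ((measurable_pi_apply a).comp measurable_snd)) (fun _ _ _ => rfl)
    (fun _ _ y y' hy => Finset.prod_congr rfl fun a ha => by rw [hy a ha])
    (fun _ _ y => by
      simp_rw [fun y : Fin n × Fin K → ℂ => ENNReal.ofReal_prod_of_nonneg (s := A)
        (f := fun a => tailDensity ε (y a)) fun _ _ => (tailDensity_pos hε _).le]
      refine lmarginal_prod_le_one (fun b _ => by fun_prop) (fun b _ c _ hbc y v => ?_)
        (fun b _ y => ?_) y
      · rw [Function.update_of_ne hbc.symm]
      · simp only [Function.update_self]
        simpa using (lintegral_tailDensity hε 0).le)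
    (by simp_rw [hlog]; exact integrable_finsetSum _ fun a _ => (hi a).1)
  simp_rw [hlog] at hG
  rw [integral_finsetSum _ fun a _ => (hi a).1] at hG
  have hsum := Finset.sum_le_sum fun a (_ : a ∈ A) => (hi a).2
  rw [Finset.sum_const, nsmul_eq_mul] at hsum
  unfold condEntropy
  linarith

/-- The entropy of the signals of a further user is bounded through heavy-tailed posterior
mixtures, given any part of the signals of the users before. -/
lemma MomentBounds.condEntropy_union_le (h : MomentBounds L c C P) {ε : ℝ} (hε : 0 < ε)
    (E : Setoid 𝓦) {A B : Finset (Fin n × Fin K)} (hAB : Disjoint A B)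
    (S : Fin n × Fin K → Finset (Fin n × Fin K)) (hS : ∀ b, S b ⊆ A) :
    condEntropy L c E (A ∪ B) ≤ condEntropy L c E A + ∑ b ∈ B, (tailLoss ε C - (1 + ε) *
      ∫ o, Real.log (concentration c E (S b) b.1 o.1 o.2.1 (observed c o)) ∂(channelLaw 𝓦 n L)) := by
  have hbS : ∀ b ∈ B, b ∉ A := fun b hb hbA => Finset.disjoint_left.1 hAB hbA hb
  have hi : ∀ b, Integrable (fun o =>
      Real.log (tailMixture c ε E (S b) b o.1 o.2.1 (observed c o))) (channelLaw 𝓦 n L) ∧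
      -(tailLoss ε C - (1 + ε) * ∫ o, Real.log (concentration c E (S b) b.1 o.1 o.2.1
        (observed c o)) ∂(channelLaw 𝓦 n L)) ≤
      ∫ o, Real.log (tailMixture c ε E (S b) b o.1 o.2.1 (observed c o)) ∂(channelLaw 𝓦 n L) := by
    intro b
    have hci := integrable_log_concentration L h.measurable E (S b) b.1
    have hi1 : Integrable (fun o => -Real.log (tailMass ε) - (1 + ε) * fluctuation o b)
        (channelLaw 𝓦 n L) :=
      (integrable_const _).sub ((h.integrable_fluctuation b).const_mul _)
    have hlow : Integrable (fun o => -Real.log (tailMass ε) - (1 + ε) * fluctuation o b +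
        (1 + ε) * Real.log (concentration c E (S b) b.1 o.1 o.2.1 (observed c o)))
        (channelLaw 𝓦 n L) := hi1.add (hci.const_mul _)
    have hpt := log_tailMixture_ge c hε E (S b) b
    have hint : Integrable (fun o =>
        Real.log (tailMixture c ε E (S b) b o.1 o.2.1 (observed c o))) (channelLaw 𝓦 n L) := by
      refine integrable_of_le_of_le ?_ (ae_of_all _ hpt) (ae_of_all _ fun o => ?_) hlow
        (integrable_const (Real.log (tailMass ε)⁻¹))
      · exact (measurable_comp_observed h.measurable
          (measurable_tailMixture h.measurable ε E (S b) b)).log.aestronglyMeasurable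
      · exact Real.log_le_log (tailMixture_pos c hε _ _ _ _ _ _) (tailMixture_le c hε _ _ _ _ _ _)
    refine ⟨hint, le_trans ?_ (integral_mono hlow hint hpt)⟩
    rw [integral_add hi1 (hci.const_mul _), integral_sub (integrable_const _)
      ((h.integrable_fluctuation b).const_mul _), integral_const_mul, integral_const_mul,
      integral_const]
    simp only [probReal_univ, one_smul]
    have h2 := mul_le_mul_of_nonneg_left (h.integral_fluctuation_le b) (by linarith : 0 ≤ 1 + ε)
    unfold tailLoss
    linarith
  have hprod : ∀ w ω y, 0 < ∏ b ∈ B, tailMixture c ε E (S b) b w ω y := fun w ω y =>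
    Finset.prod_pos fun _ _ => tailMixture_pos c hε _ _ _ _ _ _
  have hlog : ∀ o : 𝓦 × FadingPath K × (Fin n → Fin K → ℂ),
      Real.log (mixture c E A o.1 o.2.1 (observed c o) *
        ∏ b ∈ B, tailMixture c ε E (S b) b o.1 o.2.1 (observed c o)) =
      Real.log (mixture c E A o.1 o.2.1 (observed c o)) +
        ∑ b ∈ B, Real.log (tailMixture c ε E (S b) b o.1 o.2.1 (observed c o)) := fun o => by
    rw [Real.log_mul (mixture_pos _ _ _ _ _ _).ne' (hprod _ _ _).ne', Real.log_prod
      fun b _ => (tailMixture_pos c hε _ _ _ _ _ _).ne']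
  have hmi := integrable_log_mixture L h.measurable E A
  have hsi : Integrable (fun o => ∑ b ∈ B,
      Real.log (tailMixture c ε E (S b) b o.1 o.2.1 (observed c o))) (channelLaw 𝓦 n L) :=
    integrable_finsetSum _ fun b _ => (hi b).1
  have hpm : ∀ w, Measurable fun p : FadingPath K × (Fin n × Fin K → ℂ) =>
      ∏ b ∈ B, tailMixture c ε E (S b) b w p.1 p.2 := fun w =>
    Finset.measurable_prod _ fun b _ => measurable_tailMixture h.measurable ε E (S b) b w
  -- The competitor is the true density on `A` times one tail mixture per new signal. Each mixture
  -- may use its own subset `S b` of the conditioning, so no separate chain rule is needed.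
  have hG := integral_log_le_integral_log_mixture L h.measurable E (A ∪ B)
    (X := fun w ω y => mixture c E A w ω y * ∏ b ∈ B, tailMixture c ε E (S b) b w ω y)
    (fun w ω y => mul_pos (mixture_pos _ _ _ _ _ _) (hprod w ω y))
    (fun w => (measurable_mixture h.measurable E A w).mul (hpm w)) ?_ ?_ ?_
    (by simp_rw [hlog]; exact hmi.add hsi)
  · simp_rw [hlog] at hG
    rw [integral_add hmi hsi, integral_finsetSum _ fun b _ => (hi b).1] at hG
    have hsum := Finset.sum_le_sum fun b (_ : b ∈ B) => (hi b).2
    rw [Finset.sum_neg_distrib] at hsum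
    unfold condEntropy
    linarith
  · intro w w' hw
    ext ω y
    have e1 : mixture c E A w ω y = mixture c E A w' ω y := classAvg_congr hw
    simp_rw [e1, fun b => tailMixture_congr c ε (S b) b hw]
  · intro w ω y y' hy
    have e1 : mixture c E A w ω y = mixture c E A w ω y' :=
      dependsOn_mixture c E A w ω fun a ha => hy a (by simp [Finset.mem_coe.1 ha])
    simp only
    rw [e1]
    congr 1
    refine Finset.prod_congr rfl fun b hb => tailMixture_eq_of_eqOn c ε E (S b) b w ω
      (fun a ha => hy a (by simp [hS b ha])) (hy b (by simp [hb]))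
  · intro w ω y
    have hMm : Measurable fun y => ENNReal.ofReal (mixture c E A w ω y) :=
      ((measurable_mixture h.measurable E A w).comp
        (measurable_const.prodMk measurable_id)).ennreal_ofReal
    have hqm : ∀ b, Measurable fun y => ENNReal.ofReal (tailMixture c ε E (S b) b w ω y) := fun b =>
      ((measurable_tailMixture h.measurable ε E (S b) b w).comp
        (measurable_const.prodMk measurable_id)).ennreal_ofReal
    have e : (fun y => ENNReal.ofReal (mixture c E A w ω y *
        ∏ b ∈ B, tailMixture c ε E (S b) b w ω y)) = fun y => ENNReal.ofReal (mixture c E A w ω y) *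
          ∏ b ∈ B, ENNReal.ofReal (tailMixture c ε E (S b) b w ω y) := by
      ext y
      rw [ENNReal.ofReal_mul (mixture_pos _ _ _ _ _ _).le, ENNReal.ofReal_prod_of_nonneg
        fun _ _ => (tailMixture_pos c hε _ _ _ _ _ _).le]
    have hPm : Measurable fun y =>
        ∏ b ∈ B, ENNReal.ofReal (tailMixture c ε E (S b) b w ω y) :=
      Finset.measurable_prod _ fun b _ => hqm b
    have hMPm : Measurable fun y => ENNReal.ofReal (mixture c E A w ω y) *
        ∏ b ∈ B, ENNReal.ofReal (tailMixture c ε E (S b) b w ω y) := hMm.mul hPm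
    rw [e, lmarginal_union _ _ hMPm hAB]
    refine le_trans (lmarginal_mono (g := fun y => ENNReal.ofReal (mixture c E A w ω y))
      (fun x => ?_) y) (lmarginal_mixture_le_one h.measurable E A w ω y)
    have hconst : ∀ z : B → ℂ, mixture c E A w ω (Function.updateFinset x B z) =
        mixture c E A w ω x := fun z => dependsOn_mixture c E A w ω fun a ha => by
      rw [Function.updateFinset, dif_neg (Finset.disjoint_left.1 hAB ha)]
    have hle := lmarginal_prod_le_one (B := B)
      (q := fun b y => ENNReal.ofReal (tailMixture c ε E (S b) b w ω y)) (fun b _ => hqm b)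
      (fun b hb c' hc' hbc y v => by
        congr 1
        exact tailMixture_eq_of_eqOn c ε E (S b) b w ω
          (fun a ha => Function.update_of_ne
            (fun h : a = c' => hbS c' hc' (h ▸ hS b ha)) _ _) (Function.update_of_ne hbc.symm _ _))
      (fun b hb y => lintegral_tailMixture_update hε E (fun hb' => hbS b hb (hS b hb')) w ω y) x
    simp only [lmarginal] at hle ⊢
    simp_rw [hconst]
    have hPm' : Measurable fun z : B → ℂ => ∏ b ∈ B, ENNReal.ofReal
        (tailMixture c ε E (S b) b w ω (Function.updateFinset x B z)) :=
      hPm.comp measurable_updateFinset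
    rw [lintegral_const_mul _ hPm']
    exact mul_le_of_le_one_right (by positivity) hle

end Upper

variable {α : ℝ} (F : FadingModel K α) {P : ℝ}

/-- With delayed CSIT and current CSIT of limited quality, a further user increases the entropy by
at most the average entropy of the users before, up to the logarithm of the CSIT gain. -/
theorem FadingModel.condEntropy_succ_le (hP : 1 < P) {C : ℝ≥0}
    (hC : ∀ k t i, (F.law P).map (csiError t k i) ≤ ((C / F.mse k P : ℝ≥0) : ℝ≥0∞) • volume)
    {c : Codebook K n 𝓦} {C' P' : ℝ} (h : MomentBounds (F.law P) c C' P') {ε : ℝ} (hε : 0 < ε)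
    {g : ℝ} (hg : ∀ k, Real.log (errorGain K C (F.mse k P)) ≤ g) (E : Setoid 𝓦) {k : ℕ}
    (hk : k < K) :
    k * (condEntropy (F.law P) c E (userSignals n K (k + 1)) -
        condEntropy (F.law P) c E (userSignals n K k)) ≤
      (1 + ε) * condEntropy (F.law P) c E (userSignals n K k) +
        n * k * ((1 + ε) * g + tailLoss ε C') := by
  have := F.isProb P
  set ce := condEntropy (F.law P) c E with hce
  have hinj : Function.Injective fun t : Fin n => (t, (⟨k, hk⟩ : Fin K)) := fun t t' h =>
    congrArg Prod.fst h
  set B : Finset (Fin n × Fin K) := Finset.univ.map ⟨_, hinj⟩ with hB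
  have hmemB : ∀ a, a ∈ B ↔ (a.2 : ℕ) = k := by
    rintro ⟨a, b⟩
    rw [hB, Finset.mem_map]
    constructor
    · rintro ⟨t, -, ht⟩
      exact (congrArg (fun p : Fin n × Fin K => (p.2 : ℕ)) ht).symm
    · intro h
      exact ⟨a, Finset.mem_univ _, Prod.ext rfl (Fin.ext h.symm)⟩
  have hdisj : Disjoint (userSignals n K k) B := by
    rw [Finset.disjoint_left]
    intro a ha hb
    rw [mem_userSignals] at ha
    rw [hmemB] at hb
    omega
  have hunion : userSignals n K (k + 1) = userSignals n K k ∪ B := by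
    ext a
    simp only [mem_userSignals, Finset.mem_union, hmemB]
    omega
  -- Each earlier user `j` gives a separate bound on the increment: at time `t` the further user is
  -- compared with `j` given the same past, so the same concentration bounds one from above and the
  -- other from below.
  have hstep : ∀ j ∈ Finset.range k, ce (userSignals n K (k + 1)) - ce (userSignals n K k) ≤
      n * ((1 + ε) * g + tailLoss ε C') + (1 + ε) * ∑ t ∈ Finset.range n,
        (ce (pastSignals n K k t (j + 1)) - ce (pastSignals n K k t j)) := by
    intro j hj
    rw [Finset.mem_range] at hj
    have h1 := h.condEntropy_union_le hε E hdisj (fun b => pastSignals n K k b.1 j)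
      fun b => pastSignals_subset n K hj.le
    rw [← hunion, hB, Finset.sum_map] at h1
    simp only [Function.Embedding.coeFn_mk] at h1
    have h2 : ∀ t : Fin n, tailLoss ε C' - (1 + ε) * ∫ o, Real.log (concentration c E
        (pastSignals n K k t j) t o.1 o.2.1 (observed c o)) ∂(channelLaw 𝓦 n (F.law P)) ≤
        ((1 + ε) * g + tailLoss ε C') + (1 + ε) *
          (ce (pastSignals n K k t (j + 1)) - ce (pastSignals n K k t j)) := by
      intro t
      have hK1 := F.integral_log_mixture_insert_le hP h.measurable E
        (A := pastSignals n K k t j) (b := (t, (⟨j, hj.trans hk⟩ : Fin K)))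
        (hC ⟨j, hj.trans hk⟩) fun a ha => by
          rw [mem_pastSignals] at ha
          rcases ha with ha | ha
          · exact Or.inl ha.1
          · exact Or.inr ⟨Fin.ext ha.1, fun h => by
              have := congrArg Fin.val h
              simp only at this
              omega⟩
      rw [insert_pastSignals k t (⟨j, hj.trans hk⟩ : Fin K)] at hK1
      have hgj := hg ⟨j, hj.trans hk⟩
      simp only at hK1
      have hK2 : -∫ o, Real.log (concentration c E (pastSignals n K k t j) t o.1 o.2.1
          (observed c o)) ∂(channelLaw 𝓦 n (F.law P)) ≤
          g + (ce (pastSignals n K k t (j + 1)) - ce (pastSignals n K k t j)) := by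
        rw [hce]
        unfold condEntropy
        linarith
      have := mul_le_mul_of_nonneg_left hK2 (by linarith : 0 ≤ 1 + ε)
      linarith
    have h3 := Finset.sum_le_sum fun t (_ : t ∈ Finset.univ) => h2 t
    rw [Finset.sum_add_distrib, Finset.sum_const, Finset.card_univ, Fintype.card_fin,
      nsmul_eq_mul, ← Finset.mul_sum] at h3
    rw [Finset.sum_range fun t => ce (pastSignals n K k t (j + 1)) - ce (pastSignals n K k t j)]
    linarith
  have hsum := Finset.sum_le_sum hstep
  rw [Finset.sum_const, Finset.card_range, nsmul_eq_mul, Finset.sum_add_distrib, Finset.sum_const,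
    Finset.card_range, nsmul_eq_mul, ← Finset.mul_sum, Finset.sum_comm] at hsum
  -- Adding the k bounds completes the chain rule over all users below `k` and all times, starting
  -- from the zero entropy of no signals.
  have htel : ∑ t ∈ Finset.range n, ∑ j ∈ Finset.range k,
      (ce (pastSignals n K k t (j + 1)) - ce (pastSignals n K k t j)) = ce (userSignals n K k) := by
    have e : ∀ t, ∑ j ∈ Finset.range k,
        (ce (pastSignals n K k t (j + 1)) - ce (pastSignals n K k t j)) =
        ce (pastSignals n K k (t + 1) 0) - ce (pastSignals n K k t 0) := fun t => by
      rw [Finset.sum_range_sub fun j => ce (pastSignals n K k t j), pastSignals_self]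
    simp_rw [e]
    rw [Finset.sum_range_sub fun t => ce (pastSignals n K k t 0), pastSignals_last,
      pastSignals_zero_zero, hce, condEntropy_empty, sub_zero]
  rw [htel] at hsum
  linarith

end EntropyBounds

/-! ### Entropies of files and caches, and the schedule of requests -/

section Counting

variable {𝓦 : Type*} [Fintype 𝓦]

lemma classEntropy_mono {E E' : Setoid 𝓦} (h : E' ≤ E) : classEntropy E' ≤ classEntropy E := by
  unfold classEntropy
  gcongr with w _
  · exact card_eqvClass_pos E' w
  · exact eqvClass_mono h w

/-- A function with values in `V` reduces the remaining entropy by at most `log |V|`. -/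
lemma classEntropy_sub_log_card_le [Nonempty 𝓦] {V : Type*} [Fintype V] [Nonempty V]
    (C : Setoid 𝓦) (φ : 𝓦 → V) :
    classEntropy C - Real.log (Fintype.card V) ≤ classEntropy (C ⊓ Setoid.ker φ) := by
  have hV : (0 : ℝ) < Fintype.card V := by exact_mod_cast Fintype.card_pos
  have hW : (0 : ℝ) < Fintype.card 𝓦 := by exact_mod_cast Fintype.card_pos
  -- Unit weights and a uniform guess reduce the posterior bound to counting class sizes.
  have h := sum_mul_guess_le C φ (l := fun _ => 1) (fun _ => one_pos)
    (ρ := fun _ _ => (Fintype.card V : ℝ)⁻¹) (fun _ _ _ => rfl) (fun _ _ => by positivity)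
    (fun _ => by simp [hV.ne'])
  simp only [one_mul, Finset.sum_const, nsmul_eq_mul, mul_one, Finset.card_univ] at h
  have hlog : ∀ w, Real.log (eqvClass C w).card - Real.log (Fintype.card V) -
      Real.log (eqvClass (C ⊓ Setoid.ker φ) w).card ≤ (Fintype.card V : ℝ)⁻¹ *
        (eqvClass C w).card / (eqvClass (C ⊓ Setoid.ker φ) w).card - 1 := by
    intro w
    have h1 := card_eqvClass_pos C w
    have h2 := card_eqvClass_pos (C ⊓ Setoid.ker φ) w
    have := Real.log_le_sub_one_of_pos (show 0 < (Fintype.card V : ℝ)⁻¹ *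
        (eqvClass C w).card / (eqvClass (C ⊓ Setoid.ker φ) w).card by positivity)
    rw [Real.log_div (by positivity) (by positivity), Real.log_mul (by positivity) (by positivity),
      Real.log_inv] at this
    linarith
  have hsum := Finset.sum_le_sum fun w (_ : w ∈ Finset.univ) => hlog w
  rw [Finset.sum_sub_distrib, Finset.sum_sub_distrib, Finset.sum_sub_distrib] at hsum
  simp only [Finset.sum_const, Finset.card_univ, nsmul_eq_mul, mul_one] at hsum
  unfold classEntropy
  rw [sub_le_iff_le_add, div_le_iff₀ hW, add_mul, div_mul_cancel₀ _ hW.ne']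
  linarith

variable {N B : ℕ}

/-- Two libraries are equivalent if they agree on the files in `T`. -/
def fileSetoid (B : ℕ) (T : Finset (Fin N)) : Setoid (Library N B) where
  r W W' := ∀ i ∈ T, W i = W' i
  iseqv := ⟨fun _ _ _ => rfl, fun h i hi => (h i hi).symm,
    fun h h' i hi => (h i hi).trans (h' i hi)⟩

lemma fileSetoid_anti {T T' : Finset (Fin N)} (h : T ⊆ T') :
    fileSetoid B T' ≤ fileSetoid B T := fun {_ _} hW i hi => hW i (h hi)

lemma fileSetoid_insert (T : Finset (Fin N)) (x : Fin N) :
    fileSetoid B (insert x T) = fileSetoid B T ⊓ Setoid.ker fun W : Library N B => W x := by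
  ext W W'
  change (∀ i ∈ insert x T, W i = W' i) ↔ (∀ i ∈ T, W i = W' i) ∧ W x = W' x
  rw [Finset.forall_mem_insert, and_comm]

lemma classEntropy_fileSetoid (T : Finset (Fin N)) :
    classEntropy (fileSetoid B T) = (N - T.card) * (B * Real.log 2) := by
  have hcard : ∀ W : Library N B, Real.log (eqvClass (fileSetoid B T) W).card =
      (N - T.card) * (B * Real.log 2) := by
    intro W
    have : eqvClass (fileSetoid B T) W =
        Fintype.piFinset fun i => if i ∈ T then {W i} else Finset.univ := by
      ext W'
      rw [mem_eqvClass, Fintype.mem_piFinset]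
      refine forall_congr' fun i => ?_
      by_cases hi : i ∈ T
      · simp [hi, eq_comm]
      · simp [hi]
    have hle : T.card ≤ N := by simpa using Finset.card_le_univ T
    rw [this, Fintype.card_piFinset]
    have e : ∀ i : Fin N, (if i ∈ T then ({W i} : Finset (File B)) else Finset.univ).card =
        if i ∈ T then 1 else 2 ^ B := fun i => by
      split_ifs <;> simp [File]
    simp_rw [e]
    rw [Finset.prod_ite, Finset.prod_const_one, one_mul, Finset.prod_const, Finset.filter_not,
      Finset.filter_mem_eq_inter, Finset.univ_inter, ← Finset.compl_eq_univ_sdiff,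
      Finset.card_compl, Fintype.card_fin, ← pow_mul]
    push_cast [hle]
    rw [Real.log_pow]
    push_cast [hle]
    ring
  unfold classEntropy
  simp_rw [hcard]
  rw [Finset.sum_const, nsmul_eq_mul, Finset.card_univ]
  have : (Fintype.card (Library N B) : ℝ) ≠ 0 := by exact_mod_cast Fintype.card_ne_zero
  field_simp

/-- Two messages are equivalent if they lead to the same caches of the users below `k`. -/
def cacheSetoid {K q : ℕ} (place : Fin K → 𝓦 → Fin q) (k : ℕ) : Setoid 𝓦 where
  r w w' := ∀ i : Fin K, (i : ℕ) < k → place i w = place i w'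
  iseqv := ⟨fun _ _ _ => rfl, fun h i hi => (h i hi).symm,
    fun h h' i hi => (h i hi).trans (h' i hi)⟩

lemma cacheSetoid_anti {𝓦 : Type*} {K q : ℕ} (place : Fin K → 𝓦 → Fin q) {k k' : ℕ} (h : k ≤ k') :
    cacheSetoid place k' ≤ cacheSetoid place k :=
  fun {_ _} hw i hi => hw i (hi.trans_le h)

/-- The joint content of `k` caches takes at most q^k values. -/
lemma classEntropy_cacheSetoid_ge [Nonempty 𝓦] {K q : ℕ} (place : Fin K → 𝓦 → Fin q) (hq : 0 < q)
    {k : ℕ} (hk : k ≤ K) (C : Setoid 𝓦) :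
    classEntropy C - k * Real.log q ≤ classEntropy (cacheSetoid place k ⊓ C) := by
  have : Nonempty (Fin q) := ⟨⟨0, hq⟩⟩
  have h := classEntropy_sub_log_card_le C fun w (i : Fin k) => place (Fin.castLE hk i) w
  rw [Fintype.card_fun, Fintype.card_fin, Fintype.card_fin, Nat.cast_pow, Real.log_pow] at h
  refine h.trans (classEntropy_mono fun {w w'} hw => ⟨fun i hi => ?_, hw.1⟩)
  exact congrFun (show (fun i : Fin k => place (Fin.castLE hk i) w) =
    fun i => place (Fin.castLE hk i) w' from hw.2) ⟨i, hi⟩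

/-- The first `j` files requested by user `k`, and all files requested by the users below `k`,
when request `i` of user `l < s` is for file `i * s + l` and each user makes `D` requests. -/
def requestedFiles (N D s k j : ℕ) : Finset (Fin N) :=
  Finset.univ.filter fun x => (x : ℕ) < D * s ∧
    ((x : ℕ) % s < k ∨ (x : ℕ) % s = k ∧ (x : ℕ) / s < j)

lemma mem_requestedFiles {N D s k j : ℕ} {x : Fin N} : x ∈ requestedFiles N D s k j ↔
    (x : ℕ) < D * s ∧ ((x : ℕ) % s < k ∨ (x : ℕ) % s = k ∧ (x : ℕ) / s < j) := by
  simp [requestedFiles]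

lemma requestedFiles_last (N D s k : ℕ) :
    requestedFiles N D s k D = requestedFiles N D s (k + 1) 0 := by
  ext x
  rw [mem_requestedFiles, mem_requestedFiles]
  have h : (x : ℕ) < D * s → (x : ℕ) / s < D := Nat.div_lt_of_lt_mul ∘ fun h => by
    rwa [mul_comm] at h
  constructor
  · rintro ⟨h1, h2 | h2⟩ <;> exact ⟨h1, Or.inl (by omega)⟩
  · rintro ⟨h1, h2 | h2⟩
    · rcases Nat.lt_succ_iff_lt_or_eq.1 h2 with h3 | h3
      · exact ⟨h1, Or.inl h3⟩
      · exact ⟨h1, Or.inr ⟨h3, h h1⟩⟩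
    · exact absurd h2.2 (Nat.not_lt_zero _)

lemma requestedFiles_mono (N D s k : ℕ) {j j' : ℕ} (h : j ≤ j') :
    requestedFiles N D s k j ⊆ requestedFiles N D s k j' := by
  intro x hx
  rw [mem_requestedFiles] at hx ⊢
  exact ⟨hx.1, hx.2.imp_right fun h2 => ⟨h2.1, h2.2.trans_le h⟩⟩

lemma requestedFiles_succ {N D s k j : ℕ} (hk : k < s) (hj : j < D) {x : Fin N}
    (hx : (x : ℕ) = j * s + k) :
    requestedFiles N D s k (j + 1) = insert x (requestedFiles N D s k j) := by
  have hs : 0 < s := by omega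
  have hmod : (x : ℕ) % s = k := by
    rw [hx, Nat.add_mod, Nat.mul_mod_left, zero_add, Nat.mod_mod, Nat.mod_eq_of_lt hk]
  have hdiv : (x : ℕ) / s = j := by
    rw [hx, add_comm, Nat.add_mul_div_right _ _ hs, Nat.div_eq_of_lt hk, zero_add]
  have hlt : (x : ℕ) < D * s := by
    rw [hx]; nlinarith [Nat.mul_le_mul_right s (Nat.succ_le_of_lt hj)]
  ext y
  rw [Finset.mem_insert, mem_requestedFiles, mem_requestedFiles]
  constructor
  · rintro ⟨h1, h2 | ⟨h2, h3⟩⟩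
    · exact Or.inr ⟨h1, Or.inl h2⟩
    · rcases Nat.lt_succ_iff_lt_or_eq.1 h3 with h4 | h4
      · exact Or.inr ⟨h1, Or.inr ⟨h2, h4⟩⟩
      · refine Or.inl (Fin.ext ?_)
        rw [← Nat.div_add_mod (y : ℕ) s, h4, h2, hx, mul_comm]
  · rintro (rfl | ⟨h1, h2⟩)
    · exact ⟨hlt, Or.inr ⟨hmod, by omega⟩⟩
    · exact ⟨h1, h2.imp_right fun h => ⟨h.1, by omega⟩⟩

lemma card_requestedFiles_succ {N D s k : ℕ} (hk : k < s) (hN : D * s ≤ N) :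
    (requestedFiles N D s (k + 1) 0).card = (requestedFiles N D s k 0).card + D := by
  rw [← requestedFiles_last]
  have : ∀ j ≤ D, (requestedFiles N D s k j).card = (requestedFiles N D s k 0).card + j := by
    intro j hj
    induction j with
    | zero => rfl
    | succ j ih =>
      have hlt : j * s + k < N := by
        nlinarith [Nat.mul_le_mul_right s hj]
      rw [requestedFiles_succ hk hj (x := ⟨j * s + k, hlt⟩) rfl, Finset.card_insert_of_notMem,
        ih (by omega), add_assoc]
      rw [mem_requestedFiles]
      rintro ⟨-, h | ⟨-, h⟩⟩
      · change (j * s + k) % s < k at h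
        rw [Nat.add_mod, Nat.mul_mod_left, zero_add, Nat.mod_mod, Nat.mod_eq_of_lt hk] at h
        exact lt_irrefl _ h
      · change (j * s + k) / s < j at h
        rw [add_comm, Nat.add_mul_div_right _ _ (by omega), Nat.div_eq_of_lt hk, zero_add] at h
        exact lt_irrefl _ h
  exact this D le_rfl

end Counting

/-- Weighted telescoping of entropies `f k m` of the signals of `m` users, given the caches and
files of `k` users. -/
lemma sum_entropy_diff_le {f : ℕ → ℕ → ℝ} {n U V ε : ℝ} (hε : 0 ≤ ε) (s : ℕ) (hs : 1 ≤ s)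
    (h0 : f 0 1 ≤ n * U) (h1 : ∀ k < s, f k k ≤ n * k * U)
    (h2 : ∀ k, 1 ≤ k → k < s → k * (f k (k + 1) - f k k) ≤ (1 + ε) * f k k + n * k * V) :
    ∑ k ∈ Finset.range s, (f k (k + 1) - f (k + 1) (k + 1)) / (k + 1) + f s s / s ≤
      n * (U + ((harmonic s : ℚ) - 1 : ℝ) * (ε * U + V)) := by
  induction s, hs using Nat.le_induction with
  | base => simpa using h0
  | succ s hs ih =>
    have hs0 : (0 : ℝ) < s := by exact_mod_cast hs
    have ih' := ih (fun k hk => h1 k (by omega)) fun k hk hk' => h2 k hk (by omega)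
    rw [Finset.sum_range_succ, harmonic_succ]
    push_cast
    -- Hypothesis `h2` divided by s(s+1), with the excess ε f(s,s) absorbed by `h1`. The remaining
    -- 1/(s+1) is the new harmonic term.
    have hf : f s (s + 1) / (s + 1) ≤ f s s / s + n * (ε * U + V) / (s + 1) := by
      have e1 := h1 s (by omega)
      have e2 := h2 s hs (by omega)
      have e3 : ε * f s s ≤ ε * (n * s * U) := mul_le_mul_of_nonneg_left e1 hε
      rw [div_add_div _ _ hs0.ne' (by positivity), div_le_div_iff₀ (by positivity) (by positivity)]
      nlinarith
    have e : n * (U + ((harmonic s : ℝ) + ((s : ℝ) + 1)⁻¹ - 1) * (ε * U + V)) =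
        n * (U + ((harmonic s : ℝ) - 1) * (ε * U + V)) + n * (ε * U + V) / (s + 1) := by
      rw [div_eq_mul_inv]; ring
    rw [e, sub_div]
    linarith

/-! ### The converse for one scheme -/

section Converse

variable {K N B q n : ℕ} {α : ℝ} (F : FadingModel K α) {P : ℝ}

/-- Fano's inequality for one user and one request vector. -/
lemma Scheme.condEntropy_sub_ge (S : Scheme K N B q n) (R : Fin K → Fin N) {δ : ℝ} (hδ : 0 ≤ δ)
    (herr : S.errorProb F P R ≤ ENNReal.ofReal δ) (k : Fin K) (C : Setoid (Library N B))
    (hC : ∀ W W', C W W' → S.place k W = S.place k W') :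
    classEntropy C - classEntropy (C ⊓ Setoid.ker fun W : Library N B => W (R k))
        - (Real.log 2 + δ * (B * Real.log 2)) ≤
      condEntropy (F.law P) (S.encode R) C (userSignals n K (k + 1)) -
      condEntropy (F.law P) (S.encode R) (C ⊓ Setoid.ker fun W : Library N B => W (R k))
        (userSignals n K (k + 1)) := by
  have := F.isProb P
  have h := condEntropy_sub_ge_of_decode (F.law P) (S.measurable_encode R) C
    (userSignals n K (k + 1)) (fun W : Library N B => W (R k))
    (dec := fun W ω y => S.decode R k (S.place k W) (fun t => y (t, k), fun t => ω t)) ?_ ?_ ?_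
    hδ ?_
  · rwa [show (Fintype.card (File B) : ℝ) = 2 ^ B by simp [File], Real.log_pow] at h
  · exact fun W => (S.measurable_decode R k _).comp (by fun_prop)
  · intro W W' hW
    rw [hC W W' hW]
  · intro W ω y y' hy
    have : ∀ t, y (t, k) = y' (t, k) := fun t => hy _ (by simp [mem_userSignals])
    simp_rw [this]
  · refine le_trans (measure_mono ?_) herr
    intro o ho
    exact ⟨k, ho⟩

/-- The converse for a single scheme. -/
theorem Scheme.converse (hP : 1 < P) {C C' : ℝ≥0}
    (hC : ∀ k t i, (F.law P).map (csiError t k i) ≤ ((C / F.mse k P : ℝ≥0) : ℝ≥0∞) • volume)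
    (hC' : ∀ k t, ∫⁻ ω, ∑ i, ‖(ω t).2 k i‖ₑ ^ 2 ∂(F.law P) ≤ C') {ε : ℝ} (hε : 0 < ε)
    {g : ℝ} (hg : ∀ k, Real.log (errorGain K C (F.mse k P)) ≤ g) (S : Scheme K N B q n)
    (hpow : S.PowerConstraint F P) {δ : ℝ} (hδ : 0 ≤ δ)
    (herr : ∀ R, S.errorProb F P R ≤ ENNReal.ofReal δ) (hq : 0 < q) {s D : ℕ} (hs : 1 ≤ s)
    (hsK : s ≤ K) (hN : D * s ≤ N) :
    D * (B * Real.log 2 - (Real.log 2 + δ * (B * Real.log 2))) * (harmonic s : ℝ)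
        - s * Real.log q ≤
      D * (n * ((tailLoss ε C' + (1 + ε) * Real.log (1 + P)) + ((harmonic s : ℝ) - 1) *
        (ε * (tailLoss ε C' + (1 + ε) * Real.log (1 + P)) + ((1 + ε) * g + tailLoss ε C')))) := by
  have := F.isProb P
  set U := tailLoss ε C' + (1 + ε) * Real.log (1 + P) with hU
  set V := (1 + ε) * g + tailLoss ε C' with hV
  rcases Nat.eq_zero_or_pos D with rfl | hD
  · have h1 : 0 ≤ (s : ℝ) * Real.log q :=
      mul_nonneg (by positivity) (Real.log_nonneg (by exact_mod_cast hq))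
    simp only [Nat.cast_zero, zero_mul]
    linarith
  have hN0 : 0 < N := by nlinarith
  -- The reduction modulo `N` only gives the users from `s` on some valid request; below `s` nothing
  -- wraps around, as Ds ≤ N.
  set req : ℕ → Fin K → Fin N := fun j i => ⟨(j * s + i) % N, Nat.mod_lt _ hN0⟩ with hreq
  have hreq_val : ∀ j < D, ∀ i : Fin K, (i : ℕ) < s → (req j i : ℕ) = j * s + i := by
    intro j hj i hi
    refine Nat.mod_eq_of_lt ?_
    nlinarith [Nat.mul_le_mul_right s (Nat.succ_le_of_lt hj)]
  set Z := cacheSetoid S.place with hZ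
  set T := requestedFiles N D s with hT
  -- The conditioning contains the files of all rounds, so it does not depend on `j`; only the
  -- transmitted codebook does.
  set ce : ℕ → ℕ → ℕ → ℝ := fun j k m =>
    condEntropy (F.law P) (S.encode (req j)) (Z k ⊓ fileSetoid B (T k 0)) (userSignals n K m) with hce
  have hmom : ∀ j, MomentBounds (F.law P) (S.encode (req j)) C' P := fun j =>
    ⟨S.measurable_encode _, C'.coe_nonneg, fun k t => by
      rw [ENNReal.ofReal_coe_nnreal]; exact hC' k t, fun t => hpow (req j) t⟩
  have hstep : ∀ k < s, ∀ j < D,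
      classEntropy (Z (k + 1) ⊓ fileSetoid B (T k j)) -
        classEntropy (Z (k + 1) ⊓ fileSetoid B (T k (j + 1))) -
        (Real.log 2 + δ * (B * Real.log 2)) ≤ ce j k (k + 1) - ce j (k + 1) (k + 1) := by
    intro k hk j hj
    have hkK : k < K := hk.trans_le hsK
    have h := S.condEntropy_sub_ge F (req j) hδ (herr (req j)) ⟨k, hkK⟩
      (Z (k + 1) ⊓ fileSetoid B (T k j)) fun W W' hW => hW.1 ⟨k, hkK⟩ (Nat.lt_succ_self k)
    have hins := requestedFiles_succ hk hj (hreq_val j hj ⟨k, hkK⟩ hk)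
    rw [inf_assoc, ← fileSetoid_insert, ← hins] at h
    -- Fano's inequality conditions on the files of user `k` from the rounds before `j`. Dropping
    -- these and the cache of user `k` raises the first entropy; adding the files of all rounds
    -- lowers the subtracted one.
    have m1 := condEntropy_mono (F.law P) (S.measurable_encode (req j))
      (inf_le_inf (cacheSetoid_anti S.place (Nat.le_succ k))
        (fileSetoid_anti (B := B) (requestedFiles_mono N D s k (Nat.zero_le j))))
      (userSignals n K (k + 1))
    have m2 := condEntropy_mono (F.law P) (S.measurable_encode (req j))
      (inf_le_inf (le_refl (cacheSetoid S.place (k + 1)))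
        (fileSetoid_anti (B := B) (requestedFiles_mono N D s k (Nat.succ_le_of_lt hj))))
      (userSignals n K (k + 1))
    rw [requestedFiles_last] at m2
    simp only [hce]
    linarith
  -- Over the rounds the class entropies telescope to those of the `D` files of user `k`, less what
  -- the `k + 1` caches may already reveal.
  have huser : ∀ k < s, D * (B * Real.log 2 - (Real.log 2 + δ * (B * Real.log 2))) -
      (k + 1) * Real.log q ≤ ∑ j ∈ Finset.range D, (ce j k (k + 1) - ce j (k + 1) (k + 1)) := by
    intro k hk
    have h := Finset.sum_le_sum fun j (hj : j ∈ Finset.range D) =>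
      hstep k hk j (Finset.mem_range.1 hj)
    rw [Finset.sum_sub_distrib, Finset.sum_range_sub'
      fun j => classEntropy (Z (k + 1) ⊓ fileSetoid B (T k j)), Finset.sum_const,
      Finset.card_range, nsmul_eq_mul] at h
    have h1 := classEntropy_cacheSetoid_ge S.place hq (show k + 1 ≤ K by omega)
      (fileSetoid B (T k 0))
    have h2 := classEntropy_mono (inf_le_right (a := Z (k + 1)) (b := fileSetoid B (T k D)))
    rw [classEntropy_fileSetoid] at h1 h2
    rw [hT, requestedFiles_last, card_requestedFiles_succ hk hN] at h2
    push_cast at h1 h2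
    rw [hT, requestedFiles_last] at h
    rw [← hT] at h h2
    linarith
  have htel : ∀ j, ∑ k ∈ Finset.range s, (ce j k (k + 1) - ce j (k + 1) (k + 1)) / (k + 1) ≤
      n * (U + ((harmonic s : ℝ) - 1) * (ε * U + V)) := by
    intro j
    have hub : ∀ k m, m ≤ K → ce j k m ≤ n * m * U := fun k m hm => by
      have h := (hmom j).condEntropy_le (by linarith) hε
        (Z k ⊓ fileSetoid B (T k 0)) (userSignals n K m)
      rw [card_userSignals n hm] at h
      push_cast at h
      exact h
    have h := sum_entropy_diff_le (f := ce j) (n := n) (U := U) (V := V) hε.le s hs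
      (by simpa using hub 0 1 (by omega)) (fun k hk => hub k k (by omega))
      fun k _ hk => F.condEntropy_succ_le hP hC (hmom j) hε hg _ (by omega)
    have hnn : 0 ≤ ce j s s / s :=
      div_nonneg (condEntropy_nonneg _ _ _ _) (by positivity)
    linarith
  -- With weights 1/(k+1) the cache terms (k+1) log q contribute log q each, and the file terms sum
  -- to the harmonic number.
  have hw := Finset.sum_le_sum fun k (hk : k ∈ Finset.range s) =>
    div_le_div_of_nonneg_right (huser k (Finset.mem_range.1 hk))
      (show (0 : ℝ) ≤ (k : ℝ) + 1 by positivity)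
  have hj := Finset.sum_le_sum fun j (_ : j ∈ Finset.range D) => htel j
  rw [Finset.sum_const, Finset.card_range, nsmul_eq_mul, Finset.sum_comm] at hj
  simp_rw [← Finset.sum_div] at hj
  refine le_trans (le_of_eq ?_) (hw.trans hj)
  have e : ∀ k : ℕ, (D * (B * Real.log 2 - (Real.log 2 + δ * (B * Real.log 2))) -
      ((k : ℝ) + 1) * Real.log q) / (k + 1) =
      D * (B * Real.log 2 - (Real.log 2 + δ * (B * Real.log 2))) * ((k : ℝ) + 1)⁻¹ - Real.log q := by
    intro k
    have : (k : ℝ) + 1 ≠ 0 := by positivity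
    field_simp
  simp_rw [e]
  rw [Finset.sum_sub_distrib, ← Finset.mul_sum, Finset.sum_const, Finset.card_range, nsmul_eq_mul]
  congr 2
  unfold harmonic
  push_cast
  rfl

end Converse

/-! ### From one scheme to the optimal time at high power -/

section Limits

variable {K N : ℕ} {α : ℝ} (F : FadingModel K α)

/-- A lower bound on the optimal delivery time at a given power. -/
lemma FadingModel.le_optimalTimeAt {P : ℝ} (hP : 1 < P) {C C' : ℝ≥0}
    (hC : ∀ k t i, (F.law P).map (csiError t k i) ≤ ((C / F.mse k P : ℝ≥0) : ℝ≥0∞) • volume)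
    (hC' : ∀ k t, ∫⁻ ω, ∑ i, ‖(ω t).2 k i‖ₑ ^ 2 ∂(F.law P) ≤ C') {ε : ℝ} (hε : 0 < ε)
    {g : ℝ} (hg : ∀ k, Real.log (errorGain K C (F.mse k P)) ≤ g) {s D : ℕ} (hs : 1 ≤ s)
    (hsK : s ≤ K) (hD : 0 < D) (hN : D * s ≤ N) (M : ℝ) {ρ : ℝ} (hρ : 0 < ρ)
    (hb : (tailLoss ε C' + (1 + ε) * Real.log (1 + P)) + ((harmonic s : ℝ) - 1) *
      (ε * (tailLoss ε C' + (1 + ε) * Real.log (1 + P)) + ((1 + ε) * g + tailLoss ε C')) ≤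
        ρ * Real.log P) :
    ENNReal.ofReal (((harmonic s : ℝ) - M * s / D) / ρ) ≤ optimalTimeAt F N M P := by
  refine le_iInf₂ fun T hT => ?_
  rw [← ENNReal.ofReal_coe_nnreal]
  refine ENNReal.ofReal_le_ofReal ?_
  have hD0 : (0 : ℝ) < D := by exact_mod_cast hD
  have hH : (0 : ℝ) ≤ harmonic s := by exact_mod_cast (harmonic_pos (by omega)).le
  rw [div_le_iff₀ hρ]
  refine le_of_forall_pos_le_add fun δ' hδ' => ?_
  obtain ⟨δ, hδ, hδH⟩ : ∃ δ : ℝ, 0 < δ ∧ 2 * δ * (harmonic s : ℝ) ≤ δ' := by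
    refine ⟨δ' / (2 * ((harmonic s : ℝ) + 1)), by positivity, ?_⟩
    rw [mul_div_assoc', div_mul_eq_mul_div, div_le_iff₀ (by positivity)]
    nlinarith
  -- Files of at least 1/δ bits let δB absorb the constant of Fano's inequality, so the total
  -- relative loss is 2δ.
  obtain ⟨B, q, n, hB, hq, hn, S, hpow, herr⟩ := hT δ hδ (⌈δ⁻¹⌉₊ + 1)
  have hB1 : δ⁻¹ ≤ B := (Nat.le_ceil _).trans (by exact_mod_cast (by omega : ⌈δ⁻¹⌉₊ ≤ B))
  have hB0 : (0 : ℝ) < B := (inv_pos.2 hδ).trans_le hB1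
  have hδB : 1 ≤ δ * B := by
    have := mul_le_mul_of_nonneg_left hB1 hδ.le
    rwa [mul_inv_cancel₀ hδ.ne'] at this
  -- The placement maps some library into `Fin q`, so the cache alphabet is nonempty.
  have hq0 : 0 < q :=
    (Nat.zero_le _).trans_lt (S.place ⟨0, by omega⟩ fun _ _ => false).isLt
  have hl2 : 0 < Real.log 2 := Real.log_pos one_lt_two
  have hlogq : Real.log q ≤ M * B * Real.log 2 := by
    refine (Real.log_le_log (by exact_mod_cast hq0) hq).trans_eq ?_
    rw [Real.log_rpow two_pos]
  have hn' : n * Real.log P ≤ T * B * Real.log 2 := by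
    rw [Real.logb, mul_div_assoc', div_le_iff₀ hl2] at hn
    exact hn
  have h := S.converse F hP hC hC' hε hg hpow hδ.le herr hq0 hs hsK hN
  have h1 := mul_le_mul_of_nonneg_left hb (Nat.cast_nonneg (α := ℝ) n)
  have h2 := mul_le_mul_of_nonneg_left hn' hρ.le
  have h3 := mul_le_mul_of_nonneg_left (h1.trans (by linarith :
    (n : ℝ) * (ρ * Real.log P) ≤ ρ * (T * B * Real.log 2))) hD0.le
  have h4 := mul_le_mul_of_nonneg_left hlogq (Nat.cast_nonneg (α := ℝ) s)
  have h5 : D * ((1 - 2 * δ) * (B * Real.log 2)) * (harmonic s : ℝ) ≤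
      D * (B * Real.log 2 - (Real.log 2 + δ * (B * Real.log 2))) * (harmonic s : ℝ) := by
    gcongr
    nlinarith
  have h6 : (D * (1 - 2 * δ) * (harmonic s : ℝ) - s * M) * (B * Real.log 2) ≤
      (D * (ρ * T)) * (B * Real.log 2) := by
    linarith
  have h7 := le_of_mul_le_mul_right h6 (by positivity)
  have h8 : (harmonic s : ℝ) - M * s / D = (D * (harmonic s : ℝ) - s * M) / D := by
    field_simp
  rw [h8, div_le_iff₀ hD0]
  nlinarith

/-- The gain due to imperfect CSIT has exponent at most `α`. -/
lemma FadingModel.eventually_log_errorGain_le (hα : 0 ≤ α) (C : ℝ≥0) {η : ℝ} (hη : 0 < η) :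
    ∀ᶠ P in atTop, ∀ k, Real.log (errorGain K C (F.mse k P)) ≤ (α + η) * Real.log P := by
  rw [eventually_all]
  intro k
  -- Half of the slack η covers convergence of the CSIT exponent, the other half the constant factor
  -- of `errorGain`.
  have hlim := (F.quality k).eventually_lt_const (show α < α + η / 2 by linarith)
  have hconst := (Real.tendsto_log_atTop.const_mul_atTop (half_pos hη)).eventually_ge_atTop
    (Real.log (2 * (1 + K * C)))
  filter_upwards [hlim, hconst, eventually_gt_atTop 1] with P h1 h2 hP
  have hX : 0 < Real.log P := Real.log_pos hP
  set Q := Real.exp ((α + η / 2) * Real.log P) with hQ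
  have hQ1 : 1 ≤ Q := Real.one_le_exp (by positivity)
  have hdiv : ((C / F.mse k P : ℝ≥0) : ℝ) ≤ C * Q := by
    -- If the mean-square error is 0, the quotient is 0 by the convention for division.
    rcases eq_or_ne (F.mse k P) 0 with h0 | h0
    · rw [h0, div_zero, NNReal.coe_zero]; positivity
    · have hpos : (0 : ℝ) < F.mse k P := by exact_mod_cast pos_iff_ne_zero.2 h0
      rw [NNReal.coe_div, div_eq_mul_inv]
      gcongr
      rw [← Real.exp_log (inv_pos.2 hpos), Real.log_inv, hQ]
      refine Real.exp_le_exp.2 ?_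
      rw [← neg_div, div_lt_iff₀ hX] at h1
      exact h1.le
  have hle : errorGain K C (F.mse k P) ≤ 2 * (1 + K * C) * Q := by
    have := mul_le_mul_of_nonneg_left hdiv (Nat.cast_nonneg (α := ℝ) K)
    unfold errorGain
    linarith
  have hpos : 0 < errorGain K C (F.mse k P) := by unfold errorGain; positivity
  refine (Real.log_le_log hpos hle).trans ?_
  rw [Real.log_mul (by positivity) (by positivity), hQ, Real.log_exp]
  linarith

lemma eventually_log_one_add_le {η : ℝ} (hη : 0 < η) :
    ∀ᶠ P : ℝ in atTop, Real.log (1 + P) ≤ (1 + η) * Real.log P := by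
  filter_upwards [(Real.tendsto_log_atTop.const_mul_atTop hη).eventually_ge_atTop (Real.log 2),
    eventually_gt_atTop 1] with P h hP
  calc Real.log (1 + P) ≤ Real.log (2 * P) := Real.log_le_log (by linarith) (by linarith)
    _ = Real.log 2 + Real.log P := Real.log_mul two_ne_zero (by linarith)
    _ ≤ (1 + η) * Real.log P := by linarith

/-- The bound on the optimal delivery time up to a slack `η` in the exponents. -/
lemma FadingModel.le_optimalTime (hα : 0 ≤ α) {s D : ℕ} (hs : 1 ≤ s) (hsK : s ≤ K) (hD : 0 < D)
    (hN : D * s ≤ N) (M : ℝ) {η : ℝ} (hη : 0 < η) :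
    ENNReal.ofReal (((harmonic s : ℝ) - M * s / D) / ((η + (1 + η) * (1 + η)) +
      ((harmonic s : ℝ) - 1) * (η * (η + (1 + η) * (1 + η)) + ((1 + η) * (α + η) + η)))) ≤
      optimalTime F N M := by
  obtain ⟨C, hC⟩ := F.error_density
  obtain ⟨C', hC'⟩ := F.secondMoment_le
  have hH : (1 : ℝ) ≤ harmonic s := by
    have h : (harmonic 1 : ℝ) ≤ harmonic s := by
      exact_mod_cast Finset.sum_le_sum_of_subset_of_nonneg
        (Finset.range_subset_range.2 hs) fun i _ _ => by positivity
    simpa using h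
  refine le_liminf_of_le (by isBoundedDefault) ?_
  filter_upwards [F.eventually_log_errorGain_le hα C hη, eventually_log_one_add_le hη,
    (Real.tendsto_log_atTop.const_mul_atTop hη).eventually_ge_atTop (tailLoss η C'),
    eventually_gt_atTop 1] with P h1 h2 h3 hP
  have hH' : 0 ≤ (harmonic s : ℝ) - 1 := by linarith
  -- The same η serves as the tail exponent and as the slack in every logarithmic estimate, so that
  -- one limit removes all losses.
  refine F.le_optimalTimeAt hP (hC P hP) (hC' P hP) hη h1 hs hsK hD hN M (by positivity) ?_
  have hU : tailLoss η C' + (1 + η) * Real.log (1 + P) ≤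
      (η + (1 + η) * (1 + η)) * Real.log P := by
    have := mul_le_mul_of_nonneg_left h2 (by linarith : 0 ≤ 1 + η)
    linarith
  have hV : η * (tailLoss η C' + (1 + η) * Real.log (1 + P)) +
      ((1 + η) * ((α + η) * Real.log P) + tailLoss η C') ≤
      (η * (η + (1 + η) * (1 + η)) + ((1 + η) * (α + η) + η)) * Real.log P := by
    have := mul_le_mul_of_nonneg_left hU hη.le
    linarith
  have := mul_le_mul_of_nonneg_left hV hH'
  linarith

end Limits

theorem lemma1 (K N : ℕ) (hKN : K ≤ N) (M : ℝ) (hM : 0 ≤ M)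
    (α : ℝ) (hα : α ∈ Set.Icc (0 : ℝ) 1) (F : FadingModel K α) :
    ∀ s : ℕ, 1 ≤ s → s ≤ K → (s : ℝ) * M ≤ N →
      ENNReal.ofReal ((1 / ((harmonic s : ℝ) * α + 1 - α)) *
          ((harmonic s : ℝ) - M * s / ((N / s : ℕ) : ℝ)))
        ≤ optimalTime F N M := by
  intro s hs hsK _
  have hpos : (0 : ℝ) < (harmonic s : ℝ) * α + 1 - α := by
    have hH : (0 : ℝ) < harmonic s := by exact_mod_cast harmonic_pos (by omega)
    -- For α < 1 the term 1 - α is positive; for α = 1 the denominator is the harmonic number.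
    rcases hα.2.lt_or_eq with h | h
    · nlinarith [hα.1, mul_nonneg hH.le hα.1]
    · rw [h]; linarith
  -- A polynomial in η whose value at 0 is 1 + (H_s - 1) α, so the bounds with slack tend to the
  -- claimed one.
  let ρ : ℝ → ℝ := fun η => (η + (1 + η) * (1 + η)) +
    ((harmonic s : ℝ) - 1) * (η * (η + (1 + η) * (1 + η)) + ((1 + η) * (α + η) + η))
  have hρ0 : ρ 0 = (harmonic s : ℝ) * α + 1 - α := by simp only [ρ]; ring
  have hρ : Tendsto ρ (𝓝[>] 0) (𝓝 ((harmonic s : ℝ) * α + 1 - α)) := by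
    rw [← hρ0]
    exact (show Continuous ρ by fun_prop).continuousAt.tendsto.mono_left nhdsWithin_le_nhds
  have hlim := ENNReal.tendsto_ofReal
    ((tendsto_const_nhds (x := (harmonic s : ℝ) - M * s / ((N / s : ℕ) : ℝ))).div hρ hpos.ne')
  rw [one_div_mul_eq_div]
  refine le_of_tendsto hlim ?_
  filter_upwards [self_mem_nhdsWithin] with η hη
  -- The number of rounds is D = ⌊N/s⌋, positive because s ≤ K ≤ N.
  exact F.le_optimalTime hα.1 hs hsK (Nat.div_pos (hsK.trans hKN) (by omega))
    (Nat.div_mul_le_self N s) M hη
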